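/- Work over $\mathbb C$. Let $\underline p=(p_1\ge\dots\ge p_r>0)$ be a partition of $N$, let $V$ have basis $e_{(a,i)}$ ($1\le a\le r$, $1\le i\le p_a$), with matrix units $E_{\alpha\beta}$, and let $\mathfrak g=\mathfrak{gl}(V)=\mathfrak{gl}_N$ with the trace form $(x|y)=\mathrm{tr}(xy)$. Let $f e_{(a,i)}=e_{(a,i+1)}$ for $i<p_a$, $f e_{(a,p_a)}=0$, let $\chi e_{(a,i)}=\big(\tfrac{p_a+1}2-i\big)e_{(a,i)}$, and let $\mathfrak g=\bigoplus_{k\in\frac12\mathbb Z}\mathfrak g_k$ be the eigenspace decomposition of $\mathrm{ad}\,\chi$. For a subspace $\mathfrak a\subset\mathfrak g$ let $\mathcal V(\mathfrak a)=S(\mathbb C[\partial]\mathfrak a)$ be the algebra of differential polynomials over $\mathfrak a$. Let $\{\cdot_\lambda\cdot\}$ be the Poisson vertex algebra $\lambda$-bracket on $\mathcal V(\mathfrak g)$ with $\{a_\lambda b\}=[a,b]+(a|b)\lambda$ for $a,b\in\mathfrak g$, and let $\rho:\mathcal V(\mathfrak g)\to\mathcal V(\mathfrak g_{\le\frac12})$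 be the differential algebra homomorphism with $\rho(a)=\pi_{\le\frac12}(a)+(f|a)$ for $a\in\mathfrak g$, where $\pi_{\le\frac12}$ is the projection with kernel $\mathfrak g_{\ge1}$. The classical $\mathcal W$-algebra is $$\mathcal W=\mathcal W(\mathfrak{gl}_N,\underline p)=\{w\in\mathcal V(\mathfrak g_{\le\frac12})\mid\rho\{a_\lambda w\}=0\ \text{for all}\ a\in\mathfrak g_{\ge\frac12}\}.$$ Let $\mathfrak g^f$ be the centralizer of $f$ and, for $1\le a,b\le r$ and $0\le i<\min\{p_a,p_b\}$, let $f_{ab;i}=\sum_{j=0}^iE_{(a,p_a+j-i),(b,j+1)}\in\mathfrak g^f$. Let $U$ be the span of the $E_{(b,1),(a,p_a-i)}$ for the same $a,b,i$, let $U^\perp$ be its orthogonal complement in $\mathfrak g_{\le\frac12}$, and let $\langle U^\perp\rangle$ be the differential ideal of $\mathcal V(\mathfrak g_{\le\frac12})$ generated by $U^\perp$. Then for every $q\in\mathcal V(\mathfrak g^f)$ there is a unique $w(q)\in\mathcal W$ with $w(q)-q\in\langle U^\perp\rangle$, and every element of $\mathcal W$ equals $w(q)$ for a unique $q\in\mathcal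 V(\mathfrak g^f)$. Let $w_{ab;i}=w(f_{ab;i})$, and let $W(\partial)$ be the $r\times r$ matrix with $(a,b)$ entry $\sum_{i=0}^{\min\{p_a,p_b\}-1}w_{ba;i}(-\partial)^i$. Let $A(\partial)$ be the matrix differential operator, with rows and columns indexed by the basis of $V$, whose $(\alpha,\beta)$ entry is $\delta_{\alpha\beta}\partial+E_{\beta\alpha}$ with $E_{\beta\alpha}\in\mathfrak g\subset\mathcal V(\mathfrak g)$, and let $\rho A(\partial)$ be obtained by applying $\rho$ to its coefficients. Let $V_+$ and $V_-$ be the spans of the $e_{(a,1)}$ and of the $e_{(a,p_a)}$, respectively; with these bases, operators $V_-\to V_+$, $V_+\to V_-$, $V_\pm\to V_\pm$ are written as $r\times r$ matrices. Let $s$ be the number of distinct parts of $\underline p$, and for $1\le k\le s$ let $V_{\pm,k}$ be the span of the above basis vectors of $V_\pm$ with $p_a$ equal to the $k$-th largest distinct part; let $V_{\pm,\ge k}=\bigoplus_{l\ge k}V_{\pm,l}$. Write $\mathbb 1_Y$ for the inclusion of, or the coordinate projection onto, a coordinate subspace $Y$, and $(\cdot)_+$ for the part of a pseudodifferential operator with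 non-negative powers of $\partial$. Then the quasideterminant $$T(\partial)=|\rho A(\partial)|_{V_+,V_-}=\big(\mathbb 1_{V_-}(\rho A(\partial))^{-1}\mathbb 1_{V_+}\big)^{-1}$$ exists over $\mathcal V(\mathfrak g_{\le\frac12})((\partial^{-1}))$. Put $T^{(s)}=T$, $W^{(k)}=\mathbb 1_{V_{+,\ge k}}T^{(k)}\mathbb 1_{V_{-,\ge k}}$ for $1\le k\le s$ and, for $k=s-1,\dots,1$, $$T^{(k)}=\Big(\mathbb 1_{V_+}-\mathbb 1_{V_{+,k}}\big(T^{(k+1)}(W^{(k+1)})^{-1}\big)_+\Big)\,T^{(k+1)}\,\Big(\mathbb 1_{V_-}-\big((W^{(k+1)})^{-1}T^{(k+1)}\big)_+\mathbb 1_{V_{-,k}}\Big).$$ This recursion is well defined: for $1\le k\le s$ the entries of $T^{(k)}$ are differential operators over $\mathcal V(\mathfrak g_{\le\frac12})$, and $W^{(k)}$ is invertible over $\mathcal V(\mathfrak g_{\le\frac12})((\partial^{-1}))$. Its last term is $$W^{(1)}(\partial)=-(-\partial)^{\underline p}+W(\partial),\qquad(-\partial)^{\underline p}=\mathrm{diag}\big((-\partial)^{p_1},\dots,(-\partial)^{p_r}\big).$$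 -/

import Mathlib

namespace WGL

noncomputable section

open scoped Differential

/-- The additive group of formal sums `∑ₙ aₙ ∂ⁿ` over `n : ℤ` with `aₙ = 0` for `n` large. -/
def psiAddSubgroup (R : Type*) [AddCommGroup R] : AddSubgroup (ℤ → R) where
  carrier := {a | ∃ M : ℤ, ∀ n, M < n → a n = 0}
  zero_mem' := ⟨0, fun _ _ => rfl⟩
  add_mem' := by
    rintro a b ⟨M, hM⟩ ⟨N, hN⟩
    refine ⟨max M N, fun n hn => ?_⟩
    simp [hM n (lt_of_le_of_lt (le_max_left _ _) hn), hN n (lt_of_le_of_lt (le_max_right _ _) hn)]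
  neg_mem' := by
    rintro a ⟨M, hM⟩
    exact ⟨M, fun n hn => by simp [hM n hn]⟩

/-- Pseudodifferential operators `R((∂⁻¹))` over a commutative differential ring `R`. -/
def PsiDO (R : Type*) [CommRing R] : Type _ := psiAddSubgroup R

namespace PsiDO

variable {R : Type*} [CommRing R]

instance : AddCommGroup (PsiDO R) := inferInstanceAs (AddCommGroup (psiAddSubgroup R))

/-- The coefficient of `∂ⁿ`, with coefficients written on the left. -/
def coeff (a : PsiDO R) (n : ℤ) : R := a.1 n

@[ext] theorem ext {a b : PsiDO R} (h : ∀ n, a.coeff n = b.coeff n) : a = b :=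
  Subtype.ext (funext h)

/-- `a` has order at most `A`. -/
def OrdLE (a : PsiDO R) (A : ℤ) : Prop := ∀ n, A < n → a.coeff n = 0

theorem exists_ordLE (a : PsiDO R) : ∃ A, a.OrdLE A := a.2

@[simp] theorem coeff_zero (n : ℤ) : (0 : PsiDO R).coeff n = 0 := rfl
@[simp] theorem coeff_add (a b : PsiDO R) (n : ℤ) : (a + b).coeff n = a.coeff n + b.coeff n := rfl
@[simp] theorem coeff_neg (a : PsiDO R) (n : ℤ) : (-a).coeff n = -a.coeff n := rfl
@[simp] theorem coeff_sub (a b : PsiDO R) (n : ℤ) : (a - b).coeff n = a.coeff n - b.coeff n := rfl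

/-- The monomial `x ∂ᵐ`. -/
def mono (m : ℤ) (x : R) : PsiDO R :=
  ⟨Pi.single m x, m, fun n hn => by simp [hn.ne']⟩

theorem coeff_mono (m : ℤ) (x : R) (n : ℤ) : (mono m x).coeff n = if n = m then x else 0 := by
  simp [mono, coeff, Pi.single_apply]

theorem ordLE_mono (m : ℤ) (x : R) : (mono m x).OrdLE m :=
  fun n hn => by simp [coeff_mono, hn.ne']

/-- The element `∂`. -/
def D : PsiDO R := mono 1 1

/-- The operator of multiplication by `x : R`. -/
def const (x : R) : PsiDO R := mono 0 x

/-- The positive part `a₊`, which keeps the coefficients of `∂ⁿ` with `n ≥ 0`. -/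
def posPart (a : PsiDO R) : PsiDO R :=
  ⟨fun n => if 0 ≤ n then a.coeff n else 0, by
    obtain ⟨A, hA⟩ := a.exists_ordLE
    exact ⟨A, fun n hn => by simp [hA n hn]⟩⟩

/-- `a` lies in the subring `R[∂]` of differential operators. -/
def IsDiffOp (a : PsiDO R) : Prop := ∀ n : ℤ, n < 0 → a.coeff n = 0

/-- Apply a ring homomorphism to all coefficients. -/
def map {S : Type*} [CommRing S] (f : R →+* S) (a : PsiDO R) : PsiDO S :=
  ⟨fun n => f (a.coeff n), by
    obtain ⟨A, hA⟩ := a.exists_ordLE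
    exact ⟨A, fun n hn => by simp [hA n hn]⟩⟩

instance : One (PsiDO R) := ⟨mono 0 1⟩

/-- An additive property that holds for monomials and in low order holds everywhere. -/
theorem induct {P : PsiDO R → Prop} (d : ℤ) (hadd : ∀ a b, P a → P b → P (a + b))
    (hmono : ∀ m x, P (mono m x)) (hlow : ∀ a, a.OrdLE d → P a) (a : PsiDO R) : P a := by
  obtain ⟨A, hA⟩ := a.exists_ordLE
  obtain ⟨k, hk⟩ : ∃ k : ℕ, A ≤ d + k := ⟨(A - d).toNat, by omega⟩
  replace hA : a.OrdLE (d + k) := fun n hn => hA n (by omega)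
  clear hk
  induction k generalizing a with
  | zero => exact hlow a (by simpa using hA)
  | succ k ih =>
    rw [← sub_add_cancel a (mono (d + k + 1) (a.coeff (d + k + 1)))]
    refine hadd _ _ (ih _ fun n hn => ?_) (hmono _ _)
    rw [coeff_sub, coeff_mono]
    split_ifs with h
    · rw [h, sub_self]
    · rw [sub_zero]
      exact hA n (by push_cast; omega)

variable [Differential R]

/-- The iterated derivative of an element of `R`. -/
def der (n : ℕ) (x : R) : R := (Differential.deriv : Derivation ℤ R R)^[n] x

theorem der_succ (n : ℕ) (x : R) : der (n + 1) x = (der n x)′ := Function.iterate_succ_apply' _ _ _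

@[simp] theorem der_zero_left (x : R) : der 0 x = x := rfl

theorem der_add_left (m n : ℕ) (x : R) : der (m + n) x = der m (der n x) :=
  Function.iterate_add_apply _ _ _ _

@[simp] theorem der_zero (n : ℕ) : der n (0 : R) = 0 := by
  induction n with
  | zero => rfl
  | succ n ih => rw [der_succ, ih, map_zero]

theorem der_add (n : ℕ) (x y : R) : der n (x + y) = der n x + der n y := by
  induction n with
  | zero => rfl
  | succ n ih => simp [der_succ, ih]

theorem der_one (n : ℕ) : der n (1 : R) = if n = 0 then 1 else 0 := by
  cases n with
  | zero => rfl
  | succ n =>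
    rw [der_add_left]
    simp [der_succ]

theorem der_zsmul (n : ℕ) (k : ℤ) (x : R) : der n (k • x) = k • der n x := by
  induction n with
  | zero => rfl
  | succ n ih => simp only [der_succ, ih, map_zsmul]

theorem der_mul (n : ℕ) (x y : R) :
    der n (x * y) = ∑ ij ∈ Finset.HasAntidiagonal.antidiagonal n, n.choose ij.1 • (der ij.1 x * der ij.2 y) := by
  induction n with
  | zero => simp
  | succ n ih =>
    rw [Finset.sum_antidiagonal_choose_succ_nsmul (fun i j => der i x * der j y), der_succ, ih,
      map_sum, ← Finset.sum_add_distrib]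
    refine Finset.sum_congr rfl fun ij hij => ?_
    have h : n.choose ij.2 = n.choose ij.1 := by
      rw [Finset.HasAntidiagonal.mem_antidiagonal] at hij
      rw [← hij, Nat.add_comm ij.1, Nat.choose_symm_add]
    simp only [map_nsmul, Derivation.leibniz, smul_eq_mul, der_succ, h]
    rw [← smul_add, mul_comm (der ij.2 y)]

/-- A summand of the coefficient of `∂ᵏ` in `a ∘ b`. -/
def mulTerm (a b : PsiDO R) (k : ℤ) (x : ℤ × ℕ) : R :=
  Ring.choose x.1 x.2 • (a.coeff x.1 * der x.2 (b.coeff (k - x.1 + x.2)))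

theorem support_mulTerm {a b : PsiDO R} {A B : ℤ} (ha : a.OrdLE A) (hb : b.OrdLE B) (k : ℤ) :
    Function.support (mulTerm a b k) ⊆
      ((Finset.Icc (k - B) A ×ˢ Finset.range (A + B - k + 1).toNat : Finset (ℤ × ℕ)) :
        Set (ℤ × ℕ)) := by
  rintro ⟨m, j⟩ h
  rw [Function.mem_support] at h
  have h1 : m ≤ A := by
    by_contra hm
    exact h (by simp [mulTerm, ha m (not_le.1 hm)])
  have h2 : k - m + j ≤ B := by
    by_contra hm
    exact h (by simp [mulTerm, hb _ (not_le.1 hm)])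
  simp only [Finset.coe_product, Set.mem_prod, Finset.coe_Icc, Set.mem_Icc, Finset.coe_range,
    Set.mem_Iio]
  omega

theorem finite_mulTerm (a b : PsiDO R) (k : ℤ) : (Function.support (mulTerm a b k)).Finite := by
  obtain ⟨A, hA⟩ := a.exists_ordLE
  obtain ⟨B, hB⟩ := b.exists_ordLE
  exact (Finset.finite_toSet _).subset (support_mulTerm hA hB k)

theorem finsum_mulTerm_eq_zero {a b : PsiDO R} {A B : ℤ} (ha : a.OrdLE A) (hb : b.OrdLE B)
    {k : ℤ} (hk : A + B < k) : ∑ᶠ x, mulTerm a b k x = 0 := by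
  rw [finsum_eq_sum_of_support_subset _ (support_mulTerm ha hb k), Finset.Icc_eq_empty (by omega)]
  simp

/-- Composition of operators:
`(∑ aₘ ∂ᵐ) ∘ (∑ bₙ ∂ⁿ) = ∑_{m,n} ∑_{j ≥ 0} (m choose j) aₘ bₙ⁽ʲ⁾ ∂^{m+n-j}`. -/
instance : Mul (PsiDO R) :=
  ⟨fun a b => ⟨fun k => ∑ᶠ x : ℤ × ℕ, mulTerm a b k x, by
    obtain ⟨A, hA⟩ := a.exists_ordLE
    obtain ⟨B, hB⟩ := b.exists_ordLE
    exact ⟨A + B, fun k hk => finsum_mulTerm_eq_zero hA hB hk⟩⟩⟩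

theorem coeff_mul (a b : PsiDO R) (k : ℤ) :
    (a * b).coeff k = ∑ᶠ x : ℤ × ℕ,
      Ring.choose x.1 x.2 • (a.coeff x.1 * der x.2 (b.coeff (k - x.1 + x.2))) := rfl

theorem OrdLE.mul {a b : PsiDO R} {A B : ℤ} (ha : a.OrdLE A) (hb : b.OrdLE B) :
    (a * b).OrdLE (A + B) :=
  fun _ hk => finsum_mulTerm_eq_zero ha hb hk

theorem psi_add_mul (a b c : PsiDO R) : (a + b) * c = a * c + b * c := by
  ext k
  change ∑ᶠ x, mulTerm (a + b) c k x = ∑ᶠ x, mulTerm a c k x + ∑ᶠ x, mulTerm b c k x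
  rw [← finsum_add_distrib (finite_mulTerm a c k) (finite_mulTerm b c k)]
  exact finsum_congr fun x => by simp [mulTerm, add_mul]

theorem psi_mul_add (a b c : PsiDO R) : a * (b + c) = a * b + a * c := by
  ext k
  change ∑ᶠ x, mulTerm a (b + c) k x = ∑ᶠ x, mulTerm a b k x + ∑ᶠ x, mulTerm a c k x
  rw [← finsum_add_distrib (finite_mulTerm a b k) (finite_mulTerm a c k)]
  exact finsum_congr fun x => by simp [mulTerm, mul_add, der_add]

theorem coeff_mono_mul (m : ℤ) (x : R) {b : PsiDO R} {B : ℤ} (hb : b.OrdLE B) (t : ℕ) :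
    (mono m x * b).coeff (m + B - t) = ∑ ij ∈ Finset.HasAntidiagonal.antidiagonal t,
      Ring.choose m ij.2 • (x * der ij.2 (b.coeff (B - ij.1))) := by
  rw [coeff_mul, finsum_eq_sum_of_support_subset (s := (Finset.HasAntidiagonal.antidiagonal t).image
    fun ij => (m, ij.2))]
  · rw [Finset.sum_image]
    · refine Finset.sum_congr rfl fun ij hij => ?_
      rw [Finset.HasAntidiagonal.mem_antidiagonal] at hij
      have : m + B - (t : ℤ) - m + (ij.2 : ℤ) = B - ij.1 := by omega
      simp [coeff_mono, this]
    · rintro ⟨i, j⟩ hi ⟨i', j'⟩ hi' h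
      simp only [Finset.mem_coe,
        Finset.HasAntidiagonal.mem_antidiagonal, Prod.mk.injEq, true_and] at hi hi' h ⊢
      omega
  · rintro ⟨m', j⟩ h
    have h1 : m' = m := by
      by_contra hm
      exact h (by simp [coeff_mono, hm])
    subst h1
    have h2 : m' + B - (t : ℤ) - m' + j ≤ B := by
      by_contra hm
      exact h (by simp [hb _ (not_le.1 hm)])
    simp only [Finset.coe_image, Set.mem_image, Finset.mem_coe, Finset.HasAntidiagonal.mem_antidiagonal]
    exact ⟨(t - j, j), by simp; omega, rfl⟩

theorem coeff_mul_mono {a : PsiDO R} {A : ℤ} (ha : a.OrdLE A) (n : ℤ) (y : R) (t : ℕ) :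
    (a * mono n y).coeff (A + n - t) = ∑ ij ∈ Finset.HasAntidiagonal.antidiagonal t,
      Ring.choose (A - ij.1) ij.2 • (a.coeff (A - ij.1) * der ij.2 y) := by
  rw [coeff_mul, finsum_eq_sum_of_support_subset (s := (Finset.HasAntidiagonal.antidiagonal t).image
    fun ij => (A - (ij.1 : ℤ), ij.2))]
  · rw [Finset.sum_image]
    · refine Finset.sum_congr rfl fun ij hij => ?_
      rw [Finset.HasAntidiagonal.mem_antidiagonal] at hij
      have : A + n - (t : ℤ) - (A - ij.1) + (ij.2 : ℤ) = n := by omega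
      simp [coeff_mono, this]
    · rintro ⟨i, j⟩ hi ⟨i', j'⟩ hi' h
      simp only [Prod.mk.injEq] at h ⊢
      omega
  · rintro ⟨m', j⟩ h
    have h1 : m' ≤ A := by
      by_contra hm
      exact h (by simp [ha _ (not_le.1 hm)])
    have h2 : A + n - (t : ℤ) - m' + j = n := by
      by_contra hm
      exact h (by simp [coeff_mono, hm])
    simp only [Finset.coe_image, Set.mem_image, Finset.mem_coe, Finset.HasAntidiagonal.mem_antidiagonal]
    exact ⟨(t - j, j), by simp; omega, by simp; omega⟩

theorem coeff_mono_mul_mono (m n : ℤ) (x y : R) (i : ℕ) :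
    (mono m x * mono n y).coeff (m + n - i) = Ring.choose m i • (x * der i y) := by
  rw [coeff_mono_mul m x (ordLE_mono n y), Finset.sum_eq_single (0, i)]
  · simp [coeff_mono]
  · rintro ⟨u, v⟩ huv h
    rw [Finset.HasAntidiagonal.mem_antidiagonal] at huv
    have : u ≠ 0 := by
      rintro rfl
      simp_all
    simp [coeff_mono, this]
  · simp

theorem choose_vandermonde (m n : ℤ) (i j : ℕ) :
    Ring.choose (m + n - i) j * Ring.choose m i =
      ∑ vp ∈ Finset.HasAntidiagonal.antidiagonal j,
        Ring.choose m (i + vp.1) * Ring.choose n vp.2 * ((i + vp.1).choose i : ℤ) := by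
  rw [show m + n - (i : ℤ) = (m - i) + n by ring, Ring.add_choose_eq j (Commute.all _ _),
    Finset.sum_mul]
  refine Finset.sum_congr rfl fun vp _ => ?_
  have h := Ring.choose_add_smul_choose (m - (i : ℤ)) vp.1 i
  rw [sub_add_cancel, nsmul_eq_mul, Nat.add_comm vp.1 i] at h
  linear_combination -(Ring.choose n vp.2) * h

theorem mono_assoc (m n l : ℤ) (x y z : R) :
    mono m x * mono n y * mono l z = mono m x * (mono n y * mono l z) := by
  have h1 := (ordLE_mono m x).mul (ordLE_mono n y)
  have h2 := (ordLE_mono n y).mul (ordLE_mono l z)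
  ext k
  by_cases hk : m + n + l < k
  · rw [(h1.mul (ordLE_mono l z)) k hk, ((ordLE_mono m x).mul h2) k (by omega)]
  obtain ⟨t, rfl⟩ : ∃ t : ℕ, k = m + n + l - t := ⟨(m + n + l - k).toNat, by omega⟩
  rw [coeff_mul_mono h1, show m + n + l - (t : ℤ) = m + (n + l) - t by ring, coeff_mono_mul m x h2]
  simp only [coeff_mono_mul_mono, der_zsmul, der_mul, Finset.mul_sum, Finset.smul_sum,
    ← der_add_left]
  have hL : ∀ ij : ℕ × ℕ,
      Ring.choose (m + n - (ij.1 : ℤ)) ij.2 • (Ring.choose m ij.1 • (x * der ij.1 y) * der ij.2 z) =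
      ∑ vp ∈ Finset.HasAntidiagonal.antidiagonal ij.2,
        (Ring.choose m (ij.1 + vp.1) * Ring.choose n vp.2 * ((ij.1 + vp.1).choose ij.1 : ℤ)) •
          (x * der ij.1 y * der (vp.1 + vp.2) z) := by
    intro ij
    rw [smul_mul_assoc, smul_smul, choose_vandermonde, Finset.sum_smul]
    refine Finset.sum_congr rfl fun vp hvp => ?_
    rw [Finset.HasAntidiagonal.mem_antidiagonal.1 hvp]
  rw [Finset.sum_congr rfl fun ij _ => hL ij, Finset.sum_sigma', Finset.sum_sigma']
  refine Finset.sum_nbij' (fun s => ⟨(s.2.2, s.1.1 + s.2.1), (s.1.1, s.2.1)⟩)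
    (fun s => ⟨(s.2.1, s.2.2 + s.1.1), (s.2.2, s.1.1)⟩) ?_ ?_ ?_ ?_ ?_
  · rintro ⟨⟨i, j⟩, ⟨v, p⟩⟩ h
    simp only [Finset.mem_sigma, Finset.HasAntidiagonal.mem_antidiagonal] at h ⊢
    exact ⟨by omega, by trivial⟩
  · rintro ⟨⟨i, j⟩, ⟨v, p⟩⟩ h
    simp only [Finset.mem_sigma, Finset.HasAntidiagonal.mem_antidiagonal] at h ⊢
    exact ⟨by omega, by trivial⟩
  · rintro ⟨⟨i, j⟩, ⟨v, p⟩⟩ h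
    simp only [Finset.mem_sigma, Finset.HasAntidiagonal.mem_antidiagonal] at h ⊢
    obtain ⟨_, rfl⟩ := h
    rfl
  · rintro ⟨⟨i, j⟩, ⟨v, p⟩⟩ h
    simp only [Finset.mem_sigma, Finset.HasAntidiagonal.mem_antidiagonal] at h ⊢
    obtain ⟨_, rfl⟩ := h
    rfl
  · rintro ⟨⟨i, j⟩, ⟨v, p⟩⟩ h
    simp only [zsmul_eq_mul, nsmul_eq_mul]
    push_cast
    ring

theorem psi_mul_assoc (a b c : PsiDO R) : a * b * c = a * (b * c) := by
  obtain ⟨B, hB⟩ := b.exists_ordLE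
  obtain ⟨C, hC⟩ := c.exists_ordLE
  ext k
  refine induct (P := fun a => (a * b * c).coeff k = (a * (b * c)).coeff k)
    (k - B - C - 1) ?_ ?_ ?_ a
  · intro a a' h h'
    simp only [psi_add_mul, coeff_add, h, h']
  · intro m x
    refine induct (P := fun b => (mono m x * b * c).coeff k = (mono m x * (b * c)).coeff k)
      (k - m - C - 1) ?_ ?_ ?_ b
    · intro b b' h h'
      simp only [psi_add_mul, psi_mul_add, coeff_add, h, h']
    · intro n y
      refine induct (P := fun c => (mono m x * mono n y * c).coeff k =
        (mono m x * (mono n y * c)).coeff k) (k - m - n - 1) ?_ ?_ ?_ c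
      · intro b b' h h'
        simp only [psi_mul_add, coeff_add, h, h']
      · intro l z
        rw [mono_assoc]
      · intro c hc
        rw [(((ordLE_mono m x).mul (ordLE_mono n y)).mul hc) k (by omega),
          ((ordLE_mono m x).mul ((ordLE_mono n y).mul hc)) k (by omega)]
    · intro b hb
      rw [(((ordLE_mono m x).mul hb).mul hC) k (by omega),
        ((ordLE_mono m x).mul (hb.mul hC)) k (by omega)]
  · intro a ha
    rw [((ha.mul hB).mul hC) k (by omega), (ha.mul (hB.mul hC)) k (by omega)]

theorem psi_one_mul (a : PsiDO R) : 1 * a = a := by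
  ext k
  rw [coeff_mul, finsum_eq_single _ ((0 : ℤ), 0)]
  · simp [show (1 : PsiDO R) = mono 0 1 from rfl, coeff_mono]
  · rintro ⟨m, j⟩ h
    by_cases hm : m = 0
    · subst hm
      have : j ≠ 0 := by
        rintro rfl
        exact h rfl
      simp [Ring.choose_zero_ite, this]
    · simp [show (1 : PsiDO R) = mono 0 1 from rfl, coeff_mono, hm]

theorem psi_mul_one (a : PsiDO R) : a * 1 = a := by
  ext k
  rw [coeff_mul, finsum_eq_single _ (k, 0)]
  · simp [show (1 : PsiDO R) = mono 0 1 from rfl, coeff_mono]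
  · rintro ⟨m, j⟩ h
    simp only [show (1 : PsiDO R) = mono 0 1 from rfl, coeff_mono]
    split_ifs with hm
    · have : j ≠ 0 := by
        rintro rfl
        exact h (by simp; omega)
      simp [der_one, this]
    · simp

theorem psi_zero_mul (a : PsiDO R) : 0 * a = 0 := by
  have h := psi_add_mul 0 0 a
  rwa [add_zero, left_eq_add] at h

theorem psi_mul_zero (a : PsiDO R) : a * 0 = 0 := by
  have h := psi_mul_add a 0 0
  rwa [add_zero, left_eq_add] at h

instance : Ring (PsiDO R) where
  left_distrib := psi_mul_add
  right_distrib := psi_add_mul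
  zero_mul := psi_zero_mul
  mul_zero := psi_mul_zero
  mul_assoc := psi_mul_assoc
  one_mul := psi_one_mul
  mul_one := psi_mul_one
  neg_add_cancel := neg_add_cancel
  zsmul := (· • ·)
  zsmul_zero' := zero_zsmul
  zsmul_succ' n a := by exact SubNegMonoid.zsmul_succ' n a
  zsmul_neg' n a := by exact SubNegMonoid.zsmul_neg' n a
  nsmul := (· • ·)
  nsmul_zero := zero_nsmul
  nsmul_succ n a := by exact AddMonoid.nsmul_succ n a
  sub_eq_add_neg := sub_eq_add_neg

end PsiDO

/-! ### Differential polynomials and the classical affine Poisson vertex algebra of `gl` -/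

/-- The algebra of differential polynomials over `ℂ` in variables indexed by `σ`; the variable
`(x, n)` stands for the `n`-th derivative of `x`. -/
abbrev DiffPoly (σ : Type*) : Type _ := MvPolynomial (σ × ℕ) ℂ

/-- The derivation `∂` with `∂ x⁽ⁿ⁾ = x⁽ⁿ⁺¹⁾`. -/
instance (σ : Type*) : Differential (DiffPoly σ) where
  deriv := (MvPolynomial.mkDerivation ℂ fun y : σ × ℕ =>
    (MvPolynomial.X (y.1, y.2 + 1) : DiffPoly σ)).restrictScalars ℤ

/-- The operator `λ + ∂` on `R[λ]`, where `∂` acts on the coefficients. -/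
def lamD {R : Type*} [CommRing R] [Differential R] (q : Polynomial R) : Polynomial R :=
  Polynomial.X * q + Differential.mapCoeffs q

section Affine

variable {n : Type*} [Fintype n] [DecidableEq n]

/-- The matrix unit `E_{αβ}`. -/
def matUnit (x : n × n) : Matrix n n ℂ := Matrix.single x.1 x.2 1

/-- The inclusion of `gl` in `𝒱(gl) = S(ℂ[∂] gl)`; the variables of `𝒱(gl)` are the matrix units. -/
def emb (a : Matrix n n ℂ) : DiffPoly (n × n) :=
  ∑ x : n × n, MvPolynomial.C (a x.1 x.2) * MvPolynomial.X (x, 0)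

/-- The `λ`-bracket of the classical affine Poisson vertex algebra `𝒱(gl)`, with
`{a_λ b} = [a,b] + tr(ab) λ` on `gl`, extended by sesquilinearity and the Leibniz rules, that is
`{F_λ G} = ∑ (∂G/∂y⁽ʲ⁾) (λ+∂)ʲ {x_{λ+∂} y}_→ (-λ-∂)ⁱ (∂F/∂x⁽ⁱ⁾)`. -/
def affineBracket (F G : DiffPoly (n × n)) : Polynomial (DiffPoly (n × n)) :=
  ∑ x ∈ F.vars, ∑ y ∈ G.vars,
    let q : Polynomial (DiffPoly (n × n)) :=
      (fun z => -lamD z)^[x.2] (Polynomial.C (MvPolynomial.pderiv x F))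
    Polynomial.C (MvPolynomial.pderiv y G) *
      lamD^[y.2] (Polynomial.C (emb ⁅matUnit x.1, matUnit y.1⁆) * q +
        Polynomial.C (MvPolynomial.C (matUnit x.1 * matUnit y.1).trace) * lamD q)

end Affine

/-! ### Quasideterminants -/

section Quasidet

variable {m n A : Type*} [Fintype m] [DecidableEq m] [Fintype n] [DecidableEq n] [Ring A]

/-- Existence of the quasideterminant `|M|_{U,W}`, where `U` and `W` are the spans of the basis
vectors with indices `u a`, respectively `w a`. -/
def QuasidetExists (M : Matrix n n A) (u w : m → n) : Prop :=
  IsUnit M ∧ IsUnit ((Ring.inverse M).submatrix w u)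

/-- The quasideterminant `|M|_{U,W} = (1_W M⁻¹ 1_U)⁻¹`. -/
def quasidet (M : Matrix n n A) (u w : m → n) : Matrix m m A :=
  Ring.inverse ((Ring.inverse M).submatrix w u)

end Quasidet

/-! ### The pyramid, the grading and the `W`-algebra -/

/-- A partition `p₁ ≥ ⋯ ≥ p_r > 0` with `r` parts. -/
structure Pyramid (r : ℕ) where
  part : Fin r → ℕ
  anti : Antitone part
  pos : ∀ a, 0 < part a

namespace Pyramid

variable {r : ℕ} (P : Pyramid r)

/-- The index set of the basis of `V`. The second index starts at `0`. -/
abbrev Box : Type := Σ a : Fin r, Fin (P.part a)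

/-- The first (rightmost) box of a row; these boxes span `V₊`. -/
def firstBox (a : Fin r) : P.Box := ⟨a, ⟨0, P.pos a⟩⟩

/-- The last (leftmost) box of a row; these boxes span `V₋`. -/
def lastBox (a : Fin r) : P.Box := ⟨a, ⟨P.part a - 1, Nat.sub_lt (P.pos a) one_pos⟩⟩

/-- The Lie algebra `gl(V) = gl_N`. -/
abbrev gl : Type := Matrix P.Box P.Box ℂ

/-- The nilpotent element `f`, which sends `e_{(a,i)}` to `e_{(a,i+1)}`. -/
def nilp : P.gl :=
  Matrix.of fun x y => if x.1 = y.1 ∧ (x.2 : ℕ) = (y.2 : ℕ) + 1 then 1 else 0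

/-- The eigenvalue `(p_a + 1)/2 - i` of `χ` on `e_{(a,i)}` (here `i` is counted from `1`). -/
def chi (x : P.Box) : ℚ := ((P.part x.1 : ℚ) + 1) / 2 - (((x.2 : ℕ) : ℚ) + 1)

/-- The `ad χ`-eigenvalue of the matrix unit `E_{αβ}`. -/
def deg (x : P.Box × P.Box) : ℚ := P.chi x.1 - P.chi x.2

theorem lie_chi_matUnit (x : P.Box × P.Box) :
    ⁅Matrix.diagonal (fun y => (P.chi y : ℂ)), matUnit x⁆ = (P.deg x : ℂ) • matUnit x := by
  ext i j
  simp only [Ring.lie_def, matUnit, deg, Matrix.sub_apply, Matrix.diagonal_mul,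
    Matrix.mul_diagonal, Matrix.smul_apply, Matrix.single_apply, smul_eq_mul]
  split_ifs with h
  · obtain ⟨h1, h2⟩ := h
    rw [h1, h2]
    push_cast
    ring
  · simp

/-- `g_{≥ 1/2}`. -/
def gGe : Set P.gl := {a | ∀ x, a x.1 x.2 ≠ 0 → 1 / 2 ≤ P.deg x}

/-- `g_{≤ 1/2}`. -/
def gLe : Set P.gl := {a | ∀ x, a x.1 x.2 ≠ 0 → P.deg x ≤ 1 / 2}

/-- The differential algebra `𝒱(g)`. -/
abbrev Vg : Type := DiffPoly (P.Box × P.Box)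

/-- The differential algebra `𝒱(g_{≤ 1/2})`. -/
abbrev Vle : Type := DiffPoly {x : P.Box × P.Box // P.deg x ≤ 1 / 2}

/-- The inclusion of `𝒱(g_{≤ 1/2})` in `𝒱(g)`. -/
def incl : P.Vle →ₐ[ℂ] P.Vg := MvPolynomial.rename fun y => (y.1.1, y.2)

/-- The inclusion of `g_{≤ 1/2}` in `𝒱(g_{≤ 1/2})` (only used for `a ∈ g_{≤ 1/2}`). -/
def embLe (a : P.gl) : P.Vle :=
  ∑ x : {x : P.Box × P.Box // P.deg x ≤ 1 / 2},
    MvPolynomial.C (a x.1.1 x.1.2) * MvPolynomial.X (x, 0)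

/-- The differential algebra homomorphism `ρ : 𝒱(g) → 𝒱(g_{≤ 1/2})` with
`ρ(a) = π_{≤ 1/2}(a) + (f|a)` for `a ∈ g`. -/
def rho : P.Vg →ₐ[ℂ] P.Vle :=
  MvPolynomial.aeval fun y =>
    (if h : P.deg y.1 ≤ 1 / 2 then MvPolynomial.X (⟨y.1, h⟩, y.2) else 0) +
      (if y.2 = 0 then MvPolynomial.C (P.nilp * matUnit y.1).trace else 0)

/-- The classical `W`-algebra `W(gl_N, p)`. -/
def wAlgebra : Set P.Vle :=
  {w | ∀ a ∈ P.gGe, (affineBracket (emb a) (P.incl w)).map P.rho.toRingHom = 0}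

/-- The centralizer `g^f`. -/
def gf : Set P.gl := {a | ⁅P.nilp, a⁆ = 0}

/-- The element `f_{ab;i} = ∑_{j=0}^{i} E_{(a,p_a+j-i),(b,j+1)}` of `g^f` (in the formula the
second indices are counted from `1`). -/
def fElt (a b : Fin r) (i : Fin (min (P.part a) (P.part b))) : P.gl :=
  ∑ j : Fin ((i : ℕ) + 1),
    matUnit (⟨a, ⟨P.part a - 1 - i + j, by have := i.2; have := j.2; omega⟩⟩,
      ⟨b, ⟨j, by have := i.2; have := j.2; omega⟩⟩)

/-- The subspace `U`, spanned by the `E_{(b,1),(a,p_a-i)}` with `0 ≤ i < min(p_a, p_b)` (in the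
formula the second indices are counted from `1`). -/
def subU : Submodule ℂ P.gl :=
  Submodule.span ℂ {u | ∃ (a b : Fin r) (i : Fin (min (P.part a) (P.part b))),
    u = matUnit (P.firstBox b, ⟨a, ⟨P.part a - 1 - i, by have := i.2; omega⟩⟩)}

/-- The orthogonal complement of `U` in `g_{≤ 1/2}` for the trace form. -/
def uPerp : Set P.gl := {a | a ∈ P.gLe ∧ ∀ u ∈ P.subU, (a * u).trace = 0}

/-- The differential ideal `⟨U^⊥⟩` of `𝒱(g_{≤ 1/2})`. -/
def uPerpIdeal : Ideal P.Vle :=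
  Ideal.span {x | ∃ u ∈ P.uPerp, ∃ n : ℕ, x = PsiDO.der n (P.embLe u)}

/-- The differential subalgebra `𝒱(g^f)` of `𝒱(g_{≤ 1/2})`. -/
def vgf : Subalgebra ℂ P.Vle :=
  Algebra.adjoin ℂ {x | ∃ q ∈ P.gf, ∃ n : ℕ, x = PsiDO.der n (P.embLe q)}

/-- `x` is an element of the `W`-algebra of the form `q + r` with `r ∈ ⟨U^⊥⟩`. -/
def IsLift (q x : P.Vle) : Prop := x ∈ P.wAlgebra ∧ x - q ∈ P.uPerpIdeal

open Classical in
/-- The map `w : 𝒱(g^f) → W(gl_N, p)`: `w(q)` is the unique element of the `W`-algebra of the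
form `q + r` with `r ∈ ⟨U^⊥⟩`. -/
def wMap (q : P.Vle) : P.Vle := if h : ∃ x, P.IsLift q x then h.choose else 0

/-- The generator `w_{ab;i} = w(f_{ab;i})`. -/
def wGen (a b : Fin r) (i : Fin (min (P.part a) (P.part b))) : P.Vle :=
  P.wMap (P.embLe (P.fElt a b i))

/-- The generator matrix `W(∂)`, with entries `∑_i w_{ba;i} (-∂)ⁱ`. -/
def genMatrix : Matrix (Fin r) (Fin r) (PsiDO P.Vle) :=
  Matrix.of fun a b =>
    ∑ i : Fin (min (P.part b) (P.part a)), PsiDO.const (P.wGen b a i) * (-PsiDO.D) ^ (i : ℕ)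

/-- The diagonal matrix `(-∂)^p`. -/
def negDPow : Matrix (Fin r) (Fin r) (PsiDO P.Vle) :=
  Matrix.diagonal fun a => (-PsiDO.D) ^ P.part a

/-! ### The operator `T(∂)` and the recursion -/

/-- The matrix differential operator `A(∂) = 1 ∂ + ∑ u_i U^i`; the matrix unit dual to `E_{βα}`
for the trace form is `E_{αβ}`. -/
def opA : Matrix P.Box P.Box (PsiDO P.Vg) :=
  Matrix.of fun x y => (if x = y then PsiDO.D else 0) + PsiDO.const (emb (matUnit (y, x)))

/-- `ρA(∂)`. -/
def rhoA : Matrix P.Box P.Box (PsiDO P.Vle) := P.opA.map (PsiDO.map P.rho.toRingHom)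

/-- `T(∂) = |ρA(∂)|_{V₊,V₋}`; the `(a,b)` entry is the coefficient of `E_{(a,1),(b,p_b)}`. -/
def opT : Matrix (Fin r) (Fin r) (PsiDO P.Vle) := quasidet P.rhoA P.firstBox P.lastBox

/-- The number `s` of distinct parts. -/
def numBlocks : ℕ := (Finset.univ.image P.part).card

/-- The number `k ∈ {1,…,s}` of the rectangle that contains row `a`, so that row `a` contributes
to `V_{±,k}`. -/
def block (a : Fin r) : ℕ := ((Finset.univ.image P.part).filter fun l => P.part a < l).card + 1

/-- `1_{V_{+,≥k}} M 1_{V_{-,≥k}}`. -/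
def corner (k : ℕ) (M : Matrix (Fin r) (Fin r) (PsiDO P.Vle)) :
    Matrix {a // k ≤ P.block a} {a // k ≤ P.block a} (PsiDO P.Vle) :=
  M.submatrix Subtype.val Subtype.val

/-- `T⁽ᵏ⁺¹⁾ (W⁽ᵏ⁺¹⁾)⁻¹`, for `M = T⁽ᵏ⁺¹⁾`. -/
def rightQuot (k : ℕ) (M : Matrix (Fin r) (Fin r) (PsiDO P.Vle)) :
    Matrix (Fin r) {a // k + 1 ≤ P.block a} (PsiDO P.Vle) :=
  M.submatrix id Subtype.val * Ring.inverse (P.corner (k + 1) M)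

/-- `(W⁽ᵏ⁺¹⁾)⁻¹ T⁽ᵏ⁺¹⁾`, for `M = T⁽ᵏ⁺¹⁾`. -/
def leftQuot (k : ℕ) (M : Matrix (Fin r) (Fin r) (PsiDO P.Vle)) :
    Matrix {a // k + 1 ≤ P.block a} (Fin r) (PsiDO P.Vle) :=
  Ring.inverse (P.corner (k + 1) M) * M.submatrix Subtype.val id

/-- `E₋⁽ᵏ⁾ = 1 - 1_{V_{+,k}} (T⁽ᵏ⁺¹⁾ (W⁽ᵏ⁺¹⁾)⁻¹)₊`, for `M = T⁽ᵏ⁺¹⁾`. -/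
def eMinus (k : ℕ) (M : Matrix (Fin r) (Fin r) (PsiDO P.Vle)) :
    Matrix (Fin r) (Fin r) (PsiDO P.Vle) :=
  1 - Matrix.of fun a b =>
    if h : P.block a = k ∧ k + 1 ≤ P.block b then
      (P.rightQuot k M a ⟨b, h.2⟩).posPart
    else 0

/-- `F₋⁽ᵏ⁾ = 1 - ((W⁽ᵏ⁺¹⁾)⁻¹ T⁽ᵏ⁺¹⁾)₊ 1_{V_{-,k}}`, for `M = T⁽ᵏ⁺¹⁾`. -/
def fMinus (k : ℕ) (M : Matrix (Fin r) (Fin r) (PsiDO P.Vle)) :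
    Matrix (Fin r) (Fin r) (PsiDO P.Vle) :=
  1 - Matrix.of fun a b =>
    if h : k + 1 ≤ P.block a ∧ P.block b = k then
      (P.leftQuot k M ⟨a, h.1⟩ b).posPart
    else 0

/-- The operators `T⁽ˢ⁾, T⁽ˢ⁻¹⁾, …`. -/
def recAux : ℕ → Matrix (Fin r) (Fin r) (PsiDO P.Vle)
  | 0 => P.opT
  | j + 1 => P.eMinus (P.numBlocks - (j + 1)) (recAux j) * recAux j *
      P.fMinus (P.numBlocks - (j + 1)) (recAux j)

/-- `T⁽ᵏ⁾(∂)`, for `1 ≤ k ≤ s`. -/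
def recT (k : ℕ) : Matrix (Fin r) (Fin r) (PsiDO P.Vle) := P.recAux (P.numBlocks - k)

/-- `W⁽ᵏ⁾(∂) = 1_{V_{+,≥k}} T⁽ᵏ⁾(∂) 1_{V_{-,≥k}}`. -/
def recW (k : ℕ) : Matrix {a // k ≤ P.block a} {a // k ≤ P.block a} (PsiDO P.Vle) :=
  P.corner k (P.recT k)

theorem recT_numBlocks : P.recT P.numBlocks = P.opT := by
  rw [recT, Nat.sub_self, recAux]

theorem recT_of_lt {k : ℕ} (hk : k < P.numBlocks) :
    P.recT k = P.eMinus k (P.recT (k + 1)) * P.recT (k + 1) * P.fMinus k (P.recT (k + 1)) := by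
  obtain ⟨j, hj⟩ : ∃ j, P.numBlocks = k + j + 1 := ⟨P.numBlocks - k - 1, by omega⟩
  have h1 : P.numBlocks - k = j + 1 := by omega
  have h2 : P.numBlocks - (k + 1) = j := by omega
  have h3 : P.numBlocks - (j + 1) = k := by omega
  rw [recT, recT, h1, h2, recAux, h3]

theorem one_le_block (a : Fin r) : 1 ≤ P.block a := Nat.le_add_left _ _

end Pyramid

end

end WGL

namespace WGL
noncomputable section
open scoped Differential

/-! ### Pseudodifferential operators -/

namespace PsiDO

variable {R : Type*} [CommRing R]

/-! The matrix `T` has a normal form under multiplication by unitriangular matrix differential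
operators. The recursion computes it, and its uniqueness forces its coefficients into the
`W`-algebra.

Call W reduced if W + (-∂)^p has (a,b) entry of order less than min(p_a, p_b). If W₁, W₂ are reduced
and W₂ F = E W₁, where E - 1 and F - 1 are differential operators with nonzero entries only from
longer to shorter rows (E) or from shorter to longer (F), then W₁ = W₂ (`Reduced.unique`). On the
other side, ρA = f + ∂ + Q, and the height filtration shows that `T` is a differential operator
equal to -(-∂)^p up to lower filtration degree (`Resolvent.admissible`). Each step of the recursion
preserves this and makes a larger corner reduced, so T^(1) is a reduced form of `T` (`recAux_spec`).

For a in g_{≥1/2}, the map w ↦ w + ρ{a_λ w} is a differential ring homomorphism into a square-zero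
extension, and w lies in the `W`-algebra iff it equals the plain inclusion at w for all such a. The
homomorphism conjugates ρA by 1 - εa, hence changes `T` by unitriangular factors
(`Resolvent.gauge`). Reduced forms are unique over any coefficient ring, so the homomorphism and the
inclusion agree on T^(1): its coefficients are in the `W`-algebra (`Resolvent.reduced_transform`).

Restriction `kappa` to the slice, where only the variables dual to U survive, has kernel ⟨U^⊥⟩.
There Q has rows in V₊ only, and `T` becomes -(-∂)^p plus the coordinates of the slice times powers
of -∂ (`Resolvent.map_kappa`). This is already reduced, so by uniqueness T^(1) has the same
restriction. Thus the coefficients of T^(1), up to sign, are elements of the `W`-algebra that lift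
the coordinates; this gives existence of w(q), with no structure theorem assumed.

Uniqueness of w(q) is the injectivity of `kappa` on the `W`-algebra (`eq_zero_of_kappa`). The
lowest-weight part of the equations ρ{a_λ w} = 0 says that partial derivatives in directions off the
slice vanish, because the pairing (f|[a,z]) separates these directions (`exists_dual`). Injectivity
then identifies the coefficients of T^(1) with the w_{ba;i}. -/

@[simp] theorem coeff_posPart (a : PsiDO R) (n : ℤ) :
    a.posPart.coeff n = if 0 ≤ n then a.coeff n else 0 := rfl

@[simp] theorem coeff_map {S : Type*} [CommRing S] (f : R →+* S) (a : PsiDO R) (n : ℤ) :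
    (a.map f).coeff n = f (a.coeff n) := rfl

theorem OrdLE.mono_right {a : PsiDO R} {A B : ℤ} (ha : a.OrdLE A) (h : A ≤ B) : a.OrdLE B :=
  fun n hn => ha n (lt_of_le_of_lt h hn)

theorem OrdLE.add {a b : PsiDO R} {A : ℤ} (ha : a.OrdLE A) (hb : b.OrdLE A) : (a + b).OrdLE A :=
  fun n hn => by rw [coeff_add, ha n hn, hb n hn, add_zero]

theorem OrdLE.neg {a : PsiDO R} {A : ℤ} (ha : a.OrdLE A) : (-a).OrdLE A :=
  fun n hn => by rw [coeff_neg, ha n hn, neg_zero]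

theorem OrdLE.sub {a b : PsiDO R} {A : ℤ} (ha : a.OrdLE A) (hb : b.OrdLE A) : (a - b).OrdLE A :=
  fun n hn => by rw [coeff_sub, ha n hn, hb n hn, sub_zero]

theorem ordLE_zero (A : ℤ) : (0 : PsiDO R).OrdLE A := fun _ _ => rfl

theorem ordLE_one : (1 : PsiDO R).OrdLE 0 := ordLE_mono 0 1

theorem isDiffOp_posPart (a : PsiDO R) : a.posPart.IsDiffOp := fun n hn => by
  simp [not_le.2 hn]

theorem OrdLE.posPart {a : PsiDO R} {A : ℤ} (ha : a.OrdLE A) : a.posPart.OrdLE A :=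
  fun n hn => by simp [ha n hn]

theorem ordLE_sub_posPart (a : PsiDO R) : (a - a.posPart).OrdLE (-1) := fun n hn => by
  simp [show 0 ≤ n by omega]

theorem IsDiffOp.eq_zero {a : PsiDO R} (ha : a.IsDiffOp) (h : a.OrdLE (-1)) : a = 0 := by
  ext n
  rcases lt_or_ge n 0 with hn | hn
  · exact ha n hn
  · exact h n (by omega)

theorem coeff_one (n : ℤ) : (1 : PsiDO R).coeff n = if n = 0 then 1 else 0 :=
  coeff_mono 0 1 n

theorem isDiffOp_mono (i : ℕ) (x : R) : (mono (i : ℤ) x).IsDiffOp := fun n hn => by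
  rw [coeff_mono, if_neg (by omega)]

theorem isDiffOp_D : (D : PsiDO R).IsDiffOp := isDiffOp_mono 1 1

theorem isDiffOp_const (x : R) : (const x).IsDiffOp := isDiffOp_mono 0 x

theorem ordLE_D : (D : PsiDO R).OrdLE 1 := ordLE_mono 1 1

theorem ordLE_const (x : R) : (const x).OrdLE 0 := ordLE_mono 0 x

variable [Differential R]

/-- The coefficient of `∂ⁿ` as an additive map. -/
def coeffHom (n : ℤ) : PsiDO R →+ R where
  toFun a := a.coeff n
  map_zero' := rfl
  map_add' _ _ := rfl

theorem coeff_sum {ι : Type*} (s : Finset ι) (f : ι → PsiDO R) (n : ℤ) :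
    (∑ i ∈ s, f i).coeff n = ∑ i ∈ s, (f i).coeff n :=
  map_sum (coeffHom n) f s

theorem OrdLE.sum {ι : Type*} {s : Finset ι} {f : ι → PsiDO R} {A : ℤ}
    (h : ∀ i ∈ s, (f i).OrdLE A) : (∑ i ∈ s, f i).OrdLE A := fun n hn => by
  rw [coeff_sum]
  exact Finset.sum_eq_zero fun i hi => h i hi n hn

/-- The subring `R[∂]` of differential operators. -/
def diffOps (R : Type*) [CommRing R] [Differential R] : Subring (PsiDO R) where
  carrier := {a | a.IsDiffOp}
  zero_mem' := fun _ _ => rfl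
  one_mem' := fun n hn => by simp [coeff_one, hn.ne]
  add_mem' := fun {a b} ha hb n hn => by rw [coeff_add, ha n hn, hb n hn, add_zero]
  neg_mem' := fun {a} ha n hn => by rw [coeff_neg, ha n hn, neg_zero]
  mul_mem' := by
    intro a b ha hb k hk
    rw [coeff_mul]
    refine finsum_eq_zero_of_forall_eq_zero fun x => ?_
    obtain ⟨m, j⟩ := x
    rcases lt_or_ge m 0 with hm | hm
    · simp [ha m hm]
    rcases lt_or_ge (k - m + j) 0 with h | h
    · simp [hb _ h]
    obtain ⟨m, rfl⟩ := Int.eq_ofNat_of_zero_le hm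
    -- The inequalities k < 0 ≤ k - m + j force j > m.
    have : Ring.choose ((m : ℕ) : ℤ) j = 0 := by
      rw [Ring.choose_natCast, Nat.choose_eq_zero_of_lt (by omega), Nat.cast_zero]
    simp only [this, zero_smul]

theorem coeff_const_mul (x : R) (a : PsiDO R) (n : ℤ) : (const x * a).coeff n = x * a.coeff n := by
  rw [coeff_mul, finsum_eq_single _ ((0 : ℤ), 0)]
  · simp [const, coeff_mono]
  · rintro ⟨m, j⟩ h
    by_cases hm : m = 0
    · subst hm
      have : j ≠ 0 := by
        rintro rfl
        exact h rfl
      simp [Ring.choose_zero_ite, this]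
    · simp [const, coeff_mono, hm]

theorem coeff_mul_mono_one (a : PsiDO R) (l n : ℤ) :
    (a * mono l 1).coeff n = a.coeff (n - l) := by
  rw [coeff_mul, finsum_eq_single _ (n - l, 0)]
  · simp [coeff_mono]
  · rintro ⟨m, j⟩ h
    simp only [coeff_mono]
    split_ifs with hm
    · have : j ≠ 0 := by
        rintro rfl
        exact h (by simp; omega)
      simp [der_one, this]
    · simp

theorem coeff_D_mul (a : PsiDO R) (n : ℤ) :
    (D * a).coeff n = a.coeff (n - 1) + (a.coeff n)′ := by
  rw [coeff_mul, finsum_eq_sum_of_support_subset (s := {((1 : ℤ), 0), (1, 1)})]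
  · rw [Finset.sum_pair (by simp)]
    simp [D, coeff_mono, der_succ]
  · rintro ⟨m, j⟩ h
    by_cases hm : m = 1
    · subst hm
      have : j < 2 := by
        by_contra hj
        refine h ?_
        have : Ring.choose (1 : ℤ) j = 0 := by
          have h1 := Ring.choose_natCast (R := ℤ) 1 j
          rw [Nat.cast_one] at h1
          rw [h1, Nat.choose_eq_zero_of_lt (by omega), Nat.cast_zero]
        simp [this]
      interval_cases j <;> simp
    · exact absurd (by simp [D, coeff_mono, hm]) h

theorem coeff_mul_D (a : PsiDO R) (n : ℤ) : (a * D).coeff n = a.coeff (n - 1) :=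
  coeff_mul_mono_one a 1 n

theorem mono_one_mul (k l : ℤ) : (mono k 1 * mono l 1 : PsiDO R) = mono (k + l) 1 := by
  ext n
  rw [coeff_mul_mono_one, coeff_mono, coeff_mono]
  exact if_congr (by omega) rfl rfl

/-- The inclusion of `R` in `R((∂⁻¹))`. -/
def constHom (R : Type*) [CommRing R] [Differential R] : R →+* PsiDO R where
  toFun := const
  map_zero' := by ext n; simp [const, coeff_mono]
  map_one' := rfl
  map_add' x y := by ext n; simp only [const, coeff_mono, coeff_add]; split_ifs <;> simp
  map_mul' x y := by
    ext n
    rw [coeff_const_mul]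
    simp only [const, coeff_mono]
    split_ifs <;> simp

theorem constHom_apply (x : R) : constHom R x = const x := rfl

theorem D_mul_const (x : R) : D * const x = const x * D + const x′ := by
  ext n
  rw [coeff_D_mul, coeff_add, coeff_mul_D]
  simp only [const, coeff_mono]
  split_ifs <;> simp

theorem neg_D_pow (i : ℕ) : ((-D) ^ i : PsiDO R) = mono i ((-1) ^ i) := by
  induction i with
  | zero => rw [pow_zero, pow_zero]; rfl
  | succ i ih =>
    ext n
    rw [pow_succ, ih, mul_neg, coeff_neg, coeff_mul_D, coeff_mono, coeff_mono, pow_succ]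
    push_cast
    by_cases h : n = i + 1
    · simp [h]
    · rw [if_neg h, if_neg (by omega), neg_zero]

theorem ordLE_neg_D_pow (i : ℕ) : ((-D) ^ i : PsiDO R).OrdLE i := by
  rw [neg_D_pow]
  exact ordLE_mono _ _

/-- The inverse of `∂`. -/
def Dinv : PsiDO R := mono (-1) 1

theorem D_mul_Dinv : (D * Dinv : PsiDO R) = 1 := mono_one_mul 1 (-1)

theorem Dinv_mul_D : (Dinv * D : PsiDO R) = 1 := mono_one_mul (-1) 1

/-- The inverse of `-(-∂)^i`. -/
def negPowInv (i : ℕ) : PsiDO R := -((-1) ^ i * mono (-i) 1)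

theorem neg_D_pow_eq (i : ℕ) : ((-D) ^ i : PsiDO R) = (-1) ^ i * mono i 1 := by
  rw [neg_pow]
  congr 1
  induction i with
  | zero => simp; rfl
  | succ i ih => rw [pow_succ, ih, D, mono_one_mul]; push_cast; rfl

theorem neg_D_pow_mul_inv (i : ℕ) : (-(-D) ^ i * negPowInv i : PsiDO R) = 1 := by
  rw [negPowInv, neg_D_pow_eq, neg_mul_neg, mul_assoc, ← mul_assoc (mono _ _),
    ← ((Commute.neg_one_left (mono (i : ℤ) (1 : R))).pow_left i).eq, mul_assoc, ← mul_assoc,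
    mono_one_mul, ← pow_add, Even.neg_one_pow ⟨i, rfl⟩, add_neg_cancel, one_mul]
  rfl

theorem inv_mul_neg_D_pow (i : ℕ) : (negPowInv i * -(-D) ^ i : PsiDO R) = 1 := by
  rw [negPowInv, neg_D_pow_eq, neg_mul_neg, mul_assoc, ← mul_assoc (mono _ _),
    ← ((Commute.neg_one_left (mono (-(i : ℤ)) (1 : R))).pow_left i).eq, mul_assoc, ← mul_assoc,
    mono_one_mul, ← pow_add, Even.neg_one_pow ⟨i, rfl⟩, neg_add_cancel, one_mul]
  rfl

theorem ordLE_negPowInv (i : ℕ) : (negPowInv i : PsiDO R).OrdLE (-i) := by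
  refine OrdLE.neg ?_
  rcases neg_one_pow_eq_or (PsiDO R) i with h | h <;> rw [h]
  · rw [one_mul]; exact ordLE_mono _ _
  · rw [neg_one_mul]; exact (ordLE_mono _ _).neg

/-! ### Functoriality of R((∂⁻¹)) in the differential ring R. -/

variable {S : Type*} [CommRing S] [Differential S]

theorem map_der {φ : R →+* S} (hφ : ∀ x, φ x′ = (φ x)′) (n : ℕ) (x : R) :
    φ (der n x) = der n (φ x) := by
  induction n with
  | zero => rfl
  | succ n ih => rw [der_succ, der_succ, hφ, ih]

/-- A homomorphism of differential rings induces a homomorphism of the rings of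
pseudodifferential operators. -/
def mapHom (φ : R →+* S) (hφ : ∀ x, φ x′ = (φ x)′) : PsiDO R →+* PsiDO S where
  toFun := map φ
  map_zero' := by ext n; simp
  map_one' := by ext n; simp only [coeff_map, coeff_one]; split_ifs <;> simp
  map_add' a b := by ext n; simp
  map_mul' a b := by
    ext k
    rw [coeff_map]
    change φ (∑ᶠ x, mulTerm a b k x) = ∑ᶠ x, mulTerm (map φ a) (map φ b) k x
    refine (AddMonoidHom.map_finsum φ.toAddMonoidHom (finite_mulTerm a b k)).trans
      (finsum_congr fun x => ?_)
    simp only [mulTerm, coeff_map, ← map_der hφ, RingHom.toAddMonoidHom_eq_coe,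
      AddMonoidHom.coe_coe, map_zsmul, map_mul]

variable {φ : R →+* S} {hφ : ∀ x, φ x′ = (φ x)′}

theorem coeff_mapHom (a : PsiDO R) (n : ℤ) : (mapHom φ hφ a).coeff n = φ (a.coeff n) := rfl

theorem mapHom_mono (n : ℤ) (x : R) : mapHom φ hφ (mono n x) = mono n (φ x) := by
  ext k
  rw [coeff_mapHom, coeff_mono, coeff_mono]
  split_ifs <;> simp

theorem mapHom_const (x : R) : mapHom φ hφ (const x) = const (φ x) := mapHom_mono 0 x

theorem mapHom_D : mapHom φ hφ D = D := by rw [D, mapHom_mono, map_one]; rfl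

theorem IsDiffOp.mapHom {a : PsiDO R} (ha : a.IsDiffOp) : (mapHom φ hφ a).IsDiffOp := fun n hn => by
  rw [coeff_mapHom, ha n hn, map_zero]

theorem OrdLE.mapHom {a : PsiDO R} {A : ℤ} (ha : a.OrdLE A) : (mapHom φ hφ a).OrdLE A :=
  fun n hn => by rw [coeff_mapHom, ha n hn, map_zero]

end PsiDO
end
end WGL

namespace WGL
noncomputable section
open scoped Differential

/-! ### Filtered matrices of pseudodifferential operators -/

section Filtration

open PsiDO

variable {R : Type*} [CommRing R] {l m n : Type*}

/-- The entry `(a, b)` of `M` has order at most `(d + x a - y b) / 2`. -/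
def FilLE (x : m → ℤ) (y : n → ℤ) (d : ℤ) (M : Matrix m n (PsiDO R)) : Prop :=
  ∀ a b k, d + x a - y b < 2 * k → (M a b).coeff k = 0

variable {x : l → ℤ} {y : m → ℤ} {z : n → ℤ} {d e : ℤ}

/-- Doubled weights keep half-integral χ-degrees in ℤ, with ∂ of degree 2. Integer division rounds
down, so a half-integral bound gains 1/2; this gain is used for rows of equal length. -/
theorem filLE_iff {M : Matrix m n (PsiDO R)} :
    FilLE y z d M ↔ ∀ a b, (M a b).OrdLE ((d + y a - z b) / 2) :=
  ⟨fun h a b k hk => h a b k (by omega), fun h a b k hk => h a b k (by omega)⟩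

theorem FilLE.mono {M : Matrix m n (PsiDO R)} (h : FilLE y z d M) (hde : d ≤ e) : FilLE y z e M :=
  fun a b k hk => h a b k (by omega)

theorem FilLE.add {M N : Matrix m n (PsiDO R)} (hM : FilLE y z d M) (hN : FilLE y z d N) :
    FilLE y z d (M + N) := fun a b k hk => by
  rw [Matrix.add_apply, coeff_add, hM a b k hk, hN a b k hk, add_zero]

theorem FilLE.neg {M : Matrix m n (PsiDO R)} (hM : FilLE y z d M) : FilLE y z d (-M) :=
  fun a b k hk => by rw [Matrix.neg_apply, coeff_neg, hM a b k hk, neg_zero]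

theorem FilLE.sub {M N : Matrix m n (PsiDO R)} (hM : FilLE y z d M) (hN : FilLE y z d N) :
    FilLE y z d (M - N) := by
  rw [sub_eq_add_neg]
  exact hM.add hN.neg

theorem FilLE.submatrix {l' n' : Type*} {M : Matrix m n (PsiDO R)} (hM : FilLE y z d M)
    (u : l' → m) (v : n' → n) : FilLE (y ∘ u) (z ∘ v) d (M.submatrix u v) :=
  fun a b k hk => hM (u a) (v b) k hk

/-- The filtration is separated: a fixed coefficient k of the entry (a,b) dies once j exceeds y a -
z b - 2k. -/
theorem eq_zero_of_filLE {M : Matrix m n (PsiDO R)} (h : ∀ j : ℕ, FilLE y z (-j) M) : M = 0 := by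
  ext a b k
  exact h (y a - z b - 2 * k + 1).toNat a b k (by omega)

/-- All entries of `M` are differential operators. -/
def DiffMat (M : Matrix m n (PsiDO R)) : Prop := ∀ a b, (M a b).IsDiffOp

theorem DiffMat.submatrix {l' n' : Type*} {M : Matrix m n (PsiDO R)} (hM : DiffMat M)
    (u : l' → m) (v : n' → n) : DiffMat (M.submatrix u v) := fun a b => hM (u a) (v b)

variable [Differential R]

theorem FilLE.mul [Fintype m] {M : Matrix l m (PsiDO R)} {N : Matrix m n (PsiDO R)}
    (hM : FilLE x y d M) (hN : FilLE y z e N) : FilLE x z (d + e) (M * N) := by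
  rw [filLE_iff] at *
  intro a b
  rw [Matrix.mul_apply]
  exact OrdLE.sum fun c _ => ((hM a c).mul (hN c b)).mono_right (by omega)

theorem FilLE.sum {ι : Type*} {s : Finset ι} {M : ι → Matrix m n (PsiDO R)}
    (h : ∀ i ∈ s, FilLE y z d (M i)) : FilLE y z d (∑ i ∈ s, M i) := fun a b k hk => by
  rw [Matrix.sum_apply, coeff_sum]
  exact Finset.sum_eq_zero fun i hi => h i hi a b k hk

theorem filLE_one [DecidableEq m] : FilLE y y 0 (1 : Matrix m m (PsiDO R)) := by
  rw [filLE_iff]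
  intro a b
  rw [Matrix.one_apply]
  split_ifs with h
  · subst h
    exact ordLE_one.mono_right (by omega)
  · exact ordLE_zero _

theorem FilLE.pow [Fintype m] [DecidableEq m] {N : Matrix m m (PsiDO R)} (h : FilLE y y d N)
    (j : ℕ) : FilLE y y (j * d) (N ^ j) := by
  induction j with
  | zero => simpa using filLE_one
  | succ j ih =>
    rw [pow_succ]
    refine (ih.mul h).mono ?_
    push_cast
    linarith

/-- Since N^j has degree at most -j, only the powers with j ≤ y a - y b - 2k reach coefficient k of
the entry (a,b), so the geometric series stabilizes coefficient by coefficient. -/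
theorem FilLE.coeff_geom_eq [Fintype m] [DecidableEq m] {N : Matrix m m (PsiDO R)}
    (h : FilLE y y (-1) N) (a b : m) (k : ℤ) {J : ℕ} (hJ : (y a - y b - 2 * k + 1).toNat ≤ J) :
    ((∑ j ∈ Finset.range J, N ^ j) a b).coeff k =
      ((∑ j ∈ Finset.range (y a - y b - 2 * k + 1).toNat, N ^ j) a b).coeff k := by
  simp only [Matrix.sum_apply, coeff_sum]
  symm
  refine Finset.sum_subset (Finset.range_mono hJ) fun j _ hj => ?_
  rw [Finset.mem_range, not_lt] at hj
  exact h.pow j a b k (by omega)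

/-- A matrix `1 - N` with `N` of negative filtration degree is invertible. -/
theorem FilLE.exists_inverse [Fintype m] [DecidableEq m] {N : Matrix m m (PsiDO R)}
    (h : FilLE y y (-1) N) : ∃ G, FilLE y y 0 G ∧ (1 - N) * G = 1 ∧ G * (1 - N) = 1 := by
  let J : m → m → ℤ → ℕ := fun a b k => (y a - y b - 2 * k + 1).toNat
  let G : Matrix m m (PsiDO R) := fun a b =>
    -- For k > |y a - y b| the stabilization index is 0, so |y a - y b| bounds the order of the
    -- entry.
    ⟨fun k => ((∑ j ∈ Finset.range (J a b k), N ^ j) a b).coeff k, |y a - y b|, fun k hk => by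
      have : J a b k = 0 := by
        have := le_abs_self (y a - y b)
        have := abs_nonneg (y a - y b)
        simp only [J]
        omega
      simp [this]⟩
  -- G agrees with each partial sum up to degree -I, so both inverse identities hold modulo every
  -- step of a separated filtration.
  have hG : ∀ I : ℕ, FilLE y y (-I) (G - ∑ j ∈ Finset.range I, N ^ j) := by
    intro I a b k hk
    rw [Matrix.sub_apply, coeff_sub, sub_eq_zero, h.coeff_geom_eq a b k (by omega)]
    rfl
  refine ⟨G, by simpa using hG 0, ?_, ?_⟩ <;> refine sub_eq_zero.1 (eq_zero_of_filLE (y := y)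
    (z := y) fun I => ?_)
  · have e : (1 - N) * G - 1 = (1 - N) * (G - ∑ j ∈ Finset.range I, N ^ j) - N ^ I := by
      rw [mul_sub, mul_neg_geom_sum]
      abel
    rw [e]
    refine FilLE.sub ?_ ((h.pow I).mono (by omega))
    refine ((FilLE.sub (filLE_one) (h.mono (by omega))).mul (hG I)).mono (by omega)
  · have e : G * (1 - N) - 1 = (G - ∑ j ∈ Finset.range I, N ^ j) * (1 - N) - N ^ I := by
      rw [sub_mul, geom_sum_mul_neg]
      abel
    rw [e]
    refine FilLE.sub ?_ ((h.pow I).mono (by omega))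
    refine ((hG I).mul (FilLE.sub (filLE_one) (h.mono (by omega)))).mono (by omega)

theorem isUnit_of_mul_eq_one {A : Type*} [Ring A] {a b : A} (h : a * b = 1) (h' : b * a = 1) :
    IsUnit a := ⟨⟨a, b, h, h'⟩, rfl⟩

theorem inverse_eq_of_mul_eq_one {A : Type*} [Ring A] {a b : A} (h : a * b = 1) (h' : b * a = 1) :
    Ring.inverse a = b := Ring.inverse_unit (⟨a, b, h, h'⟩ : Aˣ)

/-- A perturbation of lower filtration degree of an invertible matrix is invertible. -/
theorem FilLE.inverse_add [Fintype m] [DecidableEq m] {x y : m → ℤ} {M N M' : Matrix m m (PsiDO R)}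
    (h1 : M * M' = 1) (h2 : M' * M = 1) (hM' : FilLE y x (-d) M') (hN : FilLE x y (d - 1) N) :
    IsUnit (M + N) ∧ FilLE y x (-d) (Ring.inverse (M + N)) := by
  obtain ⟨G, hG, hG1, hG2⟩ := FilLE.exists_inverse (y := y) (N := -(M' * N))
    ((hM'.mul hN).neg.mono (by omega))
  have e : M + N = M * (1 - -(M' * N)) := by
    rw [sub_neg_eq_add, mul_add, mul_one, ← mul_assoc, h1, one_mul]
  have r : (M + N) * (G * M') = 1 := by
    rw [e, mul_assoc, ← mul_assoc _ G, hG1, one_mul, h1]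
  have l : (G * M') * (M + N) = 1 := by
    rw [e, mul_assoc, ← mul_assoc M', h2, one_mul, hG2]
  refine ⟨isUnit_of_mul_eq_one r l, ?_⟩
  rw [inverse_eq_of_mul_eq_one r l]
  exact (hG.mul hM').mono (by omega)

/-! ### Unitriangular matrices and matrices of differential operators -/

theorem DiffMat.add {M N : Matrix m n (PsiDO R)} (hM : DiffMat M) (hN : DiffMat N) :
    DiffMat (M + N) := fun a b => (diffOps R).add_mem (hM a b) (hN a b)

theorem DiffMat.sub {M N : Matrix m n (PsiDO R)} (hM : DiffMat M) (hN : DiffMat N) :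
    DiffMat (M - N) := fun a b => (diffOps R).sub_mem (hM a b) (hN a b)

theorem DiffMat.mul [Fintype m] {M : Matrix l m (PsiDO R)} {N : Matrix m n (PsiDO R)}
    (hM : DiffMat M) (hN : DiffMat N) : DiffMat (M * N) := fun a b => by
  rw [Matrix.mul_apply]
  exact (diffOps R).sum_mem fun c _ => (diffOps R).mul_mem (hM a c) (hN c b)

theorem diffMat_one [DecidableEq m] : DiffMat (1 : Matrix m m (PsiDO R)) := fun a b => by
  rw [Matrix.one_apply]
  split_ifs
  exacts [(diffOps R).one_mem, (diffOps R).zero_mem]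

theorem DiffMat.pow [Fintype m] [DecidableEq m] {M : Matrix m m (PsiDO R)} (hM : DiffMat M)
    (j : ℕ) : DiffMat (M ^ j) := by
  induction j with
  | zero => simpa using diffMat_one
  | succ j ih => rw [pow_succ]; exact ih.mul hM

theorem DiffMat.sum {ι : Type*} {s : Finset ι} {M : ι → Matrix m n (PsiDO R)}
    (h : ∀ i ∈ s, DiffMat (M i)) : DiffMat (∑ i ∈ s, M i) := fun a b => by
  rw [Matrix.sum_apply]
  exact (diffOps R).sum_mem fun i hi => h i hi a b

end Filtration

section Unitriangular

variable {A : Type*} [Ring A] {m : Type*}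

/-- `N` strictly raises the weight `x`. -/
def Strict (x : m → ℤ) (N : Matrix m m A) : Prop := ∀ a b, x a ≤ x b → N a b = 0

variable {x : m → ℤ} {M N : Matrix m m A}

theorem Strict.add (hM : Strict x M) (hN : Strict x N) : Strict x (M + N) := fun a b h => by
  rw [Matrix.add_apply, hM a b h, hN a b h, add_zero]

theorem Strict.neg (hM : Strict x M) : Strict x (-M) := fun a b h => by
  rw [Matrix.neg_apply, hM a b h, neg_zero]

theorem Strict.mul [Fintype m] (hM : Strict x M) (hN : Strict x N) : Strict x (M * N) :=
  fun a b h => by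
    rw [Matrix.mul_apply]
    refine Finset.sum_eq_zero fun c _ => ?_
    rcases le_total (x a) (x c) with h' | h'
    · rw [hM a c h', zero_mul]
    · rw [hN c b (h'.trans h), mul_zero]

/-- Each factor changes the integral weight by at least one, so N^j only links indices whose weights
differ by at least j. -/
theorem Strict.pow_apply [Fintype m] [DecidableEq m] (hN : Strict x N) (j : ℕ) (a b : m)
    (h : x a < x b + j) : (N ^ j) a b = 0 := by
  induction j generalizing b with
  | zero =>
    rw [pow_zero, Matrix.one_apply_ne]
    rintro rfl
    simp at h
  | succ j ih =>
    rw [pow_succ, Matrix.mul_apply]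
    refine Finset.sum_eq_zero fun c _ => ?_
    push_cast at h
    rcases lt_or_ge (x b) (x c) with h' | h'
    · rw [ih c (by omega), zero_mul]
    · rw [hN c b h', mul_zero]

theorem Strict.exists_pow_eq_zero [Fintype m] [DecidableEq m] (hN : Strict x N) :
    ∃ J : ℕ, N ^ J = 0 := by
  obtain ⟨B, hB⟩ := (Set.finite_range fun ab : m × m => x ab.1 - x ab.2).bddAbove
  refine ⟨(B + 1).toNat, ?_⟩
  ext a b
  have : x a - x b ≤ B := hB ⟨(a, b), rfl⟩
  exact hN.pow_apply _ a b (by omega)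

/-- `M` is unitriangular with respect to the weight `x`. -/
def Unitri [DecidableEq m] (x : m → ℤ) (M : Matrix m m A) : Prop := Strict x (M - 1)

theorem Unitri.mul [Fintype m] [DecidableEq m] (hM : Unitri x M) (hN : Unitri x N) :
    Unitri x (M * N) := by
  have : M * N - 1 = (M - 1) + (N - 1) + (M - 1) * (N - 1) := by noncomm_ring
  rw [Unitri, this]
  exact (Strict.add hM hN).add (Strict.mul hM hN)

theorem unitri_one [DecidableEq m] : Unitri x (1 : Matrix m m A) := fun a b _ => by simp

theorem Unitri.submatrix [DecidableEq m] {n : Type*} [DecidableEq n] (hM : Unitri x M) {u : n → m}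
    (hu : Function.Injective u) : Unitri (x ∘ u) (M.submatrix u u) := fun a b h => by
  rw [← Matrix.submatrix_one u hu]
  exact hM (u a) (u b) h

theorem Unitri.of_weight [DecidableEq m] {y : m → ℤ} (hM : Unitri x M)
    (h : ∀ a b, y a ≤ y b → x a ≤ x b) : Unitri y M := fun a b hab => hM a b (h a b hab)

theorem Unitri.map [DecidableEq m] {B : Type*} [Ring B] (hM : Unitri x M) (φ : A →+* B) :
    Unitri x (M.map φ) := fun a b h => by
  have := congrArg φ (hM a b h)
  rw [Matrix.sub_apply, map_sub, map_zero, Matrix.one_apply] at this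
  rw [Matrix.sub_apply, Matrix.map_apply, Matrix.one_apply]
  rw [apply_ite φ, map_one, map_zero] at this
  exact this

/-- The inverse of a unitriangular matrix as a geometric sum. -/
theorem Unitri.exists_geom [Fintype m] [DecidableEq m] (hM : Unitri x M) : ∃ J : ℕ,
    M * (∑ j ∈ Finset.range (J + 1), (1 - M) ^ j) = 1 ∧
    (∑ j ∈ Finset.range (J + 1), (1 - M) ^ j) * M = 1 := by
  have hN : Strict x (1 - M) := by
    rw [← neg_sub]
    exact Strict.neg hM
  obtain ⟨J, hJ⟩ := hN.exists_pow_eq_zero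
  have h1 := mul_neg_geom_sum (1 - M) (J + 1)
  have h2 := geom_sum_mul_neg (1 - M) (J + 1)
  rw [sub_sub_cancel, pow_succ, hJ, zero_mul, sub_zero] at h1 h2
  exact ⟨J, h1, h2⟩

theorem Unitri.geom [Fintype m] [DecidableEq m] (hM : Unitri x M) (J : ℕ) :
    Unitri x (∑ j ∈ Finset.range (J + 1), (1 - M) ^ j) := by
  have hN : Strict x (1 - M) := by
    rw [← neg_sub]
    exact Strict.neg hM
  rw [Unitri, Finset.sum_range_succ', pow_zero, add_sub_cancel_right]
  intro a b h
  rw [Matrix.sum_apply]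
  refine Finset.sum_eq_zero fun j _ => hN.pow_apply _ a b ?_
  push_cast
  omega

end Unitriangular

/-- The geometric series is a finite sum, so inversion leaves neither the unitriangular matrices nor
R[∂]. -/
theorem Unitri.exists_inverse {R : Type*} [CommRing R] [Differential R] {m : Type*} [Fintype m]
    [DecidableEq m] {x : m → ℤ} {M : Matrix m m (PsiDO R)} (hM : Unitri x M) (hD : DiffMat M) :
    ∃ G, M * G = 1 ∧ G * M = 1 ∧ Unitri x G ∧ DiffMat G := by
  obtain ⟨J, h1, h2⟩ := hM.exists_geom
  exact ⟨_, h1, h2, hM.geom J, DiffMat.sum fun j _ => (diffMat_one.sub hD).pow j⟩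

theorem DiffMat.map {R S : Type*} [CommRing R] [Differential R] [CommRing S] [Differential S]
    {m n : Type*} {M : Matrix m n (PsiDO R)} (hM : DiffMat M) {φ : R →+* S}
    (hφ : ∀ x, φ x′ = (φ x)′) : DiffMat (M.map (PsiDO.mapHom φ hφ)) :=
  fun a b => (hM a b).mapHom (hφ := hφ)

end
end WGL

namespace WGL
noncomputable section
open scoped Differential

/-! ### Reduced matrix differential operators -/

section Reduced

open PsiDO

/-- The bound has the form j - 1 with j natural so that descent on j ends at order -1, where a
differential operator is zero. -/
theorem exists_common_ordLE {R : Type*} [CommRing R] {m : Type*} [Fintype m] (N : m → PsiDO R) : ∃ j : ℕ, ∀ b, (N b).OrdLE (j - 1) := by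
  choose A hA using fun b => (N b).exists_ordLE
  obtain ⟨B, hB⟩ := (Set.finite_range A).bddAbove
  exact ⟨(B + 1).toNat, fun b => (hA b).mono_right (by have := hB ⟨b, rfl⟩; omega)⟩

variable {R : Type*} [CommRing R] [Differential R] {m : Type*} [DecidableEq m]

/-- The diagonal matrix `-(-∂)^p`. -/
def topMat (R : Type*) [CommRing R] [Differential R] (p : m → ℕ) : Matrix m m (PsiDO R) :=
  Matrix.diagonal fun a => -(-D) ^ p a

/-- `W` equals `-(-∂)^p` up to terms of order less than `min (p a) (p b)`. -/
def Reduced (p : m → ℕ) (W : Matrix m m (PsiDO R)) : Prop :=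
  ∀ a b, (W a b - topMat R p a b).OrdLE (min (p a) (p b) - 1)

variable {p : m → ℕ}

theorem topMat_apply (a b : m) : topMat R p a b = if a = b then -(-D) ^ p a else 0 :=
  Matrix.diagonal_apply ..

/-- Descent on a common order bound of the row N. In N W, the term N_b (-(-∂)^{p_b}) dominates: if
all entries of N have order at most j, the others contribute to column b order at most j + p_b - 1,
and so does N W by hypothesis. Dividing by (-∂)^{p_b} gives N_b order at most j - 1. -/
theorem Reduced.row_eq_zero [Fintype m] {W : Matrix m m (PsiDO R)} (hW : Reduced p W) {q : ℕ}
    {N : m → PsiDO R} (hN : ∀ b, (N b).IsDiffOp) (h0 : ∀ b, q ≤ p b → N b = 0)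
    (h : ∀ b, p b < q → (∑ c, N c * W c b).OrdLE (p b - 1)) (b : m) : N b = 0 := by
  obtain ⟨j, hj⟩ := exists_common_ordLE N
  induction j with
  | zero => exact (hN b).eq_zero (by simpa using hj b)
  | succ j ih =>
    refine ih fun b => ?_
    rcases le_or_gt q (p b) with hb | hb
    · rw [h0 b hb]
      exact ordLE_zero _
    have e : N b = (∑ c, N c * W c b - ∑ c, N c * (W c b - topMat R p c b)) *
        negPowInv (p b) := by
      simp only [← Finset.sum_sub_distrib, ← mul_sub, sub_sub_cancel, topMat_apply, mul_ite,
        mul_zero, Finset.sum_ite_eq', Finset.mem_univ, if_true]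
      rw [mul_assoc, neg_D_pow_mul_inv, mul_one]
    rw [e]
    refine ((OrdLE.sub ((h b hb).mono_right (B := j + p b - 1) (by omega))
      (OrdLE.sum fun c _ => ?_)).mul (ordLE_negPowInv _)).mono_right (by omega)
    exact ((hj c).mul (hW c b)).mono_right (by push_cast; omega)

/-- The same descent for columns, dividing on the left. -/
theorem Reduced.col_eq_zero [Fintype m] {W : Matrix m m (PsiDO R)} (hW : Reduced p W) {q : ℕ}
    {N : m → PsiDO R} (hN : ∀ b, (N b).IsDiffOp) (h0 : ∀ b, q ≤ p b → N b = 0)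
    (h : ∀ b, p b < q → (∑ c, W b c * N c).OrdLE (p b - 1)) (b : m) : N b = 0 := by
  obtain ⟨j, hj⟩ := exists_common_ordLE N
  induction j with
  | zero => exact (hN b).eq_zero (by simpa using hj b)
  | succ j ih =>
    refine ih fun b => ?_
    rcases le_or_gt q (p b) with hb | hb
    · rw [h0 b hb]
      exact ordLE_zero _
    have e : N b = negPowInv (p b) *
        (∑ c, W b c * N c - ∑ c, (W b c - topMat R p b c) * N c) := by
      simp only [← Finset.sum_sub_distrib, ← sub_mul, sub_sub_cancel, topMat_apply, ite_mul,
        zero_mul, Finset.sum_ite_eq, Finset.mem_univ, if_true]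
      rw [← mul_assoc, inv_mul_neg_D_pow, one_mul]
    rw [e]
    refine ((ordLE_negPowInv _).mul (OrdLE.sub ((h b hb).mono_right (B := j + p b - 1) (by omega))
      (OrdLE.sum fun c _ => ?_))).mono_right (by omega)
    exact ((hW b c).mul (hj c)).mono_right (by push_cast; omega)

/-- A matrix differential operator has at most one reduced form up to multiplication by
unitriangular matrix differential operators. -/
theorem Reduced.unique [Fintype m] {W₁ W₂ E F : Matrix m m (PsiDO R)} (h₁ : Reduced p W₁)
    (h₂ : Reduced p W₂) (hE : Unitri (fun a => (p a : ℤ)) E) (hE' : DiffMat E)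
    (hF : Unitri (fun a => -(p a : ℤ)) F) (hF' : DiffMat F) (h : W₂ * F = E * W₁) : W₁ = W₂ := by
  have hord : ∀ a b, (W₂ a b - W₁ a b).OrdLE (min (p a) (p b) - 1) := fun a b => by
    rw [← sub_sub_sub_cancel_right _ _ (topMat R p a b)]
    exact (h₂ a b).sub (h₁ a b)
  -- Induction on row length. Row a of (E - 1) W₁ equals that of W₂ - W₁ + W₂ (F - 1); in columns b
  -- with p_b < p_a the last term vanishes by induction, and the difference of two reduced matrices
  -- has order below p_b. This is the input for `row_eq_zero`; columns of F - 1 are treated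
  -- symmetrically.
  have key : ∀ q, ∀ a, p a = q → (∀ c, (E - 1) a c = 0) ∧ ∀ c, (F - 1) c a = 0 := by
    intro q
    induction q using Nat.strong_induction_on with
    | _ q ih =>
      intro a ha
      refine ⟨h₁.row_eq_zero (q := q) (fun b => (hE'.sub diffMat_one) a b)
          (fun b hb => hE a b (by simp only; omega)) fun b hb => ?_,
        h₂.col_eq_zero (q := q) (fun b => (hF'.sub diffMat_one) b a)
          (fun b hb => hF b a (by simp only; omega)) fun b hb => ?_⟩
      · have e : ∑ c, (E - 1) a c * W₁ c b = W₂ a b - W₁ a b + (W₂ * (F - 1)) a b := by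
          rw [← Matrix.mul_apply, sub_mul, mul_sub, h, one_mul, mul_one, Matrix.sub_apply,
            Matrix.sub_apply]
          abel
        have e' : (W₂ * (F - 1)) a b = 0 := by
          rw [Matrix.mul_apply]
          exact Finset.sum_eq_zero fun c _ => by rw [(ih _ hb b rfl).2 c, mul_zero]
        rw [e, e', add_zero]
        exact (hord a b).mono_right (by omega)
      · have e : ∑ c, W₂ b c * (F - 1) c a = ((E - 1) * W₁) b a - (W₂ b a - W₁ b a) := by
          rw [← Matrix.mul_apply, sub_mul, mul_sub, h, one_mul, mul_one, Matrix.sub_apply,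
            Matrix.sub_apply]
          abel
        have e' : ((E - 1) * W₁) b a = 0 := by
          rw [Matrix.mul_apply]
          exact Finset.sum_eq_zero fun c _ => by rw [(ih _ hb b rfl).1 c, zero_mul]
        rw [e, e', zero_sub]
        exact ((hord b a).mono_right (by omega)).neg
  have hE1 : E = 1 := sub_eq_zero.1 (Matrix.ext fun a c => (key _ a rfl).1 c)
  have hF1 : F = 1 := sub_eq_zero.1 (Matrix.ext fun c a => (key _ a rfl).2 c)
  rw [hE1, hF1, one_mul, mul_one] at h
  exact h.symm

variable {S : Type*} [CommRing S] [Differential S]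

theorem map_topMat {φ : R →+* S} (hφ : ∀ x, φ x′ = (φ x)′) :
    (topMat R p).map (mapHom φ hφ) = topMat S p := by
  ext1 a b
  rw [Matrix.map_apply, topMat_apply, topMat_apply]
  split_ifs <;> simp [mapHom_D]

theorem Reduced.map {W : Matrix m m (PsiDO R)} (h : Reduced p W) {φ : R →+* S}
    (hφ : ∀ x, φ x′ = (φ x)′) : Reduced p (W.map (mapHom φ hφ)) := fun a b => by
  rw [← map_topMat hφ, Matrix.map_apply, Matrix.map_apply, ← map_sub]
  exact (h a b).mapHom

/-- Reduced forms are compatible with unitriangular equivalence. -/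
theorem Reduced.eq_of_equiv [Fintype m] {T₁ T₂ E₁ F₁ E₂ F₂ A B : Matrix m m (PsiDO R)}
    (h₁ : Reduced p (E₁ * T₁ * F₁)) (h₂ : Reduced p (E₂ * T₂ * F₂))
    (hE₁ : Unitri (fun a => (p a : ℤ)) E₁ ∧ DiffMat E₁)
    (hF₁ : Unitri (fun a => -(p a : ℤ)) F₁ ∧ DiffMat F₁)
    (hE₂ : Unitri (fun a => (p a : ℤ)) E₂ ∧ DiffMat E₂)
    (hF₂ : Unitri (fun a => -(p a : ℤ)) F₂ ∧ DiffMat F₂)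
    (hB : Unitri (fun a => (p a : ℤ)) B ∧ DiffMat B)
    (hA : Unitri (fun a => -(p a : ℤ)) A ∧ DiffMat A) (h : T₂ * A = B * T₁) :
    E₁ * T₁ * F₁ = E₂ * T₂ * F₂ := by
  obtain ⟨G, hG1, hG2, hG3, hG4⟩ := hE₁.1.exists_inverse hE₁.2
  obtain ⟨H, hH1, hH2, hH3, hH4⟩ := hF₂.1.exists_inverse hF₂.2
  -- With G = E₁⁻¹ and H = F₂⁻¹, the relation T₂ A = B T₁ becomes W₂ (F₂⁻¹ A F₁) = (E₂ B E₁⁻¹) W₁.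
  refine h₁.unique h₂ (E := E₂ * B * G) ((hE₂.1.mul hB.1).mul hG3) ((hE₂.2.mul hB.2).mul hG4)
    (F := H * A * F₁) ((hH3.mul hA.1).mul hF₁.1) ((hH4.mul hA.2).mul hF₁.2) ?_
  calc E₂ * T₂ * F₂ * (H * A * F₁) = E₂ * T₂ * (F₂ * H) * A * F₁ := by simp only [mul_assoc]
    _ = E₂ * (T₂ * A) * F₁ := by rw [hH1, mul_one]; simp only [mul_assoc]
    _ = E₂ * B * (G * E₁) * T₁ * F₁ := by rw [h, hG2, mul_one]; simp only [mul_assoc]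
    _ = _ := by simp only [mul_assoc]

end Reduced

/-! ### The recursion -/

namespace Pyramid

open PsiDO

variable {r : ℕ} (P : Pyramid r)

/-- The lengths of the rows as integers. -/
def partZ (a : Fin r) : ℤ := P.part a

theorem block_lt_block {a b : Fin r} : P.block a < P.block b ↔ P.part b < P.part a := by
  have key : ∀ {a b : Fin r}, P.part b < P.part a → P.block a < P.block b := by
    intro a b h
    refine Nat.add_lt_add_right (Finset.card_lt_card ?_) 1
    refine Finset.ssubset_iff.2 ⟨P.part a, by simp, ?_⟩
    intro l hl
    rw [Finset.mem_insert] at hl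
    rcases hl with rfl | hl
    · simp [h]
    · rw [Finset.mem_filter] at hl ⊢
      exact ⟨hl.1, h.trans hl.2⟩
  refine ⟨fun h => ?_, key⟩
  rcases lt_trichotomy (P.part b) (P.part a) with h' | h' | h'
  · exact h'
  · rw [block, block, h'] at h
    exact absurd h (lt_irrefl _)
  · exact absurd (key h') (not_lt.2 h.le)

theorem part_eq_of_block_eq {a b : Fin r} (h : P.block a = P.block b) : P.part a = P.part b := by
  by_contra h'
  rcases lt_or_gt_of_ne h' with h' | h' <;> have := P.block_lt_block.2 h' <;> omega

theorem block_le_numBlocks (a : Fin r) : P.block a ≤ P.numBlocks := by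
  refine Nat.succ_le_of_lt (Finset.card_lt_card ?_)
  refine Finset.ssubset_iff.2 ⟨P.part a, by simp, ?_⟩
  intro l hl
  rw [Finset.mem_insert] at hl
  rcases hl with rfl | hl
  · simp
  · exact Finset.filter_subset _ _ hl

/-- The leading part `-(-∂)^p` of all operators in the recursion. -/
abbrev lead : Matrix (Fin r) (Fin r) (PsiDO P.Vle) := topMat P.Vle P.part

/-- Columns carry the weight -p, so degree d means order at most (d + p_a + p_b)/2, which is p_a on
the diagonal for d = 0. -/
theorem lead_filLE : FilLE P.partZ (-P.partZ) 0 P.lead := by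
  rw [filLE_iff]
  intro a b
  rw [lead, topMat_apply]
  split_ifs with h
  · subst h
    exact (ordLE_neg_D_pow _).neg.mono_right (by simp only [partZ, Pi.neg_apply]; omega)
  · exact ordLE_zero _

/-- `M` is a matrix differential operator with leading part `-(-∂)^p`. -/
def Admissible (M : Matrix (Fin r) (Fin r) (PsiDO P.Vle)) : Prop :=
  DiffMat M ∧ FilLE P.partZ (-P.partZ) (-1) (M - P.lead)

variable {P} {M : Matrix (Fin r) (Fin r) (PsiDO P.Vle)} {k : ℕ}

theorem Admissible.filLE (hM : P.Admissible M) : FilLE P.partZ (-P.partZ) 0 M := by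
  rw [← sub_add_cancel M P.lead]
  exact (hM.2.mono (by omega)).add P.lead_filLE

/-- On any union of blocks the diagonal part -(-∂)^p has an inverse of degree 0, and the remainder
of degree -1 is a small perturbation. -/
theorem Admissible.corner (hM : P.Admissible M) (k : ℕ) : IsUnit (P.corner k M) ∧
    FilLE (-P.partZ ∘ Subtype.val) (P.partZ ∘ Subtype.val) 0 (Ring.inverse (P.corner k M)) := by
  have e : P.corner k M = Matrix.diagonal (fun a => -(-D) ^ P.part a.1) +
      (M - P.lead).submatrix Subtype.val Subtype.val := by
    ext1 a b
    rw [Matrix.add_apply, Matrix.submatrix_apply, Matrix.sub_apply, lead, topMat_apply,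
      Matrix.diagonal_apply, Pyramid.corner, Matrix.submatrix_apply]
    simp only [← Subtype.ext_iff]
    abel
  rw [e]
  refine FilLE.inverse_add (d := 0) (x := P.partZ ∘ Subtype.val) (y := (-P.partZ) ∘ Subtype.val)
    (M' := Matrix.diagonal fun a => negPowInv (P.part a.1)) ?_ ?_ ?_ ?_
  · rw [Matrix.diagonal_mul_diagonal]
    simp only [neg_D_pow_mul_inv, Matrix.diagonal_one]
  · rw [Matrix.diagonal_mul_diagonal]
    simp only [inv_mul_neg_D_pow, Matrix.diagonal_one]
  · rw [filLE_iff]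
    intro a b
    rw [Matrix.diagonal_apply]
    split_ifs with h
    · subst h
      refine (ordLE_negPowInv _).mono_right ?_
      simp only [partZ, Pi.neg_apply, Function.comp]
      omega
    · exact ordLE_zero _
  · exact hM.2.submatrix _ _

theorem sum_eq_sum_subtype {ι A : Type*} [Fintype ι] [AddCommMonoid A] {q : ι → Prop}
    [DecidablePred q] {f : ι → A} (h : ∀ c, ¬ q c → f c = 0) :
    ∑ c, f c = ∑ c : {c // q c}, f c := by
  rw [← Finset.sum_subtype (Finset.univ.filter q) (by simp), Finset.sum_filter]
  exact Finset.sum_congr rfl fun c _ => by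
    by_cases hc : q c
    · rw [if_pos hc]
    · rw [if_neg hc, h c hc]

variable (P M k) in
theorem rightQuot_eq : P.rightQuot k M =
    (M.submatrix (id : Fin r → Fin r) Subtype.val : Matrix (Fin r) {a // k + 1 ≤ P.block a} _) *
      Ring.inverse (P.corner (k + 1) M) := rfl

variable (P M k) in
theorem leftQuot_eq : P.leftQuot k M = Ring.inverse (P.corner (k + 1) M) *
    (M.submatrix Subtype.val (id : Fin r → Fin r) : Matrix {a // k + 1 ≤ P.block a} (Fin r) _) := rfl

/-- A row of block k and columns of later blocks never meet on the diagonal, so the leading part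
drops out and the quotient has degree -1 instead of 0. -/
theorem Admissible.ordLE_rightQuot (hM : P.Admissible M) {a : Fin r} (ha : P.block a = k)
    (b : {b // k + 1 ≤ P.block b}) :
    (P.rightQuot k M a b).OrdLE ((-1 + P.partZ a - P.partZ b) / 2) := by
  have e : P.rightQuot k M a b = (((M - P.lead).submatrix (id : Fin r → Fin r) Subtype.val :
      Matrix (Fin r) {a // k + 1 ≤ P.block a} _) * Ring.inverse (P.corner (k + 1) M)) a b := by
    rw [rightQuot_eq, Matrix.mul_apply, Matrix.mul_apply]
    refine Finset.sum_congr rfl fun c _ => ?_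
    have : a ≠ c.1 := fun h => by
      have := c.2
      rw [← h] at this
      omega
    simp [topMat_apply, this]
  rw [e]
  exact filLE_iff.1 ((hM.2.submatrix id Subtype.val).mul (hM.corner (k + 1)).2) a b

theorem Admissible.ordLE_leftQuot (hM : P.Admissible M) {b : Fin r} (hb : P.block b = k)
    (a : {a // k + 1 ≤ P.block a}) :
    (P.leftQuot k M a b).OrdLE ((-1 - P.partZ a + P.partZ b) / 2) := by
  have e : P.leftQuot k M a b = (Ring.inverse (P.corner (k + 1) M) *
      ((M - P.lead).submatrix Subtype.val (id : Fin r → Fin r) :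
        Matrix {a // k + 1 ≤ P.block a} (Fin r) _)) a b := by
    rw [leftQuot_eq, Matrix.mul_apply, Matrix.mul_apply]
    refine Finset.sum_congr rfl fun c _ => ?_
    have : c.1 ≠ b := fun h => by
      have := c.2
      rw [h] at this
      omega
    simp [topMat_apply, this]
  rw [e]
  refine (filLE_iff.1 ((hM.corner (k + 1)).2.mul (hM.2.submatrix Subtype.val id)) a b).mono_right ?_
  simp only [Pi.neg_apply, Function.comp]
  exact (congrArg (· / 2) (by simp only [id]; ring)).le

variable (P k M)

/-- `1 - E₋⁽ᵏ⁾`. -/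
def eCorr : Matrix (Fin r) (Fin r) (PsiDO P.Vle) := 1 - P.eMinus k M

/-- `1 - F₋⁽ᵏ⁾`. -/
def fCorr : Matrix (Fin r) (Fin r) (PsiDO P.Vle) := 1 - P.fMinus k M

theorem eCorr_apply (a b : Fin r) : P.eCorr M k a b =
    if h : P.block a = k ∧ k + 1 ≤ P.block b then (P.rightQuot k M a ⟨b, h.2⟩).posPart else 0 := by
  rw [eCorr, eMinus, sub_sub_cancel, Matrix.of_apply]

theorem fCorr_apply (a b : Fin r) : P.fCorr M k a b =
    if h : k + 1 ≤ P.block a ∧ P.block b = k then (P.leftQuot k M ⟨a, h.1⟩ b).posPart else 0 := by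
  rw [fCorr, fMinus, sub_sub_cancel, Matrix.of_apply]

theorem eMinus_eq : P.eMinus k M = 1 - P.eCorr M k := by rw [eCorr, sub_sub_cancel]

theorem fMinus_eq : P.fMinus k M = 1 - P.fCorr M k := by rw [fCorr, sub_sub_cancel]

theorem diffMat_eMinus : DiffMat (P.eMinus k M) := by
  rw [eMinus_eq]
  refine diffMat_one.sub fun a b => ?_
  rw [eCorr_apply]
  split_ifs
  exacts [isDiffOp_posPart _, (diffOps _).zero_mem]

theorem diffMat_fMinus : DiffMat (P.fMinus k M) := by
  rw [fMinus_eq]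
  refine diffMat_one.sub fun a b => ?_
  rw [fCorr_apply]
  split_ifs
  exacts [isDiffOp_posPart _, (diffOps _).zero_mem]

/-- A correction links a row of block k to a later block only, that is, to a strictly shorter row.
-/
theorem unitri_eMinus : Unitri (fun a => (P.part a : ℤ)) (P.eMinus k M) := fun a b h => by
  rw [eMinus_eq, sub_sub_cancel_left, Matrix.neg_apply, eCorr_apply, dif_neg, neg_zero]
  rintro ⟨h1, h2⟩
  have := P.block_lt_block.1 (show P.block a < P.block b by omega)
  simp only at h
  omega

theorem unitri_fMinus : Unitri (fun a => -(P.part a : ℤ)) (P.fMinus k M) := fun a b h => by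
  rw [fMinus_eq, sub_sub_cancel_left, Matrix.neg_apply, fCorr_apply, dif_neg, neg_zero]
  rintro ⟨h1, h2⟩
  have := P.block_lt_block.1 (show P.block b < P.block a by omega)
  simp only at h
  omega

variable {P k M}

theorem Admissible.filLE_eCorr (hM : P.Admissible M) :
    FilLE P.partZ P.partZ (-1) (P.eCorr M k) := by
  rw [filLE_iff]
  intro a b
  rw [eCorr_apply]
  split_ifs with h
  exacts [(hM.ordLE_rightQuot h.1 _).posPart, ordLE_zero _]

theorem Admissible.filLE_fCorr (hM : P.Admissible M) :
    FilLE (-P.partZ) (-P.partZ) (-1) (P.fCorr M k) := by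
  rw [filLE_iff]
  intro a b
  rw [fCorr_apply]
  split_ifs with h
  · refine (hM.ordLE_leftQuot h.2 _).posPart.mono_right ?_
    simp only [Pi.neg_apply]
    omega
  · exact ordLE_zero _

/-- Both corrections have degree -1 and M has degree 0, so every correction term in the expanded
product stays below the leading part. -/
theorem Admissible.step (hM : P.Admissible M) :
    P.Admissible (P.eMinus k M * M * P.fMinus k M) := by
  refine ⟨((P.diffMat_eMinus M k).mul hM.1).mul (P.diffMat_fMinus M k), ?_⟩
  have e : P.eMinus k M * M * P.fMinus k M - P.lead = M - P.lead - P.eCorr M k * M -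
      M * P.fCorr M k + P.eCorr M k * M * P.fCorr M k := by
    rw [eMinus_eq, fMinus_eq]
    noncomm_ring
  rw [e]
  refine ((hM.2.sub ?_).sub ?_).add ?_
  · exact (hM.filLE_eCorr.mul hM.filLE).mono (by omega)
  · exact (hM.filLE.mul hM.filLE_fCorr).mono (by omega)
  · exact ((hM.filLE_eCorr.mul hM.filLE).mul hM.filLE_fCorr).mono (by omega)

/-- The corner of `M` in the blocks `≥ k` is reduced. -/
def CornerReduced (P : Pyramid r) (k : ℕ) (M : Matrix (Fin r) (Fin r) (PsiDO P.Vle)) : Prop :=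
  ∀ a b, k ≤ P.block a → k ≤ P.block b →
    (M a b - P.lead a b).OrdLE (min (P.part a) (P.part b) - 1)

/-- For equal lengths p, the bound (2p - 1)/2 rounds down to p - 1, so within one block admissible
already means reduced. -/
theorem Admissible.ordLE_of_block_eq (hM : P.Admissible M) {a b : Fin r}
    (h : P.block a = P.block b) :
    (M a b - P.lead a b).OrdLE (min (P.part a) (P.part b) - 1) := by
  have := P.part_eq_of_block_eq h
  refine (filLE_iff.1 hM.2 a b).mono_right ?_
  simp only [partZ, Pi.neg_apply]
  omega

theorem CornerReduced.ordLE_left (h : P.CornerReduced k M) {a b : Fin r} (ha : k ≤ P.block a)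
    (hb : k ≤ P.block b) : (M a b).OrdLE (P.part a) := by
  rw [← sub_add_cancel (M a b) (P.lead a b)]
  refine ((h a b ha hb).mono_right (by omega)).add ?_
  rw [lead, topMat_apply]
  split_ifs
  exacts [(ordLE_neg_D_pow _).neg, ordLE_zero _]

theorem CornerReduced.ordLE_right (h : P.CornerReduced k M) {a b : Fin r} (ha : k ≤ P.block a)
    (hb : k ≤ P.block b) : (M a b).OrdLE (P.part b) := by
  rw [← sub_add_cancel (M a b) (P.lead a b)]
  refine ((h a b ha hb).mono_right (by omega)).add ?_
  rw [lead, topMat_apply]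
  split_ifs with h'
  exacts [h' ▸ (ordLE_neg_D_pow _).neg, ordLE_zero _]

/-- Subtracting the positive part of a quotient is division with remainder: the new off-diagonal
block is W times an operator of order at most -1, so its order is below the length of the shorter
row. The old corner is untouched, and the new diagonal block is reduced by admissibility. -/
theorem Admissible.cornerReduced_step (hM : P.Admissible M) (h : P.CornerReduced (k + 1) M) :
    P.CornerReduced k (P.eMinus k M * M * P.fMinus k M) := by
  intro a b ha hb
  have hW := (hM.corner (k + 1)).1
  rcases ha.lt_or_eq with ha | ha <;> rcases hb.lt_or_eq with hb | hb
  · have e : (P.eMinus k M * M * P.fMinus k M) a b = M a b := by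
      rw [fMinus_eq, mul_sub, mul_one, eMinus_eq, Matrix.sub_apply, Matrix.mul_apply (N := P.fCorr M k),
        Finset.sum_eq_zero, sub_zero, sub_mul, one_mul, Matrix.sub_apply, Matrix.mul_apply,
        Finset.sum_eq_zero, sub_zero]
      · intro c _
        rw [eCorr_apply, dif_neg (by omega), zero_mul]
      · intro c _
        rw [fCorr_apply, dif_neg (by omega), mul_zero]
    rw [e]
    exact h a b ha hb
  -- Only the right factor acts here. Row a of the old corner has order at most p_a < p_b, so a
  -- remainder of order -1 gives order at most p_a - 1.
  · have hq : M a b = ∑ c : {c // k + 1 ≤ P.block c}, M a c * P.leftQuot k M c b := by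
      have : P.corner (k + 1) M * P.leftQuot k M = M.submatrix Subtype.val id := by
        rw [leftQuot_eq, ← Matrix.mul_assoc, Ring.mul_inverse_cancel _ hW, Matrix.one_mul]
      exact (congrFun (congrFun this ⟨a, ha⟩) b).symm.trans (Matrix.mul_apply ..)
    have e : (P.eMinus k M * M * P.fMinus k M) a b = ∑ c : {c // k + 1 ≤ P.block c},
        M a c * (P.leftQuot k M c b - (P.leftQuot k M c b).posPart) := by
      rw [mul_assoc, eMinus_eq, sub_mul, one_mul, Matrix.sub_apply, Matrix.mul_apply (M := P.eCorr M k),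
        Finset.sum_eq_zero, sub_zero, fMinus_eq, mul_sub, mul_one, Matrix.sub_apply,
        Matrix.mul_apply, sum_eq_sum_subtype (q := fun c => k + 1 ≤ P.block c)]
      · nth_rewrite 1 [hq]
        rw [← Finset.sum_sub_distrib]
        refine Finset.sum_congr rfl fun c _ => ?_
        rw [fCorr_apply, dif_pos ⟨c.2, hb.symm⟩, mul_sub]
      · intro c hc
        rw [fCorr_apply, dif_neg (by tauto), mul_zero]
      · intro c _
        rw [eCorr_apply, dif_neg (by omega), zero_mul]
    have hlt := P.block_lt_block.1 (show P.block b < P.block a by omega)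
    rw [e, lead, topMat_apply, if_neg (by rintro rfl; omega), sub_zero]
    refine OrdLE.sum fun c _ => ((h.ordLE_left ha c.2).mul (ordLE_sub_posPart _)).mono_right ?_
    omega
  -- The mirror case: only the left factor acts, and column b of the old corner has order at most
  -- p_b < p_a.
  · have hq : M a b = ∑ c : {c // k + 1 ≤ P.block c}, P.rightQuot k M a c * M c b := by
      have : P.rightQuot k M * P.corner (k + 1) M = M.submatrix id Subtype.val := by
        rw [rightQuot_eq, Matrix.mul_assoc, Ring.inverse_mul_cancel _ hW, Matrix.mul_one]
      exact (congrFun (congrFun this a) ⟨b, hb⟩).symm.trans (Matrix.mul_apply ..)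
    have e : (P.eMinus k M * M * P.fMinus k M) a b = ∑ c : {c // k + 1 ≤ P.block c},
        (P.rightQuot k M a c - (P.rightQuot k M a c).posPart) * M c b := by
      rw [fMinus_eq, mul_sub, mul_one, Matrix.sub_apply, Matrix.mul_apply (N := P.fCorr M k),
        Finset.sum_eq_zero, sub_zero, eMinus_eq, sub_mul, one_mul, Matrix.sub_apply,
        Matrix.mul_apply, sum_eq_sum_subtype (q := fun c => k + 1 ≤ P.block c)]
      · nth_rewrite 1 [hq]
        rw [← Finset.sum_sub_distrib]
        refine Finset.sum_congr rfl fun c _ => ?_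
        rw [eCorr_apply, dif_pos ⟨ha.symm, c.2⟩, sub_mul]
      · intro c hc
        rw [eCorr_apply, dif_neg (by tauto), zero_mul]
      · intro c _
        rw [fCorr_apply, dif_neg (by omega), mul_zero]
    have hlt := P.block_lt_block.1 (show P.block a < P.block b by omega)
    rw [e, lead, topMat_apply, if_neg (by rintro rfl; omega), sub_zero]
    refine OrdLE.sum fun c _ => ((ordLE_sub_posPart _).mul (h.ordLE_right c.2 hb)).mono_right ?_
    omega
  · exact hM.step.ordLE_of_block_eq (ha.symm.trans hb)

/-- All steps of the recursion: `T⁽ᵏ⁾` is admissible, its corner is reduced, and it is equivalent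
to `T` by unitriangular matrix differential operators. -/
theorem recAux_spec (hT : P.Admissible P.opT) (j : ℕ) (hj : j < P.numBlocks ∨ j = 0) :
    P.Admissible (P.recAux j) ∧ P.CornerReduced (P.numBlocks - j) (P.recAux j) ∧
    ∃ E F, (Unitri (fun a => (P.part a : ℤ)) E ∧ DiffMat E) ∧
      (Unitri (fun a => -(P.part a : ℤ)) F ∧ DiffMat F) ∧ P.recAux j = E * P.opT * F := by
  induction j with
  | zero =>
    -- Rows in blocks ≥ s all lie in the last block.
    refine ⟨hT, fun a b ha hb => hT.ordLE_of_block_eq ?_, 1, 1, ⟨unitri_one, diffMat_one⟩,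
      ⟨unitri_one, diffMat_one⟩, by rw [one_mul, mul_one]; rfl⟩
    have := P.block_le_numBlocks a
    have := P.block_le_numBlocks b
    omega
  | succ j ih =>
    obtain ⟨h1, h2, E, F, hE, hF, h3⟩ := ih (by omega)
    rw [show P.numBlocks - j = P.numBlocks - (j + 1) + 1 by omega] at h2
    refine ⟨h1.step, h1.cornerReduced_step h2, P.eMinus (P.numBlocks - (j + 1)) (P.recAux j) * E,
      F * P.fMinus (P.numBlocks - (j + 1)) (P.recAux j),
      ⟨(P.unitri_eMinus _ _).mul hE.1, (P.diffMat_eMinus _ _).mul hE.2⟩,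
      ⟨hF.1.mul (P.unitri_fMinus _ _), hF.2.mul (P.diffMat_fMinus _ _)⟩, ?_⟩
    rw [recAux]
    nth_rewrite 2 [h3]
    simp only [mul_assoc]

end Pyramid
end
end WGL

namespace WGL
noncomputable section
open scoped Differential

/-! ### The quasideterminant `T(∂)` -/

section Selection

variable {A : Type*} [Ring A] {m n l : Type*} [DecidableEq n]

/-- The inclusion of the span of the basis vectors with indices `u a`. -/
def selR (A : Type*) [Ring A] (u : m → n) : Matrix n m A := (1 : Matrix n n A).submatrix id u

/-- The coordinate projection onto the span of the basis vectors with indices `u a`. -/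
def selL (A : Type*) [Ring A] (u : m → n) : Matrix m n A := (1 : Matrix n n A).submatrix u id

theorem mul_selR [Fintype n] (M : Matrix l n A) (u : m → n) : M * selR A u = M.submatrix id u := by
  ext a b
  simp [selR, Matrix.mul_apply, Matrix.one_apply]

theorem selL_mul [Fintype n] (M : Matrix n l A) (u : m → n) : selL A u * M = M.submatrix u id := by
  ext a b
  simp [selL, Matrix.mul_apply, Matrix.one_apply]

theorem selL_mul_selR [Fintype n] [DecidableEq m] {u : m → n} (hu : Function.Injective u) :
    selL A u * selR A u = 1 := by
  rw [selL_mul, selR, Matrix.submatrix_submatrix]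
  exact Matrix.submatrix_one u hu

theorem selR_map {B : Type*} [Ring B] (φ : A →+* B) (u : m → n) :
    (selR A u).map φ = selR B u := by
  ext a b
  simp only [selR, Matrix.map_apply, Matrix.submatrix_apply, Matrix.one_apply]
  split_ifs <;> simp

theorem selL_map {B : Type*} [Ring B] (φ : A →+* B) (u : m → n) :
    (selL A u).map φ = selL B u := by
  ext a b
  simp only [selL, Matrix.map_apply, Matrix.submatrix_apply, Matrix.one_apply]
  split_ifs <;> simp

end Selection

namespace Pyramid

open PsiDO

variable {r : ℕ} (P : Pyramid r)

/-- Twice the eigenvalue of `χ`. -/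
def ht (x : P.Box) : ℤ := (P.part x.1 : ℤ) - 1 - 2 * ((x.2 : ℕ) : ℤ)

theorem deg_eq (x : P.Box × P.Box) : P.deg x = ((P.ht x.1 - P.ht x.2 : ℤ) : ℚ) / 2 := by
  simp only [deg, chi, ht]
  push_cast
  ring

theorem deg_le_iff (x : P.Box × P.Box) : P.deg x ≤ 1 / 2 ↔ P.ht x.1 - P.ht x.2 ≤ 1 := by
  rw [deg_eq, div_le_div_iff_of_pos_right (by norm_num)]
  exact_mod_cast Iff.rfl

theorem le_deg_iff (x : P.Box × P.Box) : 1 / 2 ≤ P.deg x ↔ 1 ≤ P.ht x.1 - P.ht x.2 := by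
  rw [deg_eq, div_le_div_iff_of_pos_right (by norm_num)]
  exact_mod_cast Iff.rfl

theorem box_ext {x y : P.Box} (h1 : x.1 = y.1) (h2 : (x.2 : ℕ) = y.2) : x = y := by
  obtain ⟨a, i⟩ := x
  obtain ⟨b, j⟩ := y
  obtain rfl : a = b := h1
  obtain rfl : i = j := Fin.ext h2
  rfl

theorem firstBox_injective : Function.Injective P.firstBox := fun _ _ h => congrArg Sigma.fst h

theorem lastBox_injective : Function.Injective P.lastBox := fun _ _ h => congrArg Sigma.fst h

theorem ht_firstBox (a : Fin r) : P.ht (P.firstBox a) = P.part a - 1 := by simp [ht, firstBox]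

theorem ht_lastBox (a : Fin r) : P.ht (P.lastBox a) = 1 - P.part a := by
  have := P.pos a
  simp only [ht, lastBox]
  omega

/-- The box after `x` in its row. -/
def next (x : P.Box) (h : (x.2 : ℕ) + 1 < P.part x.1) : P.Box := ⟨x.1, ⟨(x.2 : ℕ) + 1, h⟩⟩

/-- The box before `x` in its row. -/
def prev (x : P.Box) : P.Box := ⟨x.1, ⟨(x.2 : ℕ) - 1, by have := x.2.2; omega⟩⟩

theorem ht_next (x : P.Box) (h : (x.2 : ℕ) + 1 < P.part x.1) : P.ht (P.next x h) = P.ht x - 2 := by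
  simp only [ht, next]
  push_cast
  ring

theorem ht_prev {x : P.Box} (h : 0 < (x.2 : ℕ)) : P.ht (P.prev x) = P.ht x + 2 := by
  simp only [ht, prev]
  omega

theorem eq_lastBox {x : P.Box} (h : ¬ (x.2 : ℕ) + 1 < P.part x.1) : x = P.lastBox x.1 :=
  P.box_ext rfl (by have := x.2.2; simp only [lastBox]; omega)

theorem eq_firstBox {x : P.Box} (h : ¬ 0 < (x.2 : ℕ)) : x = P.firstBox x.1 :=
  P.box_ext rfl (by simp only [firstBox]; omega)

section Shift

variable {A : Type*} [Ring A] {l : Type*}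

/-- The nilpotent matrix `f` over a ring `A`. -/
def shiftF (A : Type*) [Ring A] : Matrix P.Box P.Box A :=
  Matrix.of fun x y => if x.1 = y.1 ∧ (x.2 : ℕ) = (y.2 : ℕ) + 1 then 1 else 0

/-- The transpose of `f`. -/
def shiftE (A : Type*) [Ring A] : Matrix P.Box P.Box A := (P.shiftF A).transpose

theorem shiftF_apply (x y : P.Box) : P.shiftF A x y =
    if x.1 = y.1 ∧ (x.2 : ℕ) = (y.2 : ℕ) + 1 then 1 else 0 := rfl

theorem shiftE_apply (x y : P.Box) : P.shiftE A x y =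
    if y.1 = x.1 ∧ (y.2 : ℕ) = (x.2 : ℕ) + 1 then 1 else 0 := rfl

theorem shiftE_mul (N : Matrix P.Box l A) (x : P.Box) (y : l) : (P.shiftE A * N) x y =
    if h : (x.2 : ℕ) + 1 < P.part x.1 then N (P.next x h) y else 0 := by
  rw [Matrix.mul_apply]
  split_ifs with h
  · rw [Finset.sum_eq_single (P.next x h)]
    · rw [shiftE_apply, if_pos ⟨rfl, rfl⟩, one_mul]
    · intro z _ hz
      rw [shiftE_apply, if_neg, zero_mul]
      rintro ⟨h1, h2⟩
      exact hz (P.box_ext h1 h2)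
    · simp
  · refine Finset.sum_eq_zero fun z _ => ?_
    rw [shiftE_apply, if_neg, zero_mul]
    rintro ⟨h1, h2⟩
    have := z.2.2
    have := congrArg P.part h1
    omega

theorem shiftF_mul (N : Matrix P.Box l A) (x : P.Box) (y : l) : (P.shiftF A * N) x y =
    if 0 < (x.2 : ℕ) then N (P.prev x) y else 0 := by
  rw [Matrix.mul_apply]
  split_ifs with h
  · rw [Finset.sum_eq_single (P.prev x)]
    · rw [shiftF_apply, if_pos ⟨rfl, by simp only [prev]; omega⟩, one_mul]
    · intro z _ hz
      rw [shiftF_apply, if_neg, zero_mul]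
      rintro ⟨h1, h2⟩
      exact hz (P.box_ext h1.symm (by simp only [prev]; omega))
    · simp
  · refine Finset.sum_eq_zero fun z _ => ?_
    rw [shiftF_apply, if_neg (by omega), zero_mul]

theorem mul_shiftE (N : Matrix l P.Box A) (x : l) (y : P.Box) : (N * P.shiftE A) x y =
    if 0 < (y.2 : ℕ) then N x (P.prev y) else 0 := by
  rw [Matrix.mul_apply]
  split_ifs with h
  · rw [Finset.sum_eq_single (P.prev y)]
    · rw [shiftE_apply, if_pos ⟨rfl, by simp only [prev]; omega⟩, mul_one]
    · intro z _ hz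
      rw [shiftE_apply, if_neg, mul_zero]
      rintro ⟨h1, h2⟩
      exact hz (P.box_ext h1.symm (by simp only [prev]; omega))
    · simp
  · refine Finset.sum_eq_zero fun z _ => ?_
    rw [shiftE_apply, if_neg (by omega), mul_zero]

theorem mul_shiftF (N : Matrix l P.Box A) (x : l) (y : P.Box) : (N * P.shiftF A) x y =
    if h : (y.2 : ℕ) + 1 < P.part y.1 then N x (P.next y h) else 0 := by
  rw [Matrix.mul_apply]
  split_ifs with h
  · rw [Finset.sum_eq_single (P.next y h)]
    · rw [shiftF_apply, if_pos ⟨rfl, rfl⟩, mul_one]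
    · intro z _ hz
      rw [shiftF_apply, if_neg, mul_zero]
      rintro ⟨h1, h2⟩
      exact hz (P.box_ext h1 h2)
    · simp
  · refine Finset.sum_eq_zero fun z _ => ?_
    rw [shiftF_apply, if_neg, mul_zero]
    rintro ⟨h1, h2⟩
    have := z.2.2
    have := congrArg P.part h1
    omega

theorem selR_mul_selL_apply (u : Fin r → P.Box) (x y : P.Box) :
    (selR A u * selL A u) x y = if x = y ∧ ∃ a, x = u a then
      ((Finset.univ.filter fun a => x = u a).card : A) else 0 := by
  simp only [Matrix.mul_apply, selR, selL, Matrix.submatrix_apply, id, Matrix.one_apply]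
  split_ifs with h
  · rw [← Finset.sum_boole]
    refine Finset.sum_congr rfl fun a _ => ?_
    rw [← h.1]
    by_cases ha : x = u a
    · simp [← ha]
    · simp [ha]
  · refine Finset.sum_eq_zero fun a _ => ?_
    by_cases ha : x = u a
    · rw [if_neg (c := u a = y), mul_zero]
      rintro rfl
      exact h ⟨ha, a, ha⟩
    · rw [if_neg ha, zero_mul]

theorem shiftE_mul_shiftF :
    P.shiftE A * P.shiftF A = 1 - selR A P.lastBox * selL A P.lastBox := by
  ext x y
  rw [shiftE_mul, Matrix.sub_apply, Matrix.one_apply, selR_mul_selL_apply]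
  split_ifs with h1 h2 h3 h4
  · obtain ⟨a, ha⟩ := h3.2
    subst ha
    simp only [lastBox] at h1
    omega
  · subst h2
    rw [shiftF_apply, if_pos ⟨rfl, rfl⟩, sub_zero]
  · exact absurd h4.1 h2
  · rw [shiftF_apply, if_neg, sub_zero]
    rintro ⟨h, h'⟩
    exact h2 (P.box_ext h (by simp only [next] at h'; omega))
  · have : (Finset.univ.filter fun a => x = P.lastBox a) = {x.1} := by
      ext a
      simp only [Finset.mem_filter, Finset.mem_univ, true_and, Finset.mem_singleton]
      refine ⟨fun h => by rw [h]; rfl, fun h => by rw [h]; exact P.eq_lastBox h1⟩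
    simp [this]
  · rename_i h3 h4
    exact absurd ⟨h3, x.1, P.eq_lastBox h1⟩ h4
  · rename_i h3 h4
    exact absurd h4.1 h3
  · simp

theorem shiftF_mul_shiftE :
    P.shiftF A * P.shiftE A = 1 - selR A P.firstBox * selL A P.firstBox := by
  ext x y
  rw [shiftF_mul, Matrix.sub_apply, Matrix.one_apply, selR_mul_selL_apply]
  split_ifs with h1 h2 h3 h4
  · obtain ⟨a, ha⟩ := h3.2
    subst ha
    simp only [firstBox] at h1
    omega
  · subst h2
    rw [shiftE_apply, if_pos ⟨rfl, by simp only [prev]; omega⟩, sub_zero]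
  · exact absurd h4.1 h2
  · rw [shiftE_apply, if_neg, sub_zero]
    rintro ⟨h, h'⟩
    exact h2 (P.box_ext h.symm (by simp only [prev] at h'; omega))
  · have : (Finset.univ.filter fun a => x = P.firstBox a) = {x.1} := by
      ext a
      simp only [Finset.mem_filter, Finset.mem_univ, true_and, Finset.mem_singleton]
      refine ⟨fun h => by rw [h]; rfl, fun h => by rw [h]; exact P.eq_firstBox h1⟩
    simp [this]
  · rename_i h3 h4
    exact absurd ⟨h3, x.1, P.eq_firstBox h1⟩ h4
  · rename_i h3 h4
    exact absurd h4.1 h3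
  · simp

theorem selL_last_mul_shiftE_mul (N : Matrix P.Box l A) :
    selL A P.lastBox * (P.shiftE A * N) = 0 := by
  ext a b
  rw [selL_mul, Matrix.submatrix_apply, shiftE_mul, dif_neg]
  · rfl
  · have := P.pos a
    simp only [lastBox]
    omega

theorem mul_shiftE_mul_selR_first (N : Matrix l P.Box A) :
    N * P.shiftE A * selR A P.firstBox = 0 := by
  ext a b
  rw [mul_selR, Matrix.submatrix_apply, mul_shiftE, if_neg]
  · rfl
  · simp [firstBox]

/-- A matrix `f + N` becomes supported on `V₊` after restriction to the image of a resolvent. -/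
theorem mul_resolvent_right {N G : Matrix P.Box P.Box A} (h : (1 + P.shiftE A * N) * G = 1) :
    selL A P.lastBox * (G * selR A P.lastBox) = 1 ∧
    (P.shiftF A + N) * (G * selR A P.lastBox) = selR A P.firstBox *
      (selL A P.firstBox * ((P.shiftF A + N) * (G * selR A P.lastBox))) := by
  set X := G * selR A P.lastBox with hX
  have h0 : X = selR A P.lastBox - P.shiftE A * (N * X) := by
    have : (1 + P.shiftE A * N) * X = selR A P.lastBox := by
      rw [hX, ← Matrix.mul_assoc, h, Matrix.one_mul]
    rw [← this, Matrix.add_mul, Matrix.one_mul, Matrix.mul_assoc _ N]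
    abel
  have h1 : selL A P.lastBox * X = 1 := by
    rw [h0, Matrix.mul_sub, selL_last_mul_shiftE_mul, selL_mul_selR P.lastBox_injective, sub_zero]
  refine ⟨h1, ?_⟩
  -- With e the transpose of f, e(f + N)X = (1 + eN)X - 1_{V₋} = 0. The kernel of e is V₊, whose
  -- projector is 1 - fe.
  have h2 : P.shiftE A * ((P.shiftF A + N) * X) = 0 := by
    rw [Matrix.add_mul, Matrix.mul_add, ← Matrix.mul_assoc, shiftE_mul_shiftF, Matrix.sub_mul,
      Matrix.one_mul, Matrix.mul_assoc, h1, Matrix.mul_one]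
    nth_rewrite 1 [h0]
    abel
  have h3 : selR A P.firstBox * selL A P.firstBox = 1 - P.shiftF A * P.shiftE A := by
    rw [shiftF_mul_shiftE, sub_sub_cancel]
  rw [← Matrix.mul_assoc (selR _ _), h3, Matrix.sub_mul, Matrix.one_mul, Matrix.mul_assoc, h2,
    Matrix.mul_zero, sub_zero]

/-- The transposed argument: Y(f + N) is killed by e on the right, hence is supported on V₋. -/
theorem resolvent_left_mul {N G : Matrix P.Box P.Box A} (h : G * (1 + N * P.shiftE A) = 1) :
    selL A P.firstBox * G * selR A P.firstBox = 1 ∧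
    selL A P.firstBox * G * (P.shiftF A + N) =
      selL A P.firstBox * G * (P.shiftF A + N) * selR A P.lastBox * selL A P.lastBox := by
  set Y := selL A P.firstBox * G with hY
  have h0 : Y = selL A P.firstBox - Y * N * P.shiftE A := by
    have : Y * (1 + N * P.shiftE A) = selL A P.firstBox := by
      rw [hY, Matrix.mul_assoc, h, Matrix.mul_one]
    rw [← this, Matrix.mul_add, Matrix.mul_one, ← Matrix.mul_assoc Y]
    abel
  have h1 : Y * selR A P.firstBox = 1 := by
    rw [h0, Matrix.sub_mul, mul_shiftE_mul_selR_first, selL_mul_selR P.firstBox_injective, sub_zero]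
  refine ⟨h1, ?_⟩
  have h2 : Y * (P.shiftF A + N) * P.shiftE A = 0 := by
    rw [Matrix.mul_add, Matrix.add_mul, Matrix.mul_assoc, shiftF_mul_shiftE, Matrix.mul_sub,
      Matrix.mul_one, ← Matrix.mul_assoc, h1, Matrix.one_mul]
    nth_rewrite 1 [h0]
    abel
  have h3 : selR A P.lastBox * selL A P.lastBox = 1 - P.shiftE A * P.shiftF A := by
    rw [shiftE_mul_shiftF, sub_sub_cancel]
  rw [Matrix.mul_assoc _ (selR _ _), h3, Matrix.mul_sub, Matrix.mul_one, ← Matrix.mul_assoc, h2,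
    Matrix.zero_mul, sub_zero]

end Shift

/-- The generic element of `g_{≥ -1/2}`. -/
def genQ : Matrix P.Box P.Box P.Vle := Matrix.of fun x y =>
  if h : P.deg (y, x) ≤ 1 / 2 then MvPolynomial.X (⟨(y, x), h⟩, 0) else 0

theorem genQ_apply (x y : P.Box) : P.genQ x y =
  if h : P.deg (y, x) ≤ 1 / 2 then MvPolynomial.X (⟨(y, x), h⟩, 0) else 0 := rfl

theorem genQ_eq_zero {x y : P.Box} (h : P.ht x + 1 < P.ht y) : P.genQ x y = 0 := by
  rw [genQ_apply, dif_neg]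
  rw [deg_le_iff]
  simp only
  omega

theorem emb_matUnit {n : Type*} [Fintype n] [DecidableEq n] (x : n × n) :
    emb (matUnit x) = MvPolynomial.X (x, 0) := by
  rw [emb, Finset.sum_eq_single x]
  · simp [matUnit]
  · intro y _ hy
    rw [matUnit, Matrix.single_apply, if_neg, map_zero, zero_mul]
    rintro ⟨h1, h2⟩
    exact hy (Prod.ext h1.symm h2.symm)
  · simp

theorem trace_mul_matUnit {n : Type*} [Fintype n] [DecidableEq n] (a : Matrix n n ℂ) (x : n × n) :
    (a * matUnit x).trace = a x.2 x.1 := by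
  rw [matUnit, Matrix.trace_mul_single]
  simp

theorem rho_X_zero (x : P.Box × P.Box) : P.rho (MvPolynomial.X (x, 0)) =
    P.genQ x.2 x.1 + MvPolynomial.C (P.nilp x.2 x.1) := by
  rw [rho, MvPolynomial.aeval_X, if_pos rfl, trace_mul_matUnit]
  rfl

/-- `∂ + Q`. -/
def dQ : Matrix P.Box P.Box (PsiDO P.Vle) :=
  Matrix.diagonal (fun _ => D) + P.genQ.map const

theorem dQ_apply (x y : P.Box) :
    P.dQ x y = (if x = y then D else 0) + const (P.genQ x y) := by
  rw [dQ, Matrix.add_apply, Matrix.diagonal_apply, Matrix.map_apply]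

theorem const_zero {R : Type*} [CommRing R] [Differential R] : (const 0 : PsiDO R) = 0 :=
  map_zero (constHom R)

theorem dQ_eq_zero {x y : P.Box} (h : P.ht x + 1 < P.ht y) : P.dQ x y = 0 := by
  rw [dQ_apply, P.genQ_eq_zero h, if_neg (by rintro rfl; omega), const_zero, add_zero]

/-- The constant (f|E_{yx}) is the (x,y) entry of f, so ρ turns the generic matrix into f plus its
truncation Q. -/
theorem rhoA_eq : P.rhoA = P.shiftF (PsiDO P.Vle) + P.dQ := by
  ext1 x y
  have h1 : P.rhoA x y = PsiDO.map P.rho.toRingHom ((if x = y then D else 0) +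
    const (emb (matUnit (y, x)))) := rfl
  have h2 : P.nilp x y = if x.1 = y.1 ∧ (x.2 : ℕ) = (y.2 : ℕ) + 1 then 1 else 0 := rfl
  rw [h1, Matrix.add_apply, dQ_apply, emb_matUnit, shiftF_apply]
  ext n
  simp only [coeff_map, coeff_add, AlgHom.toRingHom_eq_coe, RingHom.coe_coe, map_add, const,
    coeff_mono, apply_ite (fun a => PsiDO.coeff a n), apply_ite P.rho, P.rho_X_zero, coeff_zero, D,
    coeff_one, map_one, map_zero, h2]
  split_ifs <;> simp <;> ring

/-- ∂ + Q lowers `ht` by at most 1 while the transpose of f raises it by 2. Hence 1 + e(∂ + Q) is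
inverted by a finite series of differential operators, and no ∂⁻¹ enters `T`. -/
theorem strict_shiftE_mul_dQ : Strict P.ht (P.shiftE (PsiDO P.Vle) * P.dQ) := fun x y h => by
  rw [shiftE_mul]
  split_ifs with h'
  · exact P.dQ_eq_zero (by rw [ht_next]; omega)
  · rfl

theorem strict_dQ_mul_shiftE : Strict P.ht (P.dQ * P.shiftE (PsiDO P.Vle)) := fun x y h => by
  rw [mul_shiftE]
  split_ifs with h'
  · exact P.dQ_eq_zero (by rw [P.ht_prev h']; omega)
  · rfl

theorem filLE_genQ : FilLE P.ht P.ht 1 (P.genQ.map const) := by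
  rw [filLE_iff]
  intro x y
  rw [Matrix.map_apply]
  by_cases h : P.ht x + 1 < P.ht y
  · rw [P.genQ_eq_zero h, const_zero]
    exact ordLE_zero _
  · exact (ordLE_const _).mono_right (by omega)

theorem filLE_dQ : FilLE P.ht P.ht 2 P.dQ := by
  refine FilLE.add (filLE_iff.2 fun x y => ?_) (P.filLE_genQ.mono (by omega))
  rw [Matrix.diagonal_apply]
  split_ifs with h
  · subst h
    exact ordLE_D.mono_right (by omega)
  · exact ordLE_zero _

theorem filLE_dQ_mul_shiftE : FilLE P.ht P.ht 0 (P.dQ * P.shiftE (PsiDO P.Vle)) := by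
  rw [filLE_iff]
  intro x y
  rw [mul_shiftE]
  split_ifs with h
  · refine (filLE_iff.1 P.filLE_dQ x (P.prev y)).mono_right ?_
    rw [P.ht_prev h]
    omega
  · exact ordLE_zero _

theorem diffMat_dQ : DiffMat P.dQ := fun x y => by
  rw [dQ_apply]
  refine (diffOps _).add_mem ?_ (isDiffOp_const _)
  split_ifs
  exacts [isDiffOp_D, (diffOps _).zero_mem]

theorem diffMat_shiftF : DiffMat (P.shiftF (PsiDO P.Vle)) := fun x y => by
  rw [shiftF_apply]
  split_ifs
  exacts [(diffOps _).one_mem, (diffOps _).zero_mem]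

theorem diffMat_shiftE : DiffMat (P.shiftE (PsiDO P.Vle)) := fun x y => P.diffMat_shiftF y x

/-- With all weights zero, ∂ is the only part of degree 2, and f + Q is a perturbation of degree 0.
-/
theorem isUnit_rhoA : IsUnit P.rhoA := by
  have e : P.rhoA = Matrix.diagonal (fun _ => D) + (P.shiftF (PsiDO P.Vle) + P.genQ.map const) := by
    rw [rhoA_eq, dQ]
    abel
  rw [e]
  refine (FilLE.inverse_add (d := 2) (x := fun _ => 0) (y := fun _ => 0)
    (M' := Matrix.diagonal fun _ => Dinv) ?_ ?_ ?_ ?_).1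
  · simp only [Matrix.diagonal_mul_diagonal, D_mul_Dinv, Matrix.diagonal_one]
  · simp only [Matrix.diagonal_mul_diagonal, Dinv_mul_D, Matrix.diagonal_one]
  · rw [filLE_iff]
    intro x y
    rw [Matrix.diagonal_apply]
    split_ifs
    exacts [(ordLE_mono _ _).mono_right (by omega), ordLE_zero _]
  · rw [filLE_iff]
    intro x y
    rw [Matrix.add_apply, Matrix.map_apply, shiftF_apply]
    refine OrdLE.add ?_ ((ordLE_const _).mono_right (by omega))
    split_ifs
    exacts [ordLE_one.mono_right (by omega), ordLE_zero _]

/-- Resolvents that compute the quasideterminant `T(∂)`. -/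
structure Resolvent where
  G : Matrix P.Box P.Box (PsiDO P.Vle)
  G' : Matrix P.Box P.Box (PsiDO P.Vle)
  T : Matrix (Fin r) (Fin r) (PsiDO P.Vle)
  diffMat_G : DiffMat G
  diffMat_G' : DiffMat G'
  unitri_G : Unitri P.ht G
  unitri_G' : Unitri P.ht G'
  filLE_G' : FilLE P.ht P.ht 0 G'
  sel_mul : selL (PsiDO P.Vle) P.lastBox * (G * selR (PsiDO P.Vle) P.lastBox) = 1
  mul_sel : selL (PsiDO P.Vle) P.firstBox * G' * selR (PsiDO P.Vle) P.firstBox = 1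
  rhoA_mul : P.rhoA * (G * selR (PsiDO P.Vle) P.lastBox) = selR (PsiDO P.Vle) P.firstBox * T
  mul_rhoA : selL (PsiDO P.Vle) P.firstBox * G' * P.rhoA = T * selL (PsiDO P.Vle) P.lastBox

theorem nonempty_resolvent : Nonempty P.Resolvent := by
  have u1 : Unitri P.ht (1 + P.shiftE (PsiDO P.Vle) * P.dQ) := by
    rw [Unitri, add_sub_cancel_left]
    exact P.strict_shiftE_mul_dQ
  have u2 : Unitri P.ht (1 + P.dQ * P.shiftE (PsiDO P.Vle)) := by
    rw [Unitri, add_sub_cancel_left]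
    exact P.strict_dQ_mul_shiftE
  obtain ⟨G, hG1, -, hG2, hG3⟩ := u1.exists_inverse (diffMat_one.add (P.diffMat_shiftE.mul P.diffMat_dQ))
  obtain ⟨J, -, hJ⟩ := u2.exists_geom
  set G' := ∑ j ∈ Finset.range (J + 1), (1 - (1 + P.dQ * P.shiftE (PsiDO P.Vle))) ^ j with hG'
  obtain ⟨h1, h2⟩ := P.mul_resolvent_right hG1
  obtain ⟨h3, h4⟩ := P.resolvent_left_mul hJ
  rw [← rhoA_eq] at h2 h4
  -- The right and left resolvents could define different operators; pairing one with the other and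
  -- using both normalizations shows that they define the same `T`.
  have e : selL (PsiDO P.Vle) P.firstBox * (P.rhoA * (G * selR (PsiDO P.Vle) P.lastBox)) =
      selL (PsiDO P.Vle) P.firstBox * G' * P.rhoA * selR (PsiDO P.Vle) P.lastBox := by
    calc _ = selL (PsiDO P.Vle) P.firstBox * G' * (selR (PsiDO P.Vle) P.firstBox *
        (selL (PsiDO P.Vle) P.firstBox * (P.rhoA * (G * selR (PsiDO P.Vle) P.lastBox)))) := by
          rw [← Matrix.mul_assoc _ (selR _ _), h3, Matrix.one_mul]
      _ = selL (PsiDO P.Vle) P.firstBox * G' * P.rhoA * (G * selR (PsiDO P.Vle) P.lastBox) := by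
          rw [← h2, Matrix.mul_assoc _ P.rhoA]
      _ = _ := by rw [h4, Matrix.mul_assoc _ (selL _ _), h1, Matrix.mul_one, ← h4]
  refine ⟨⟨G, G', selL (PsiDO P.Vle) P.firstBox * G' * P.rhoA * selR (PsiDO P.Vle) P.lastBox, hG3, ?_, hG2, u2.geom J, ?_,
    h1, h3, e ▸ h2, h4⟩⟩
  · exact DiffMat.sum fun j _ => (diffMat_one.sub
      (diffMat_one.add (P.diffMat_dQ.mul P.diffMat_shiftE))).pow j
  · refine FilLE.sum fun j _ => ?_
    rw [sub_add_cancel_left]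
    simpa using P.filLE_dQ_mul_shiftE.neg.pow j

variable {P}

/-- The two resolvent identities exhibit `S.T` as a left and a right inverse of 1_{V₋}(ρA)⁻¹1_{V₊}.
-/
theorem Resolvent.quasidet (S : P.Resolvent) :
    QuasidetExists P.rhoA P.firstBox P.lastBox ∧ P.opT = S.T := by
  have hA := P.isUnit_rhoA
  set B := (Ring.inverse P.rhoA).submatrix P.lastBox P.firstBox with hB
  have hB' : B = selL (PsiDO P.Vle) P.lastBox * Ring.inverse P.rhoA * selR (PsiDO P.Vle) P.firstBox := by
    rw [mul_selR, selL_mul]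
    rfl
  have r : S.T * B = 1 := by
    rw [hB', ← Matrix.mul_assoc, ← Matrix.mul_assoc, ← S.mul_rhoA, Matrix.mul_assoc _ P.rhoA,
      Ring.mul_inverse_cancel _ hA, Matrix.mul_one, S.mul_sel]
  have l : B * S.T = 1 := by
    rw [hB', Matrix.mul_assoc, ← S.rhoA_mul, ← Matrix.mul_assoc, Matrix.mul_assoc (selL (PsiDO P.Vle) _),
      Ring.inverse_mul_cancel _ hA, Matrix.mul_one, S.sel_mul]
  exact ⟨⟨hA, isUnit_of_mul_eq_one l r⟩, inverse_eq_of_mul_eq_one l r⟩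

variable (P)

/-- The solution of `(∂ + f) X = T₀` with `1_{V₋} X = 1`. -/
def solX (R : Type*) [CommRing R] [Differential R] : Matrix P.Box (Fin r) (PsiDO R) :=
  Matrix.of fun x b => if x.1 = b then (-D) ^ (P.part b - 1 - (x.2 : ℕ)) else 0

theorem solX_apply {R : Type*} [CommRing R] [Differential R] (x : P.Box) (b : Fin r) :
    P.solX R x b = if x.1 = b then (-D) ^ (P.part b - 1 - (x.2 : ℕ)) else 0 := rfl

theorem selL_mul_solX {R : Type*} [CommRing R] [Differential R] :
    selL (PsiDO R) P.lastBox * P.solX R = 1 := by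
  ext1 a b
  rw [selL_mul, Matrix.submatrix_apply, id, solX_apply, Matrix.one_apply]
  by_cases h : a = b
  · subst h
    simp [lastBox]
  · rw [if_neg h, if_neg (show (P.lastBox a).1 ≠ b from h)]

/-- Along a row, f shifts (-∂)^{i+1} onto ∂(-∂)^i and they cancel. Only the first box survives, with
∂(-∂)^{p_b - 1} = -(-∂)^{p_b}. -/
theorem mul_solX {R : Type*} [CommRing R] [Differential R] :
    (P.shiftF (PsiDO R) + Matrix.diagonal fun _ => (D : PsiDO R)) * P.solX R = selR (PsiDO R) P.firstBox * topMat R P.part := by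
  ext1 x b
  rw [Matrix.add_mul, Matrix.add_apply, shiftF_mul, Matrix.diagonal_mul, solX_apply, solX_apply]
  have h1 : (selR (PsiDO R) P.firstBox * topMat R P.part) x b =
      if x = P.firstBox b then -(-D) ^ P.part b else 0 := by
    rw [topMat, Matrix.mul_diagonal, selR, Matrix.submatrix_apply, Matrix.one_apply, id]
    split_ifs <;> simp
  rw [h1]
  have hx := x.2.2
  by_cases hb : x.1 = b
  · subst hb
    rw [if_pos rfl]
    by_cases h : 0 < (x.2 : ℕ)
    · rw [if_pos h, if_pos (show (P.prev x).1 = x.1 from rfl), if_neg]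
      · rw [show P.part x.1 - 1 - ((P.prev x).2 : ℕ) = P.part x.1 - 1 - (x.2 : ℕ) + 1 by
          simp only [prev]; omega, pow_succ']
        simp
      · intro h'
        rw [h'] at h
        simp [firstBox] at h
    · rw [if_neg h, if_pos (P.eq_firstBox h), zero_add]
      have e : P.part x.1 = P.part x.1 - 1 - (x.2 : ℕ) + 1 := by omega
      rw [congrArg (fun i => -(-D : PsiDO R) ^ i) e, pow_succ']
      simp
  · rw [if_neg hb, if_neg (show (P.prev x).1 ≠ b from hb), if_neg (show x ≠ P.firstBox b by rintro rfl; exact hb rfl)]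
    simp

/-- Applying 1_{V₊} G' ρA = T 1_{V₋} to `solX`, which is 1 on V₋, separates the contribution of ∂ +
f, the leading part, from that of Q. -/
theorem Resolvent.T_eq (S : P.Resolvent) : S.T = P.lead +
    selL (PsiDO P.Vle) P.firstBox * S.G' * (P.genQ.map const) * P.solX P.Vle := by
  have : S.T = selL (PsiDO P.Vle) P.firstBox * S.G' * P.rhoA * P.solX P.Vle := by
    rw [S.mul_rhoA, Matrix.mul_assoc, selL_mul_solX, Matrix.mul_one]
  rw [this, rhoA_eq, dQ, ← add_assoc, Matrix.mul_add, Matrix.add_mul, Matrix.mul_assoc _ _ (P.solX _),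
    mul_solX, ← Matrix.mul_assoc, S.mul_sel, Matrix.one_mul]

theorem filLE_solX : FilLE P.ht (P.ht ∘ P.lastBox) 0 (P.solX P.Vle) := by
  rw [filLE_iff]
  intro x b
  rw [solX_apply]
  split_ifs with h
  · subst h
    refine (ordLE_neg_D_pow _).mono_right ?_
    have := x.2.2
    rw [Function.comp, ht_lastBox, ht]
    omega
  · exact ordLE_zero _

/-- In the formula `T_eq`, Q has degree 1 for the weight `ht`, and G' and `solX` have degree 0.
Since `ht` is p_a - 1 on first and 1 - p_b on last boxes, the order is at most (p_a + p_b - 1)/2. -/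
theorem Resolvent.admissible (S : P.Resolvent) : P.Admissible S.T := by
  constructor
  · have : S.T = (S.G' * P.rhoA).submatrix P.firstBox P.lastBox := by
      rw [← Matrix.mul_one S.T, ← selL_mul_selR P.lastBox_injective, ← Matrix.mul_assoc,
        ← S.mul_rhoA, Matrix.mul_assoc, Matrix.mul_assoc, selL_mul, ← Matrix.mul_assoc, mul_selR]
      rfl
    rw [this, rhoA_eq]
    exact (S.diffMat_G'.mul (P.diffMat_shiftF.add P.diffMat_dQ)).submatrix _ _
  · rw [S.T_eq, add_sub_cancel_left, selL_mul]
    have := ((S.filLE_G'.submatrix P.firstBox id).mul P.filLE_genQ).mul P.filLE_solX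
    intro a b k hk
    refine this a b k ?_
    simp only [Function.comp, ht_firstBox, ht_lastBox, partZ, Pi.neg_apply] at hk ⊢
    omega

end Pyramid
end
end WGL

namespace WGL
noncomputable section
open scoped Differential

/-! ### Infinitesimal gauge transformations -/

/-! ### The operator λ + ∂ and the square-zero differential extension. -/

section LamD

variable {R : Type*} [CommRing R] [Differential R]

theorem lamD_add (p q : Polynomial R) : lamD (p + q) = lamD p + lamD q := by
  simp only [lamD, map_add, mul_add]
  abel

theorem lamD_zero : lamD (0 : Polynomial R) = 0 := by simp [lamD]

theorem lamD_C_mul (x : R) (p : Polynomial R) :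
    lamD (Polynomial.C x * p) = Polynomial.C x * lamD p + Polynomial.C x′ * p := by
  simp only [lamD, Derivation.leibniz, Differential.mapCoeffs_C, smul_eq_mul]
  ring

theorem coeff_lamD_zero (p : Polynomial R) : (lamD p).coeff 0 = (p.coeff 0)′ := by
  simp [lamD, Differential.coeff_mapCoeffs]

theorem coeff_lamD_succ (p : Polynomial R) (n : ℕ) :
    (lamD p).coeff (n + 1) = p.coeff n + (p.coeff (n + 1))′ := by
  simp [lamD, Differential.coeff_mapCoeffs]

theorem lamD_iterate_zero (n : ℕ) : lamD^[n] (0 : Polynomial R) = 0 := by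
  induction n with
  | zero => rfl
  | succ n ih => rw [Function.iterate_succ_apply', ih, lamD_zero]

theorem lamD_iterate_add (n : ℕ) (p q : Polynomial R) :
    lamD^[n] (p + q) = lamD^[n] p + lamD^[n] q := by
  induction n with
  | zero => rfl
  | succ n ih => simp only [Function.iterate_succ_apply', ih, lamD_add]

theorem lamD_iterate_sum {ι : Type*} (n : ℕ) (s : Finset ι) (p : ι → Polynomial R) :
    lamD^[n] (∑ i ∈ s, p i) = ∑ i ∈ s, lamD^[n] (p i) :=
  map_sum (⟨⟨lamD^[n], lamD_iterate_zero n⟩, lamD_iterate_add n⟩ : Polynomial R →+ Polynomial R) p s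

theorem map_lamD {S : Type*} [CommRing S] [Differential S] {φ : R →+* S}
    (hφ : ∀ x, φ x′ = (φ x)′) (p : Polynomial R) : (lamD p).map φ = lamD (p.map φ) := by
  ext n
  cases n with
  | zero => rw [Polynomial.coeff_map, coeff_lamD_zero, coeff_lamD_zero, hφ, Polynomial.coeff_map]
  | succ n =>
    rw [Polynomial.coeff_map, coeff_lamD_succ, coeff_lamD_succ, map_add, hφ, Polynomial.coeff_map,
      Polynomial.coeff_map]

theorem map_lamD_iterate {S : Type*} [CommRing S] [Differential S] {φ : R →+* S}
    (hφ : ∀ x, φ x′ = (φ x)′) (n : ℕ) (p : Polynomial R) :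
    (lamD^[n] p).map φ = lamD^[n] (p.map φ) := by
  induction n with
  | zero => rfl
  | succ n ih => rw [Function.iterate_succ_apply', map_lamD hφ, ih, Function.iterate_succ_apply']

/-- The square-zero extension `R ⊕ R[λ]`, where `λⁿ` stands for the `n`-th derivative of an
infinitesimal gauge parameter `ε`. -/
abbrev GaugeExt (R : Type*) [CommRing R] : Type _ := TrivSqZeroExt R (Polynomial R)

instance : Differential (GaugeExt R) where
  deriv := Derivation.mk' (AddMonoidHom.toIntLinearMap
    { toFun := fun s => TrivSqZeroExt.inl s.fst′ + TrivSqZeroExt.inr (lamD s.snd)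
      map_zero' := by ext <;> simp [lamD_zero]
      map_add' := fun s t => by ext1 <;> simp [lamD_add] }) (by
    intro s t
    ext1
    · simp
    · simp only [AddMonoidHom.coe_toIntLinearMap, AddMonoidHom.coe_mk, ZeroHom.coe_mk,
        TrivSqZeroExt.snd_mul, TrivSqZeroExt.fst_mul, TrivSqZeroExt.snd_add, TrivSqZeroExt.snd_inl,
        TrivSqZeroExt.snd_inr, zero_add, smul_eq_mul, TrivSqZeroExt.fst_add,
        TrivSqZeroExt.fst_inl, TrivSqZeroExt.fst_inr, add_zero, lamD_add, op_smul_eq_smul,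
        Polynomial.smul_eq_C_mul, lamD_C_mul]
      ring)

theorem deriv_gaugeExt (s : GaugeExt R) :
    s′ = TrivSqZeroExt.inl s.fst′ + TrivSqZeroExt.inr (lamD s.snd) := rfl

theorem inlHom_deriv (x : R) : TrivSqZeroExt.inlHom R (Polynomial R) x′ =
    (TrivSqZeroExt.inlHom R (Polynomial R) x)′ := by
  rw [deriv_gaugeExt]
  simp [lamD_zero]

end LamD

/-! ### Differential homomorphisms and derivations of differential polynomials. -/

section DiffPoly

variable {σ : Type*}

theorem DiffPoly.deriv_X (y : σ) (n : ℕ) :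
    (MvPolynomial.X (y, n) : DiffPoly σ)′ = MvPolynomial.X (y, n + 1) :=
  MvPolynomial.mkDerivation_X ℂ _ _

theorem DiffPoly.deriv_C (c : ℂ) : (MvPolynomial.C c : DiffPoly σ)′ = 0 :=
  MvPolynomial.derivation_C (MvPolynomial.mkDerivation ℂ fun y : σ × ℕ =>
    (MvPolynomial.X (y.1, y.2 + 1) : DiffPoly σ)) c

theorem DiffPoly.der_X (y : σ) (n : ℕ) :
    PsiDO.der n (MvPolynomial.X (y, 0) : DiffPoly σ) = MvPolynomial.X (y, n) := by
  induction n with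
  | zero => rfl
  | succ n ih => rw [PsiDO.der_succ, ih, deriv_X]

/-- A ring homomorphism that commutes with `∂` on generators commutes with `∂`. -/
theorem DiffPoly.map_deriv {S : Type*} [CommRing S] [Differential S] {φ : DiffPoly σ →+* S}
    (hC : ∀ c, (φ (MvPolynomial.C c))′ = 0)
    (hX : ∀ y n, φ (MvPolynomial.X (y, n + 1)) = (φ (MvPolynomial.X (y, n)))′) (x : DiffPoly σ) :
    φ x′ = (φ x)′ := by
  induction x using MvPolynomial.induction_on with
  | C c => rw [deriv_C, hC, map_zero]
  | add p q hp hq => rw [map_add, map_add, hp, hq, map_add, map_add]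
  | mul_X p y hp =>
    simp only [map_mul, Derivation.leibniz, smul_eq_mul, map_add, hp, ← hX, ← deriv_X]

theorem sum_vars_pderiv {M : Type*} [AddCommGroup M] [Module ℂ M] [Module (DiffPoly σ) M]
    [IsScalarTower ℂ (DiffPoly σ) M] (b : σ × ℕ → M) (G : DiffPoly σ) :
    ∑ y ∈ G.vars, MvPolynomial.pderiv y G • b y = MvPolynomial.mkDerivation ℂ b G := by
  classical
  have hsum : ∀ x, (∑ y ∈ G.vars, (LinearMap.toSpanSingleton (DiffPoly σ) M (b y)).compDer
      (MvPolynomial.pderiv y)) x = ∑ y ∈ G.vars, MvPolynomial.pderiv y x • b y := fun x =>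
    (congrFun (map_sum (Derivation.coeFnAddMonoidHom (R := ℂ) (A := DiffPoly σ) (M := M)) _ _)
      x).trans (Finset.sum_apply ..)
  rw [← hsum]
  refine MvPolynomial.derivation_eq_of_forall_mem_vars fun z hz => ?_
  rw [hsum, MvPolynomial.mkDerivation_X, Finset.sum_eq_single z]
  · simp
  · intro y _ hy
    rw [MvPolynomial.pderiv_X_of_ne hy.symm, zero_smul]
  · exact fun h => absurd hz h

end DiffPoly

/-! ### The affine bracket with a linear first argument. -/

section Affine

theorem emb_sum_smul {n : Type*} [Fintype n] (c : n × n → ℂ) (m : n × n → Matrix n n ℂ) :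
    emb (∑ x, c x • m x) = ∑ x, MvPolynomial.C (c x) * emb (m x) := by
  simp only [emb, Matrix.sum_apply, Matrix.smul_apply, map_sum, Finset.sum_mul, Finset.mul_sum,
    smul_eq_mul, map_mul, mul_assoc]
  exact Finset.sum_comm

variable {n : Type*} [Fintype n] [DecidableEq n]

theorem eq_sum_matUnit (a : Matrix n n ℂ) : a = ∑ x : n × n, a x.1 x.2 • matUnit x := by
  conv_lhs => rw [Matrix.matrix_eq_sum_single a]
  rw [Fintype.sum_prod_type]
  simp [matUnit]

theorem pderiv_emb (a : Matrix n n ℂ) (x : (n × n) × ℕ) :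
    MvPolynomial.pderiv x (emb a) = if x.2 = 0 then MvPolynomial.C (a x.1.1 x.1.2) else 0 := by
  classical
  obtain ⟨x, k⟩ := x
  simp only [emb, map_sum, MvPolynomial.pderiv_mul, MvPolynomial.pderiv_C, zero_mul, zero_add,
    MvPolynomial.pderiv_X, Pi.single_apply, Prod.mk.injEq]
  split_ifs with h
  · simp [h]
  · simp [Ne.symm h]

/-- The values `{a_λ y⁽ᵏ⁾}` for `a` in `gl` and variables `y⁽ᵏ⁾`. -/
def gaugeVar (a : Matrix n n ℂ) (y : (n × n) × ℕ) : Polynomial (DiffPoly (n × n)) :=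
  lamD^[y.2] (Polynomial.C (emb ⁅a, matUnit y.1⁆) +
    Polynomial.C (MvPolynomial.C (a * matUnit y.1).trace) * Polynomial.X)

/-- The element a involves only underived variables with constant coefficients, so no power of -λ -
∂ survives in the first argument; what is left is the Leibniz rule in the second. -/
theorem affineBracket_emb (a : Matrix n n ℂ) (G : DiffPoly (n × n)) :
    affineBracket (emb a) G = MvPolynomial.mkDerivation ℂ (gaugeVar a) G := by
  rw [← sum_vars_pderiv, affineBracket, Finset.sum_comm]
  refine Finset.sum_congr rfl fun y _ => ?_
  rw [Polynomial.smul_eq_C_mul, ← Finset.mul_sum]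
  congr 1
  rw [gaugeVar, ← lamD_iterate_sum]
  congr 1
  let g : (n × n) × ℕ → Polynomial (DiffPoly (n × n)) := fun x =>
    (fun z => -lamD z)^[x.2] (Polynomial.C (MvPolynomial.pderiv x (emb a)))
  let h : (n × n) × ℕ → Polynomial (DiffPoly (n × n)) := fun x =>
    Polynomial.C (emb ⁅matUnit x.1, matUnit y.1⁆) * g x +
      Polynomial.C (MvPolynomial.C (matUnit x.1 * matUnit y.1).trace) * lamD (g x)
  have h0 : ∀ x, MvPolynomial.pderiv x (emb a) = 0 → h x = 0 := fun x hx => by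
    have : g x = 0 := by
      simp only [g, hx, map_zero]
      exact Function.iterate_fixed (by simp [lamD_zero]) _
    simp [h, this, lamD_zero]
  let s : Finset ((n × n) × ℕ) := Finset.univ.image fun x : n × n => (x, 0)
  have h1 : ∑ x ∈ (emb a).vars, h x = ∑ x ∈ s, h x := by
    rw [Finset.sum_subset (Finset.subset_union_left (s₂ := s)) fun x _ hx =>
        h0 x (MvPolynomial.pderiv_eq_zero_of_notMem_vars hx),
      ← Finset.sum_subset (Finset.subset_union_right (s₁ := (emb a).vars)) fun x _ hx => h0 x ?_]
    rw [pderiv_emb, if_neg]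
    intro h'
    exact hx (Finset.mem_image.2 ⟨x.1, Finset.mem_univ _, Prod.ext rfl h'.symm⟩)
  refine h1.trans ?_
  rw [Finset.sum_image fun _ _ _ _ h => congrArg Prod.fst h]
  have h2 : ∀ x : n × n, h (x, 0) = Polynomial.C (MvPolynomial.C (a x.1 x.2) *
      emb ⁅matUnit x, matUnit y.1⁆) + Polynomial.C (MvPolynomial.C (a x.1 x.2 *
        (matUnit x * matUnit y.1).trace)) * Polynomial.X := fun x => by
    have : g (x, 0) = Polynomial.C (MvPolynomial.C (a x.1 x.2)) := by
      simp [g, pderiv_emb]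
    have e : lamD (Polynomial.C (MvPolynomial.C (a x.1 x.2) : DiffPoly (n × n))) =
        Polynomial.X * Polynomial.C (MvPolynomial.C (a x.1 x.2)) := by
      simp [lamD, DiffPoly.deriv_C]
    simp only [h, this, e, map_mul]
    ring
  simp only [h2]
  rw [Finset.sum_add_distrib, ← Finset.sum_mul, ← map_sum, ← map_sum, ← map_sum, ← emb_sum_smul]
  congr 3
  · simp only [Ring.lie_def]
    conv_rhs => rw [eq_sum_matUnit a, Finset.sum_mul, Finset.mul_sum, ← Finset.sum_sub_distrib]
    simp only [smul_sub, smul_mul_assoc, mul_smul_comm]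
  · conv_rhs => rw [eq_sum_matUnit a, Finset.sum_mul, Matrix.trace_sum]
    simp only [smul_mul_assoc, Matrix.trace_smul, smul_eq_mul]

end Affine
end
end WGL

namespace WGL
noncomputable section
open scoped Differential

namespace Pyramid

open PsiDO

variable {r : ℕ} (P : Pyramid r)

/-! ### The gauge action of g_{≥1/2} on ρA and on T. -/

theorem nilp_apply (x y : P.Box) :
    P.nilp x y = if x.1 = y.1 ∧ (x.2 : ℕ) = (y.2 : ℕ) + 1 then 1 else 0 := rfl

theorem nilp_eq_zero {x y : P.Box} (h : P.ht x ≠ P.ht y - 2) : P.nilp x y = 0 := by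
  rw [nilp_apply, if_neg]
  rintro ⟨h1, h2⟩
  have := congrArg P.part h1
  refine h ?_
  simp only [ht]
  omega

theorem rho_deriv (x : P.Vg) : P.rho.toRingHom x′ = (P.rho.toRingHom x)′ := by
  refine DiffPoly.map_deriv (fun c => ?_) (fun y n => ?_) x
  · have : P.rho.toRingHom (MvPolynomial.C c) = MvPolynomial.C c := P.rho.commutes c
    rw [this, DiffPoly.deriv_C]
  · change P.rho (MvPolynomial.X (y, n + 1)) = Differential.deriv (P.rho (MvPolynomial.X (y, n)))
    rw [rho, MvPolynomial.aeval_X, MvPolynomial.aeval_X, map_add, if_neg (Nat.succ_ne_zero n),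
      add_zero]
    have : ((if n = 0 then MvPolynomial.C (P.nilp * matUnit y).trace else 0 : P.Vle))′ = 0 := by
      split_ifs
      · exact DiffPoly.deriv_C _
      · exact map_zero _
    rw [this, add_zero]
    split_ifs
    · exact (DiffPoly.deriv_X _ _).symm
    · exact (map_zero _).symm

/-- The functional (f|·) is supported on g_1, which lies outside g_{≤1/2}. -/
theorem rho_incl (w : P.Vle) : P.rho (P.incl w) = w := by
  have : P.rho.comp P.incl = AlgHom.id ℂ P.Vle := by
    refine MvPolynomial.algHom_ext fun y => ?_
    obtain ⟨y, n⟩ := y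
    have hy := (P.deg_le_iff y.1).1 y.2
    rw [AlgHom.comp_apply, incl, MvPolynomial.rename_X, rho, MvPolynomial.aeval_X, dif_pos y.2,
      trace_mul_matUnit, P.nilp_eq_zero (by simp only; omega), map_zero, ite_self, add_zero]
    rfl
  exact DFunLike.congr_fun this w

/-- The entries of `f + Q`. -/
def genM (x y : P.Box) : P.Vle := P.rho (MvPolynomial.X ((y, x), 0))

theorem genM_eq (x y : P.Box) : P.genM x y = P.genQ x y + MvPolynomial.C (P.nilp x y) :=
  P.rho_X_zero (y, x)

theorem genM_eq_zero {x y : P.Box} (h : P.ht x + 2 < P.ht y) : P.genM x y = 0 := by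
  rw [genM_eq, P.genQ_eq_zero (by omega), P.nilp_eq_zero (by omega), map_zero, add_zero]

theorem rho_emb_lie (a : P.gl) (x y : P.Box) : P.rho (emb ⁅a, matUnit (y, x)⁆) =
    ∑ z, (P.genM x z * MvPolynomial.C (a z y) - MvPolynomial.C (a x z) * P.genM z y) := by
  have h1 : emb ⁅a, matUnit (y, x)⁆ = ∑ z, MvPolynomial.C (a z y) * MvPolynomial.X ((z, x), 0) -
      ∑ z, MvPolynomial.C (a x z) * MvPolynomial.X ((y, z), 0) := by
    rw [emb, Fintype.sum_prod_type]
    simp only [Ring.lie_def, Matrix.sub_apply, map_sub, sub_mul, Finset.sum_sub_distrib, matUnit]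
    congr 1
    · refine Finset.sum_congr rfl fun z _ => ?_
      rw [Finset.sum_eq_single x]
      · simp
      · intro z' _ hz
        rw [Matrix.mul_single_apply_of_ne _ _ _ _ _ hz, map_zero, zero_mul]
      · simp
    · rw [Finset.sum_eq_single y]
      · simp
      · intro z' _ hz
        refine Finset.sum_eq_zero fun z'' _ => ?_
        rw [Matrix.single_mul_apply_of_ne _ _ _ _ _ hz, map_zero, zero_mul]
      · simp
  rw [h1, map_sub, map_sum, map_sum, ← Finset.sum_sub_distrib]
  refine Finset.sum_congr rfl fun z _ => ?_
  have hC : ∀ c, P.rho (MvPolynomial.C c) = MvPolynomial.C c := P.rho.commutes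
  rw [map_mul, map_mul, hC, hC, mul_comm]
  rfl

/-- The image of `{a_λ y}` for a variable `y`. -/
def gaugeLin (a : P.gl) (x : P.Box × P.Box) : Polynomial P.Vle :=
  Polynomial.C (P.rho (emb ⁅a, matUnit x⁆)) +
    Polynomial.C (MvPolynomial.C (a * matUnit x).trace) * Polynomial.X

/-- The infinitesimal gauge transformation `w ↦ w + ρ{a_λ w}`. -/
def gaugeHom (a : P.gl) : P.Vle →+* GaugeExt P.Vle :=
  MvPolynomial.eval₂Hom ((TrivSqZeroExt.inlHom P.Vle (Polynomial P.Vle)).comp MvPolynomial.C)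
    fun y => TrivSqZeroExt.inl (MvPolynomial.X y) +
      TrivSqZeroExt.inr (lamD^[y.2] (P.gaugeLin a y.1.1))

theorem gaugeHom_C (a : P.gl) (c : ℂ) :
    P.gaugeHom a (MvPolynomial.C c) = TrivSqZeroExt.inl (MvPolynomial.C c) :=
  MvPolynomial.eval₂Hom_C ..

theorem gaugeHom_X (a : P.gl) (y) :
    P.gaugeHom a (MvPolynomial.X y) = TrivSqZeroExt.inl (MvPolynomial.X y) +
      TrivSqZeroExt.inr (lamD^[y.2] (P.gaugeLin a y.1.1)) :=
  MvPolynomial.eval₂Hom_X' ..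

/-- This is sesquilinearity {a_λ ∂w} = (λ + ∂){a_λ w}, built into the derivation of `GaugeExt`. -/
theorem gaugeHom_deriv (a : P.gl) (x : P.Vle) : P.gaugeHom a x′ = (P.gaugeHom a x)′ := by
  refine DiffPoly.map_deriv (fun c => ?_) (fun y n => ?_) x
  · rw [gaugeHom_C, deriv_gaugeExt]
    ext1
    · simp [DiffPoly.deriv_C]
    · simp [lamD_zero]
  · rw [gaugeHom_X, gaugeHom_X, deriv_gaugeExt]
    ext1
    · simp [DiffPoly.deriv_X]
    · simp [Function.iterate_succ_apply']

theorem fst_gaugeHom (a : P.gl) (w : P.Vle) : (P.gaugeHom a w).fst = w := by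
  induction w using MvPolynomial.induction_on with
  | C c => rw [gaugeHom_C, TrivSqZeroExt.fst_inl]
  | add p q hp hq => rw [map_add, TrivSqZeroExt.fst_add, hp, hq]
  | mul_X p y hp => rw [map_mul, TrivSqZeroExt.fst_mul, hp, gaugeHom_X]; simp

theorem snd_gaugeHom (a : P.gl) (w : P.Vle) :
    (P.gaugeHom a w).snd = (affineBracket (emb a) (P.incl w)).map P.rho.toRingHom := by
  have hr : ∀ x, P.rho.toRingHom (P.incl x) = x := P.rho_incl
  rw [affineBracket_emb]
  induction w using MvPolynomial.induction_on with
  | C c =>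
    have : P.incl (MvPolynomial.C c) = MvPolynomial.C c := P.incl.commutes c
    rw [this, MvPolynomial.derivation_C, gaugeHom_C, Polynomial.map_zero, TrivSqZeroExt.snd_inl]
  | add p q hp hq => rw [map_add, TrivSqZeroExt.snd_add, hp, hq, map_add, map_add,
      Polynomial.map_add]
  | mul_X p y hp =>
    have hX : P.incl (MvPolynomial.X y) = MvPolynomial.X (y.1.1, y.2) := MvPolynomial.rename_X _ _
    have hX' : P.rho.toRingHom (MvPolynomial.X (y.1.1, y.2)) = MvPolynomial.X y := by
      rw [← hX, hr]
    have hg : (gaugeVar a (y.1.1, y.2)).map P.rho.toRingHom = lamD^[y.2] (P.gaugeLin a y.1.1) := by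
      have hC : P.rho.toRingHom (MvPolynomial.C (a * matUnit y.1.1).trace) =
        MvPolynomial.C (a * matUnit y.1.1).trace := P.rho.commutes _
      rw [gaugeVar, map_lamD_iterate P.rho_deriv, Polynomial.map_add, Polynomial.map_C,
        Polynomial.map_mul, Polynomial.map_C, Polynomial.map_X, hC]
      rfl
    rw [map_mul, TrivSqZeroExt.snd_mul, hp, fst_gaugeHom, gaugeHom_X, map_mul,
      Derivation.leibniz, hX, MvPolynomial.mkDerivation_X]
    simp only [Polynomial.smul_eq_C_mul, op_smul_eq_smul, Polynomial.map_add, Polynomial.map_mul,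
      Polynomial.map_C, hr, hX', hg]
    simp

/-- Membership becomes equality of two differential ring homomorphisms at w, which can be tested on
whole operators at once. -/
theorem mem_wAlgebra {w : P.Vle} :
    w ∈ P.wAlgebra ↔ ∀ a ∈ P.gGe, P.gaugeHom a w = TrivSqZeroExt.inlHom P.Vle _ w := by
  refine forall₂_congr fun a _ => ?_
  rw [← snd_gaugeHom]
  constructor
  · intro h
    ext1
    · rw [fst_gaugeHom]; rfl
    · rw [h]; rfl
  · intro h
    rw [h]; rfl

/-- The commutator formula must hold at every entry, also where Q is truncated to zero; this is
where a ∈ g_{≥1/2} is needed. -/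
theorem gaugeHom_genM {a : P.gl} (ha : a ∈ P.gGe) (x y : P.Box) :
    P.gaugeHom a (P.genM x y) = TrivSqZeroExt.inl (P.genM x y) + TrivSqZeroExt.inr
      (Polynomial.C (∑ z, (P.genM x z * MvPolynomial.C (a z y) - MvPolynomial.C (a x z) * P.genM z y)) +
        Polynomial.C (MvPolynomial.C (a x y)) * Polynomial.X) := by
  have ha' : ∀ u v : P.Box, P.ht u - P.ht v < 1 → a u v = 0 := fun u v h => by
    by_contra h'
    have := (P.le_deg_iff (u, v)).1 (ha (u, v) h')
    simp only at this
    omega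
  rw [← rho_emb_lie, genM_eq, map_add, gaugeHom_C, genQ_apply]
  split_ifs with h
  · rw [gaugeHom_X, gaugeLin, trace_mul_matUnit]
    ext1 <;> simp
  -- At a truncated entry ht y - ht x ≥ 2. A nonzero coefficient of a uses up a height difference of
  -- the wrong sign, and f + Q vanishes when it would have to lower `ht` by more than 2.
  · have h1 : P.rho (emb ⁅a, matUnit (y, x)⁆) = 0 := by
      rw [deg_le_iff] at h
      simp only at h
      rw [rho_emb_lie]
      refine Finset.sum_eq_zero fun z _ => ?_
      have e1 : P.genM x z * MvPolynomial.C (a z y) = 0 := by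
        rcases lt_or_ge (P.ht z - P.ht y) 1 with h' | h'
        · rw [ha' _ _ h', map_zero, mul_zero]
        · rw [P.genM_eq_zero (by omega), zero_mul]
      have e2 : MvPolynomial.C (a x z) * P.genM z y = 0 := by
        rcases lt_or_ge (P.ht x - P.ht z) 1 with h' | h'
        · rw [ha' _ _ h', map_zero, zero_mul]
        · rw [P.genM_eq_zero (by omega), mul_zero]
      rw [e1, e2, sub_zero]
    have h2 : a x y = 0 := by
      rw [deg_le_iff] at h
      simp only at h
      exact ha' _ _ (by omega)
    rw [h1, h2]
    simp

theorem rhoA_eq_genM : P.rhoA = Matrix.diagonal (fun _ => D) + (Matrix.of P.genM).map const := by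
  ext1 x y
  have : const (P.nilp.map MvPolynomial.C x y : P.Vle) = P.shiftF (PsiDO P.Vle) x y := by
    rw [Matrix.map_apply, nilp_apply, shiftF_apply]
    split_ifs
    · rw [map_one]; rfl
    · rw [map_zero, const_zero]
  rw [Matrix.map_apply] at this
  rw [rhoA_eq, Matrix.add_apply, Matrix.add_apply, dQ_apply, Matrix.diagonal_apply,
    Matrix.map_apply, Matrix.of_apply, genM_eq, ← constHom_apply (_ + _), map_add, constHom_apply,
    constHom_apply, this]
  abel

/-- The infinitesimal gauge parameter `ε a`. -/
def gaugeEps (a : P.gl) : Matrix P.Box P.Box (GaugeExt P.Vle) :=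
  Matrix.of fun x y => TrivSqZeroExt.inr (Polynomial.C (MvPolynomial.C (a x y)))

/-- `1 - ε a`. -/
def gaugeMat (a : P.gl) : Matrix P.Box P.Box (PsiDO (GaugeExt P.Vle)) :=
  1 - (P.gaugeEps a).map const

theorem diag_D_mul_const {R : Type*} [CommRing R] [Differential R] {n : Type*} [Fintype n]
    [DecidableEq n] (N : Matrix n n R) : Matrix.diagonal (fun _ => D) * N.map const =
      N.map const * Matrix.diagonal (fun _ => D) + (N.map fun x => x′).map const := by
  ext1 x y
  rw [Matrix.diagonal_mul, Matrix.add_apply, Matrix.mul_diagonal]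
  exact D_mul_const _

theorem rhoA_map {S : Type*} [CommRing S] [Differential S] {φ : P.Vle →+* S}
    (hφ : ∀ x, φ x′ = (φ x)′) : P.rhoA.map (mapHom φ hφ) =
      Matrix.diagonal (fun _ => D) + ((Matrix.of P.genM).map φ).map const := by
  ext1 x y
  rw [rhoA_eq_genM, Matrix.map_apply, Matrix.add_apply, Matrix.add_apply, map_add,
    Matrix.diagonal_apply, Matrix.diagonal_apply, Matrix.map_apply, mapHom_const]
  congr 1
  split_ifs
  exacts [mapHom_D, map_zero _]

/-- The first-order form of ρA ↦ g ρA g⁻¹ with g = 1 - εa. It is exact, because ε² = 0. -/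
theorem gauge_mul {a : P.gl} (ha : a ∈ P.gGe) :
    P.rhoA.map (mapHom (P.gaugeHom a) (P.gaugeHom_deriv a)) * P.gaugeMat a =
      P.gaugeMat a * P.rhoA.map (mapHom (TrivSqZeroExt.inlHom P.Vle _) inlHom_deriv) := by
  rw [rhoA_map, rhoA_map]
  set M' := (Matrix.of P.genM).map (P.gaugeHom a)
  set M := (Matrix.of P.genM).map (TrivSqZeroExt.inlHom P.Vle (Polynomial P.Vle))
  set N := P.gaugeEps a with hN
  -- This is the zeroth-order part of the intertwining relation after ∂N = N∂ + N′. The derivative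
  -- term N′ = ε′a produces the central term λ tr(a·) of the bracket.
  have key : M' = M + (N.map fun x => x′) + M' * N - N * M := by
    ext1 x y
    have h1 : (N.map fun x => x′) x y = TrivSqZeroExt.inr
        (Polynomial.C (MvPolynomial.C (a x y)) * Polynomial.X) := by
      rw [Matrix.map_apply, hN, gaugeEps, Matrix.of_apply, deriv_gaugeExt]
      have e : lamD (Polynomial.C (MvPolynomial.C (a x y) : P.Vle)) =
          Polynomial.C (MvPolynomial.C (a x y)) * Polynomial.X := by
        rw [lamD, Differential.mapCoeffs_C, DiffPoly.deriv_C, map_zero, add_zero, mul_comm]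
      simp [e]
    have h2 : (M' * N) x y = TrivSqZeroExt.inr
        (Polynomial.C (∑ z, P.genM x z * MvPolynomial.C (a z y))) := by
      rw [Matrix.mul_apply, map_sum, ← TrivSqZeroExt.inrHom_apply P.Vle, map_sum]
      refine Finset.sum_congr rfl fun z _ => ?_
      rw [TrivSqZeroExt.inrHom_apply]
      change P.gaugeHom a (P.genM x z) * TrivSqZeroExt.inr (Polynomial.C (MvPolynomial.C (a z y))) = _
      ext1
      · simp
      · simp [fst_gaugeHom, Polynomial.smul_eq_C_mul]
    have h3 : (N * M) x y = TrivSqZeroExt.inr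
        (Polynomial.C (∑ z, MvPolynomial.C (a x z) * P.genM z y)) := by
      rw [Matrix.mul_apply, map_sum, ← TrivSqZeroExt.inrHom_apply P.Vle, map_sum]
      refine Finset.sum_congr rfl fun z _ => ?_
      rw [TrivSqZeroExt.inrHom_apply]
      change TrivSqZeroExt.inr (Polynomial.C (MvPolynomial.C (a x z))) *
        TrivSqZeroExt.inl (P.genM z y) = _
      ext1
      · simp
      · simp [Polynomial.smul_eq_C_mul, mul_comm]
    have h4 : M' x y = _ := P.gaugeHom_genM ha x y
    have h5 : M x y = TrivSqZeroExt.inl (P.genM x y) := rfl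
    rw [Matrix.sub_apply, Matrix.add_apply, Matrix.add_apply, h1, h2, h3, h4, h5,
      Finset.sum_sub_distrib, map_sub]
    ext1
    · simp
    · simp only [TrivSqZeroExt.snd_add, TrivSqZeroExt.snd_sub, TrivSqZeroExt.snd_inl,
        TrivSqZeroExt.snd_inr]
      ring
  have hc : ∀ A : Matrix P.Box P.Box (GaugeExt P.Vle), A.map const =
    (constHom (GaugeExt P.Vle)).mapMatrix A := fun A => rfl
  have hD := diag_D_mul_const N
  rw [gaugeMat, ← hN, mul_sub, mul_one, add_mul, hD, sub_mul, one_mul, mul_add]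
  simp only [hc] at *
  nth_rewrite 1 [key]
  simp only [map_add, map_sub, map_mul]
  abel

theorem unitri_gaugeMat {a : P.gl} (ha : a ∈ P.gGe) : Unitri P.ht (P.gaugeMat a) := fun x y h => by
  have : a x y = 0 := by
    by_contra h'
    have := (P.le_deg_iff (x, y)).1 (ha (x, y) h')
    simp only at this
    omega
  rw [gaugeMat, sub_sub_cancel_left, Matrix.neg_apply, Matrix.map_apply, gaugeEps, Matrix.of_apply,
    this, map_zero, map_zero, TrivSqZeroExt.inr_zero, const_zero, neg_zero]

theorem diffMat_gaugeMat (a : P.gl) : DiffMat (P.gaugeMat a) :=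
  diffMat_one.sub fun _ _ => isDiffOp_const _

variable {P}

/-- The gauge covariance of `T(∂)`. -/
theorem Resolvent.gauge (S : P.Resolvent) {a : P.gl} (ha : a ∈ P.gGe) :
    ∃ A B : Matrix (Fin r) (Fin r) (PsiDO (GaugeExt P.Vle)),
      (Unitri (fun a => (P.part a : ℤ)) B ∧ DiffMat B) ∧
      (Unitri (fun a => -(P.part a : ℤ)) A ∧ DiffMat A) ∧
      S.T.map (mapHom (P.gaugeHom a) (P.gaugeHom_deriv a)) * A =
        B * S.T.map (mapHom (TrivSqZeroExt.inlHom P.Vle _) inlHom_deriv) := by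
  set φ := mapHom (P.gaugeHom a) (P.gaugeHom_deriv a)
  set φ₀ : PsiDO P.Vle →+* PsiDO (GaugeExt P.Vle) :=
    mapHom (TrivSqZeroExt.inlHom P.Vle (Polynomial P.Vle)) inlHom_deriv
  have h1 := congrArg (fun M => M.map φ₀) S.rhoA_mul
  have h2 := congrArg (fun M => M.map φ) S.mul_rhoA
  simp only [Matrix.map_mul, selR_map, selL_map] at h1 h2
  set g := P.gaugeMat a
  have hg : P.rhoA.map φ * g = g * P.rhoA.map φ₀ := P.gauge_mul ha
  -- The gauge matrix is compressed between the resolvents: to V₋ with G of the original operator,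
  -- to V₊ with G' of the transformed one. Both products are unitriangular for `ht`, which is p_a -
  -- 1 on V₊ and 1 - p_a on V₋.
  refine ⟨selL (PsiDO (GaugeExt P.Vle)) P.lastBox * (g * S.G.map φ₀) * selR (PsiDO (GaugeExt P.Vle)) P.lastBox,
    selL (PsiDO (GaugeExt P.Vle)) P.firstBox * (S.G'.map φ * g) * selR (PsiDO (GaugeExt P.Vle)) P.firstBox, ⟨?_, ?_⟩, ⟨?_, ?_⟩, ?_⟩
  · rw [selL_mul, mul_selR]
    refine (((S.unitri_G'.map φ).mul (P.unitri_gaugeMat ha)).submatrix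
      P.firstBox_injective).of_weight fun a b h => ?_
    simp only [Function.comp, ht_firstBox]
    omega
  · rw [selL_mul, mul_selR]
    exact (((S.diffMat_G'.map _).mul (P.diffMat_gaugeMat a)).submatrix _ _).submatrix _ _
  · rw [selL_mul, mul_selR]
    refine (((P.unitri_gaugeMat ha).mul (S.unitri_G.map φ₀)).submatrix
      P.lastBox_injective).of_weight fun a b h => ?_
    simp only [Function.comp, ht_lastBox]
    omega
  · rw [selL_mul, mul_selR]
    exact (((P.diffMat_gaugeMat a).mul (S.diffMat_G.map _)).submatrix _ _).submatrix _ _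
  · calc _ = S.T.map φ * selL (PsiDO (GaugeExt P.Vle)) P.lastBox * g * (S.G.map φ₀ * selR (PsiDO (GaugeExt P.Vle)) P.lastBox) := by
          simp only [Matrix.mul_assoc]
      _ = selL (PsiDO (GaugeExt P.Vle)) P.firstBox * S.G'.map φ * (P.rhoA.map φ * g) *
          (S.G.map φ₀ * selR (PsiDO (GaugeExt P.Vle)) P.lastBox) := by rw [← h2]; simp only [Matrix.mul_assoc]
      _ = selL (PsiDO (GaugeExt P.Vle)) P.firstBox * S.G'.map φ * g * (P.rhoA.map φ₀ *
          (S.G.map φ₀ * selR (PsiDO (GaugeExt P.Vle)) P.lastBox)) := by rw [hg]; simp only [Matrix.mul_assoc]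
      _ = _ := by rw [h1]; simp only [Matrix.mul_assoc]

end Pyramid
end
end WGL

namespace WGL
noncomputable section
open scoped Differential

/-! ### The slice and the projection modulo `⟨U^⊥⟩` -/

namespace Pyramid

open PsiDO

variable {r : ℕ} (P : Pyramid r)

/-- The transposes of the matrix units that span `U`. -/
def IsU (y : P.Box × P.Box) : Prop :=
  (y.2.2 : ℕ) = 0 ∧ P.part y.1.1 ≤ (y.1.2 : ℕ) + P.part y.2.1

instance : DecidablePred P.IsU := fun y =>
  inferInstanceAs (Decidable ((y.2.2 : ℕ) = 0 ∧ P.part y.1.1 ≤ (y.1.2 : ℕ) + P.part y.2.1))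

variable {P} in
theorem IsU.deg_le {y : P.Box × P.Box} (h : P.IsU y) : P.deg y ≤ 1 / 2 := by
  rw [deg_le_iff]
  obtain ⟨h1, h2⟩ := h
  simp only [ht]
  omega

variable {P} in
theorem IsU.snd_eq {y : P.Box × P.Box} (h : P.IsU y) : y.2 = P.firstBox y.2.1 :=
  P.eq_firstBox (by rw [h.1]; exact lt_irrefl 0)

theorem nilp_eq_shiftF : P.nilp = P.shiftF ℂ := rfl

theorem lie_nilp_apply (a : P.gl) (x y : P.Box) : ⁅P.nilp, a⁆ x y =
    (if 0 < (x.2 : ℕ) then a (P.prev x) y else 0) -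
      if h : (y.2 : ℕ) + 1 < P.part y.1 then a x (P.next y h) else 0 := by
  rw [Ring.lie_def, Matrix.sub_apply, nilp_eq_shiftF, shiftF_mul, mul_shiftF]

/-- An element of `g^f` is determined by its coordinates that are dual to `U`. -/
theorem eq_zero_of_mem_gf {a : P.gl} (ha : a ∈ P.gf) (h : ∀ y, P.IsU y → a y.1 y.2 = 0) :
    a = 0 := by
  have hf : ∀ x y : P.Box, (if 0 < (x.2 : ℕ) then a (P.prev x) y else 0) =
      if h : (y.2 : ℕ) + 1 < P.part y.1 then a x (P.next y h) else 0 := fun x y => by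
    rw [← sub_eq_zero, ← lie_nilp_apply]
    exact congrFun (congrFun ha x) y
  -- Commuting with f makes entries constant along diagonals. Here the diagonal reaches the end of
  -- the row of y before that of x, where the constant value is forced to be 0.
  have low : ∀ (n : ℕ) (x y : P.Box), (y.2 : ℕ) + n + 1 = P.part y.1 →
      (x.2 : ℕ) + P.part y.1 < P.part x.1 + (y.2 : ℕ) → a x y = 0 := by
    intro n
    induction n with
    | zero =>
      intro x y h1 h2
      have hx : (x.2 : ℕ) + 1 < P.part x.1 := by omega
      have := hf (P.next x hx) y
      rw [dif_neg (by omega), if_pos (by simp [next])] at this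
      rw [← this]
      congr 1
    | succ n ih =>
      intro x y h1 h2
      have hx : (x.2 : ℕ) + 1 < P.part x.1 := by omega
      have hy : (y.2 : ℕ) + 1 < P.part y.1 := by omega
      have := hf (P.next x hx) y
      rw [dif_pos hy, if_pos (by simp [next]), ih (P.next x hx) (P.next y hy)
        (by simp only [next]; omega) (by simp only [next]; omega)] at this
      exact this
  -- Going back along a diagonal ends either at a first box of x, where the value is 0, or at a
  -- first box of y, where the entry is a U-coordinate or is covered by `low`.
  have key : ∀ (n : ℕ) (x y : P.Box), (y.2 : ℕ) = n → a x y = 0 := by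
    intro n
    induction n with
    | zero =>
      intro x y hy
      by_cases hU : P.part x.1 ≤ (x.2 : ℕ) + P.part y.1
      · exact h (x, y) ⟨hy, hU⟩
      · exact low (P.part y.1 - 1) x y (by have := P.pos y.1; omega) (by omega)
    | succ n ih =>
      intro x y hy
      have hy' : ((P.prev y).2 : ℕ) + 1 < P.part (P.prev y).1 := by
        have := y.2.2
        simp only [prev]
        omega
      have := hf x (P.prev y)
      rw [dif_pos hy'] at this
      rw [show y = P.next (P.prev y) hy' from P.box_ext rfl (by simp only [next, prev]; omega),
        ← this]
      split_ifs
      · exact ih _ _ (by simp only [prev]; omega)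
      · rfl
  ext x y
  exact key _ x y rfl

/-- The basis of `g^f` dual to `U`. -/
def fU (y : P.Box × P.Box) : P.gl := Matrix.of fun x z =>
  if x.1 = y.1.1 ∧ z.1 = y.2.1 ∧ (x.2 : ℕ) = (y.1.2 : ℕ) + (z.2 : ℕ) then 1 else 0

theorem fU_apply (y : P.Box × P.Box) (x z : P.Box) : P.fU y x z =
  if x.1 = y.1.1 ∧ z.1 = y.2.1 ∧ (x.2 : ℕ) = (y.1.2 : ℕ) + (z.2 : ℕ) then 1 else 0 := rfl

theorem fU_mem_gf {y : P.Box × P.Box} (h : P.IsU y) : P.fU y ∈ P.gf := by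
  obtain ⟨-, h2⟩ := h
  ext x z
  have hx := x.2.2
  have hz := z.2.2
  rw [lie_nilp_apply, Matrix.zero_apply, sub_eq_zero]
  by_cases h : x.1 = y.1.1 ∧ z.1 = y.2.1
  · have e1 := congrArg P.part h.1
    have e2 := congrArg P.part h.2
    simp only [fU_apply, prev, next, h, true_and]
    split_ifs <;> first | rfl | omega
  · have e1 : P.fU y (P.prev x) z = 0 := by
      rw [fU_apply, if_neg]
      exact fun h' => h ⟨h'.1, h'.2.1⟩
    have e2 : ∀ hz, P.fU y x (P.next z hz) = 0 := fun hz => by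
      rw [fU_apply, if_neg]
      exact fun h' => h ⟨h'.1, h'.2.1⟩
    simp [e1, e2]

theorem fU_apply_of_isU {y z : P.Box × P.Box} (hy : P.IsU y) (hz : P.IsU z) :
    P.fU y z.1 z.2 = if z = y then 1 else 0 := by
  rw [fU_apply]
  refine if_congr ⟨fun h => ?_, fun h => ?_⟩ rfl rfl
  · have := hy.1
    have := hz.1
    exact Prod.ext (P.box_ext h.1 (by omega)) (P.box_ext h.2.1 (by omega))
  · subst h
    have := hz.1
    exact ⟨rfl, rfl, by omega⟩

/-- The position of the coordinate dual to `f_{ab;i}`. -/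
def uPos (a b : Fin r) (i : Fin (min (P.part a) (P.part b))) : P.Box × P.Box :=
  (⟨a, ⟨P.part a - 1 - i, by have := i.2; omega⟩⟩, P.firstBox b)

theorem isU_uPos (a b : Fin r) (i : Fin (min (P.part a) (P.part b))) : P.IsU (P.uPos a b i) := by
  refine ⟨rfl, ?_⟩
  have := i.2
  simp only [uPos, firstBox]
  omega

theorem fElt_eq (a b : Fin r) (i : Fin (min (P.part a) (P.part b))) :
    P.fElt a b i = P.fU (P.uPos a b i) := by
  ext x z
  have hi := i.2
  have hx := x.2.2
  have e : P.fU (P.uPos a b i) x z =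
    if x.1 = a ∧ z.1 = b ∧ (x.2 : ℕ) = P.part a - 1 - i + (z.2 : ℕ) then 1 else 0 := rfl
  rw [fElt, Matrix.sum_apply, e]
  simp only [matUnit, Matrix.single_apply]
  by_cases h : x.1 = a ∧ z.1 = b ∧ (x.2 : ℕ) = P.part a - 1 - i + (z.2 : ℕ)
  · rw [if_pos h]
    obtain ⟨h1, h2, h3⟩ := h
    have e1 := congrArg P.part h1
    rw [Finset.sum_eq_single ⟨(z.2 : ℕ), by omega⟩, if_pos]
    · exact ⟨P.box_ext h1.symm h3.symm, P.box_ext h2.symm rfl⟩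
    · intro j _ hj
      rw [if_neg]
      rintro ⟨-, rfl⟩
      exact hj rfl
    · simp
  · rw [if_neg h]
    refine Finset.sum_eq_zero fun j _ => ?_
    rw [if_neg]
    rintro ⟨rfl, rfl⟩
    exact h ⟨rfl, rfl, rfl⟩

theorem exists_uPos {y : P.Box × P.Box} (h : P.IsU y) : ∃ a b i, y = P.uPos a b i := by
  refine ⟨y.1.1, y.2.1, ⟨P.part y.1.1 - 1 - y.1.2, ?_⟩, Prod.ext (P.box_ext rfl ?_) h.snd_eq⟩
  · have := y.1.2.2
    have := h.2
    omega
  · have := y.1.2.2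
    simp only [uPos]
    omega

theorem embLe_sum_smul {ι : Type*} (s : Finset ι) (c : ι → ℂ) (m : ι → P.gl) :
    P.embLe (∑ x ∈ s, c x • m x) = ∑ x ∈ s, MvPolynomial.C (c x) * P.embLe (m x) := by
  simp only [embLe, Matrix.sum_apply, Matrix.smul_apply, map_sum, Finset.sum_mul, Finset.mul_sum,
    smul_eq_mul, map_mul, mul_assoc]
  exact Finset.sum_comm

theorem embLe_matUnit {y : P.Box × P.Box} (h : P.deg y ≤ 1 / 2) :
    P.embLe (matUnit y) = MvPolynomial.X (⟨y, h⟩, 0) := by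
  rw [embLe, Finset.sum_eq_single ⟨y, h⟩]
  · simp [matUnit]
  · intro z _ hz
    rw [matUnit, Matrix.single_apply, if_neg, map_zero, zero_mul]
    rintro ⟨h1, h2⟩
    exact hz (Subtype.ext (Prod.ext h1.symm h2.symm))
  · simp

/-! ### Differential homomorphisms defined by their values on the slice coordinates. -/

section DiffHom

variable (g : P.Box × P.Box → P.Vle)

/-- The differential homomorphism that sends the variables dual to `U` to given elements and
all other variables to zero. -/
def sliceHom : P.Vle →ₐ[ℂ] P.Vle :=
  MvPolynomial.aeval fun y => if P.IsU y.1.1 then der y.2 (g y.1.1) else 0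

theorem sliceHom_X_of_isU {y : {x : P.Box × P.Box // P.deg x ≤ 1 / 2}} (h : P.IsU y.1) (n : ℕ) :
    P.sliceHom g (MvPolynomial.X (y, n)) = der n (g y.1) := by
  rw [sliceHom, MvPolynomial.aeval_X, if_pos h]

theorem sliceHom_X_of_not_isU {y : {x : P.Box × P.Box // P.deg x ≤ 1 / 2}} (h : ¬ P.IsU y.1)
    (n : ℕ) : P.sliceHom g (MvPolynomial.X (y, n)) = 0 := by
  rw [sliceHom, MvPolynomial.aeval_X, if_neg h]

theorem sliceHom_C (c : ℂ) : P.sliceHom g (MvPolynomial.C c) = MvPolynomial.C c :=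
  (P.sliceHom g).commutes c

theorem sliceHom_deriv (x : P.Vle) : (P.sliceHom g).toRingHom x′ = ((P.sliceHom g).toRingHom x)′ := by
  refine DiffPoly.map_deriv (fun c => ?_) (fun y n => ?_) x
  · have : (P.sliceHom g).toRingHom (MvPolynomial.C c) = MvPolynomial.C c := P.sliceHom_C g c
    rw [this, DiffPoly.deriv_C]
  · change P.sliceHom g (MvPolynomial.X (y, n + 1)) =
      Differential.deriv (P.sliceHom g (MvPolynomial.X (y, n)))
    by_cases h : P.IsU y.1
    · rw [sliceHom_X_of_isU _ _ h, sliceHom_X_of_isU _ _ h, der_succ]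
    · rw [sliceHom_X_of_not_isU _ _ h, sliceHom_X_of_not_isU _ _ h, map_zero]

theorem sliceHom_der (n : ℕ) (x : P.Vle) : P.sliceHom g (der n x) = der n (P.sliceHom g x) :=
  map_der (P.sliceHom_deriv g) n x

theorem sliceHom_embLe (a : P.gl) : P.sliceHom g (P.embLe a) =
    ∑ y ∈ Finset.univ.filter P.IsU, MvPolynomial.C (a y.1 y.2) * g y := by
  rw [embLe, map_sum]
  simp only [map_mul, sliceHom_C]
  have e : ∀ y : {x : P.Box × P.Box // P.deg x ≤ 1 / 2}, MvPolynomial.C (a y.1.1 y.1.2) *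
      P.sliceHom g (MvPolynomial.X (y, 0)) =
      (fun y : P.Box × P.Box => if P.IsU y then MvPolynomial.C (a y.1 y.2) * g y else 0) y.1 :=
    fun y => by
      by_cases h : P.IsU y.1
      · rw [sliceHom_X_of_isU _ _ h]
        simp [h]
      · rw [sliceHom_X_of_not_isU _ _ h]
        simp [h]
  rw [Finset.sum_congr rfl fun y _ => e y, Finset.sum_filter,
    sum_eq_sum_subtype (q := fun y => P.deg y ≤ 1 / 2)]
  intro y hy
  rw [if_neg fun h => hy h.deg_le]

/-- Two slice homomorphisms compose. -/
theorem sliceHom_comp (g g' : P.Box × P.Box → P.Vle)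
    (h : ∀ y, P.IsU y → P.sliceHom g (g' y) = g y) (x : P.Vle) :
    P.sliceHom g (P.sliceHom g' x) = P.sliceHom g x := by
  have : (P.sliceHom g).comp (P.sliceHom g') = P.sliceHom g := by
    refine MvPolynomial.algHom_ext fun y => ?_
    obtain ⟨y, n⟩ := y
    rw [AlgHom.comp_apply]
    by_cases hy : P.IsU y.1
    · rw [sliceHom_X_of_isU _ _ hy, sliceHom_X_of_isU _ _ hy, sliceHom_der, h _ hy]
    · rw [sliceHom_X_of_not_isU _ _ hy, sliceHom_X_of_not_isU _ _ hy, map_zero]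
  exact DFunLike.congr_fun this x

end DiffHom

/-- Restriction to the slice: all variables that are not dual to `U` are set to zero. -/
def kappa : P.Vle →ₐ[ℂ] P.Vle := P.sliceHom fun y => P.embLe (matUnit y)

theorem kappa_X_of_isU {y : {x : P.Box × P.Box // P.deg x ≤ 1 / 2}} (h : P.IsU y.1) (n : ℕ) :
    P.kappa (MvPolynomial.X (y, n)) = MvPolynomial.X (y, n) := by
  rw [kappa, sliceHom_X_of_isU _ _ h, embLe_matUnit _ y.2, DiffPoly.der_X]

theorem kappa_sliceHom {g : P.Box × P.Box → P.Vle}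
    (h : ∀ y, P.IsU y → P.kappa (g y) = P.embLe (matUnit y)) (x : P.Vle) :
    P.kappa (P.sliceHom g x) = P.kappa x := P.sliceHom_comp _ _ h x

theorem sliceHom_kappa (g : P.Box × P.Box → P.Vle) (x : P.Vle) :
    P.sliceHom g (P.kappa x) = P.sliceHom g x := by
  refine P.sliceHom_comp g _ (fun y hy => ?_) x
  rw [embLe_matUnit _ hy.deg_le, sliceHom_X_of_isU _ _ hy]
  rfl

theorem kappa_embLe_fU {y : P.Box × P.Box} (h : P.IsU y) :
    P.kappa (P.embLe (P.fU y)) = P.embLe (matUnit y) := by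
  rw [kappa, sliceHom_embLe, Finset.sum_eq_single y]
  · rw [P.fU_apply_of_isU h h, if_pos rfl, map_one, one_mul]
  · intro z hz hzy
    rw [Finset.mem_filter] at hz
    rw [P.fU_apply_of_isU h hz.2, if_neg hzy, map_zero, zero_mul]
  · intro h'
    exact absurd (Finset.mem_filter.2 ⟨Finset.mem_univ _, h⟩) h'

theorem sub_kappa_mem (x : P.Vle) : x - P.kappa x ∈
    Ideal.span (MvPolynomial.X '' {y : {x : P.Box × P.Box // P.deg x ≤ 1 / 2} × ℕ |
      ¬ P.IsU y.1.1} : Set P.Vle) := by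
  set J := Ideal.span (MvPolynomial.X '' {y : {x : P.Box × P.Box // P.deg x ≤ 1 / 2} × ℕ |
      ¬ P.IsU y.1.1} : Set P.Vle)
  have : (Ideal.Quotient.mkₐ ℂ J).comp P.kappa = Ideal.Quotient.mkₐ ℂ J := by
    refine MvPolynomial.algHom_ext fun y => ?_
    obtain ⟨y, n⟩ := y
    rw [AlgHom.comp_apply]
    by_cases hy : P.IsU y.1
    · rw [kappa_X_of_isU _ hy]
    · rw [kappa, sliceHom_X_of_not_isU _ _ hy, map_zero]
      exact (Ideal.Quotient.eq_zero_iff_mem.2 (Ideal.subset_span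
        (Set.mem_image_of_mem _ hy))).symm
  exact Ideal.Quotient.eq.1 (DFunLike.congr_fun this x).symm

theorem matUnit_mem_uPerp {y : P.Box × P.Box} (hd : P.deg y ≤ 1 / 2) (h : ¬ P.IsU y) :
    matUnit y ∈ P.uPerp := by
  constructor
  · intro x hx
    have : x = y := by
      by_contra h'
      refine hx ?_
      rw [matUnit, Matrix.single_apply, if_neg]
      rintro ⟨h1, h2⟩
      exact h' (Prod.ext h1.symm h2.symm)
    rwa [this]
  · intro u hu
    rw [Matrix.trace_mul_comm, trace_mul_matUnit]
    induction hu using Submodule.span_induction with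
    | mem u hu =>
      obtain ⟨a, b, i, rfl⟩ := hu
      rw [matUnit, Matrix.single_apply, if_neg]
      rintro ⟨h1, h2⟩
      exact h (by rw [show y = P.uPos a b i from Prod.ext h2.symm h1.symm]; exact P.isU_uPos a b i)
    | zero => rfl
    | add u v _ _ hu hv => rw [Matrix.add_apply, hu, hv, add_zero]
    | smul c u _ hu => rw [Matrix.smul_apply, hu, smul_zero]

/-- `⟨U^⊥⟩` is the kernel of the restriction to the slice. -/
theorem mem_uPerpIdeal {x : P.Vle} : x ∈ P.uPerpIdeal ↔ P.kappa x = 0 := by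
  constructor
  · intro hx
    change x ∈ RingHom.ker P.kappa
    refine Ideal.span_le.2 ?_ hx
    rintro _ ⟨u, hu, n, rfl⟩
    change P.kappa _ = 0
    rw [kappa, sliceHom_der, sliceHom_embLe, Finset.sum_eq_zero, der_zero]
    intro y hy
    rw [Finset.mem_filter] at hy
    obtain ⟨a, b, i, rfl⟩ := P.exists_uPos hy.2
    have := hu.2 (matUnit ((P.uPos a b i).2, (P.uPos a b i).1))
      (Submodule.subset_span ⟨a, b, i, rfl⟩)
    rw [trace_mul_matUnit] at this
    rw [this, map_zero, zero_mul]
  · intro hx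
    have := P.sub_kappa_mem x
    rw [hx, sub_zero] at this
    refine Ideal.span_le.2 ?_ this
    rintro _ ⟨⟨y, n⟩, hy, rfl⟩
    refine Ideal.subset_span ⟨_, P.matUnit_mem_uPerp y.2 hy, n, ?_⟩
    rw [embLe_matUnit _ y.2, DiffPoly.der_X]

theorem sub_mem_uPerpIdeal {x q : P.Vle} : x - q ∈ P.uPerpIdeal ↔ P.kappa x = P.kappa q := by
  rw [mem_uPerpIdeal, map_sub, sub_eq_zero]

/-- The section `𝒱(g)/⟨U^⊥⟩ → 𝒱(g^f)`. -/
def toGf : P.Vle →ₐ[ℂ] P.Vle := P.sliceHom fun y => P.embLe (P.fU y)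

theorem toGf_mem (x : P.Vle) : P.toGf x ∈ P.vgf := by
  induction x using MvPolynomial.induction_on with
  | C c => rw [toGf, sliceHom_C]; exact P.vgf.algebraMap_mem c
  | add p q hp hq => rw [map_add]; exact P.vgf.add_mem hp hq
  | mul_X p y hp =>
    rw [map_mul]
    refine P.vgf.mul_mem hp ?_
    obtain ⟨y, n⟩ := y
    by_cases hy : P.IsU y.1
    · rw [toGf, sliceHom_X_of_isU _ _ hy]
      exact Algebra.subset_adjoin ⟨_, P.fU_mem_gf hy, n, rfl⟩
    · rw [toGf, sliceHom_X_of_not_isU _ _ hy]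
      exact P.vgf.zero_mem

theorem kappa_toGf (x : P.Vle) : P.kappa (P.toGf x) = P.kappa x :=
  P.kappa_sliceHom (fun _ hy => P.kappa_embLe_fU hy) x

theorem toGf_kappa (x : P.Vle) : P.toGf (P.kappa x) = P.toGf x := P.sliceHom_kappa _ x

/-- The difference of the two sides is in g^f and has zero U-coordinates. -/
theorem eq_sum_fU {a : P.gl} (ha : a ∈ P.gf) :
    a = ∑ y ∈ Finset.univ.filter P.IsU, a y.1 y.2 • P.fU y := by
  refine sub_eq_zero.1 (P.eq_zero_of_mem_gf ?_ fun z hz => ?_)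
  · have h1 : P.nilp * a = a * P.nilp := sub_eq_zero.1 ha
    have h2 : ∀ y ∈ Finset.univ.filter P.IsU,
        P.nilp * (a y.1 y.2 • P.fU y) = a y.1 y.2 • P.fU y * P.nilp := fun y hy => by
      have : P.nilp * P.fU y = P.fU y * P.nilp :=
        sub_eq_zero.1 (P.fU_mem_gf (Finset.mem_filter.1 hy).2)
      rw [mul_smul_comm, this, smul_mul_assoc]
    refine sub_eq_zero.2 ?_
    rw [mul_sub, sub_mul, h1, Finset.mul_sum, Finset.sum_mul, Finset.sum_congr rfl h2]
  · rw [Matrix.sub_apply, Matrix.sum_apply, Finset.sum_eq_single z]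
    · rw [Matrix.smul_apply, P.fU_apply_of_isU hz hz, if_pos rfl, smul_eq_mul, mul_one, sub_self]
    · intro y hy hyz
      rw [Matrix.smul_apply, P.fU_apply_of_isU (Finset.mem_filter.1 hy).2 hz, if_neg hyz.symm,
        smul_zero]
    · intro h
      exact absurd (Finset.mem_filter.2 ⟨Finset.mem_univ _, hz⟩) h

theorem toGf_eq_self {q : P.Vle} (hq : q ∈ P.vgf) : P.toGf q = q := by
  have : P.vgf ≤ AlgHom.equalizer P.toGf (AlgHom.id ℂ P.Vle) := by
    refine Algebra.adjoin_le ?_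
    rintro _ ⟨a, ha, n, rfl⟩
    change P.toGf _ = der n (P.embLe a)
    rw [toGf, sliceHom_der, sliceHom_embLe]
    conv_rhs => rw [P.eq_sum_fU ha, embLe_sum_smul]
  exact this hq

theorem kappa_deriv (x : P.Vle) : P.kappa.toRingHom x′ = (P.kappa.toRingHom x)′ :=
  P.sliceHom_deriv _ x

theorem kappa_genQ (x y : P.Box) : P.kappa (P.genQ x y) =
    if P.IsU (y, x) then P.embLe (matUnit (y, x)) else 0 := by
  rw [genQ_apply]
  split_ifs with h1 h2 h2
  · rw [kappa, sliceHom_X_of_isU _ _ h2]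
    rfl
  · rw [kappa, sliceHom_X_of_not_isU _ _ h2]
  · exact absurd h2.deg_le h1
  · exact map_zero _

/-- The operator `T(∂)` on the slice. -/
theorem Resolvent.map_kappa (S : P.Resolvent) (a b : Fin r) :
    mapHom P.kappa.toRingHom P.kappa_deriv (S.T a b) = topMat P.Vle P.part a b +
      ∑ j : Fin (P.part b), const (P.kappa (P.genQ (P.firstBox a) ⟨b, j⟩)) *
        (-D) ^ (P.part b - 1 - (j : ℕ)) := by
  set φ := mapHom P.kappa.toRingHom P.kappa_deriv
  set Q : Matrix P.Box P.Box (PsiDO P.Vle) := (P.genQ.map const).map φ with hQ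
  have hQ' : ∀ x y, Q x y = const (P.kappa (P.genQ x y)) := fun x y =>
    mapHom_const (hφ := P.kappa_deriv) _
  have h0 : (P.solX P.Vle).map φ = P.solX P.Vle := by
    ext1 x b
    rw [Matrix.map_apply, solX_apply]
    split_ifs
    · rw [map_pow, map_neg, mapHom_D]
    · exact map_zero _
  have h1 := congrArg (fun M => M.map φ) S.T_eq
  have h2 := congrArg (fun M => M.map φ) S.mul_sel
  rw [Matrix.map_add _ (map_add φ)] at h1
  rw [Matrix.map_one _ (map_zero φ) (map_one φ)] at h2
  simp only [Matrix.map_mul, selR_map, selL_map] at h1 h2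
  rw [h0, ← hQ, map_topMat] at h1
  -- On the slice the rows of Q lie in V₊, so G' enters `T_eq` only through 1_{V₊} G' 1_{V₊} = 1 and
  -- disappears.
  have h3 : Q = selR (PsiDO P.Vle) P.firstBox * (selL (PsiDO P.Vle) P.firstBox * Q) := by
    have : selR (PsiDO P.Vle) P.firstBox * selL (PsiDO P.Vle) P.firstBox =
        1 - P.shiftF _ * P.shiftE _ := by rw [shiftF_mul_shiftE, sub_sub_cancel]
    rw [← Matrix.mul_assoc, this, Matrix.sub_mul, Matrix.one_mul, Matrix.mul_assoc]
    have hz : P.shiftE (PsiDO P.Vle) * Q = 0 := by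
      ext1 x y
      rw [shiftE_mul]
      split_ifs with h
      · rw [hQ', kappa_genQ, if_neg, const_zero]
        · rfl
        · rintro ⟨h', -⟩
          simp [next] at h'
      · rfl
    rw [hz, Matrix.mul_zero, sub_zero]
  rw [h3, ← Matrix.mul_assoc _ (selR _ _), h2, Matrix.one_mul, selL_mul] at h1
  have h4 := congrFun (congrFun h1 a) b
  rw [Matrix.map_apply, Matrix.add_apply] at h4
  rw [h4]
  congr 1
  rw [Matrix.mul_apply, Fintype.sum_sigma, Finset.sum_eq_single b]
  · refine Finset.sum_congr rfl fun j _ => ?_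
    rw [Matrix.submatrix_apply, id, hQ', solX_apply, if_pos rfl]
  · intro c _ hc
    refine Finset.sum_eq_zero fun j _ => ?_
    rw [solX_apply, if_neg hc, mul_zero]
  · simp

/-- The exponent p_b - 1 - j is below p_b, and the inequality p_b ≤ j + p_a in `IsU` puts it below
p_a as well. -/
theorem Resolvent.reduced_kappa (S : P.Resolvent) :
    Reduced P.part (S.T.map (mapHom P.kappa.toRingHom P.kappa_deriv)) := fun a b => by
  rw [Matrix.map_apply, S.map_kappa, add_sub_cancel_left]
  refine OrdLE.sum fun j _ => ?_
  rw [kappa_genQ]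
  split_ifs with h
  · have := h.2
    simp only [firstBox] at this
    refine ((ordLE_const _).mul (ordLE_neg_D_pow _)).mono_right ?_
    omega
  · rw [const_zero, zero_mul]
    exact ordLE_zero _

theorem coeff_const_mul_neg_D_pow {R : Type*} [CommRing R] [Differential R] (x : R) (i : ℕ) (n : ℤ) :
    (const x * (-D) ^ i).coeff n = if n = i then x * (-1) ^ i else 0 := by
  rw [coeff_const_mul, neg_D_pow, coeff_mono, mul_ite, mul_zero]

theorem Resolvent.coeff_kappa (S : P.Resolvent) (a b : Fin r)
    (i : Fin (min (P.part b) (P.part a))) :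
    P.kappa ((S.T a b - topMat P.Vle P.part a b).coeff i) =
      (-1) ^ (i : ℕ) * P.embLe (matUnit (P.uPos b a i)) := by
  have hi := i.2
  have h1 : mapHom P.kappa.toRingHom P.kappa_deriv (topMat P.Vle P.part a b) =
      topMat P.Vle P.part a b := congrFun (congrFun (map_topMat P.kappa_deriv) a) b
  have h2 : P.kappa ((S.T a b - topMat P.Vle P.part a b).coeff i) =
      (mapHom P.kappa.toRingHom P.kappa_deriv (S.T a b - topMat P.Vle P.part a b)).coeff i := rfl
  rw [h2, map_sub, h1, S.map_kappa, add_sub_cancel_left, coeff_sum,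
    -- The only box of row b that carries the exponent i.
    Finset.sum_eq_single ⟨P.part b - 1 - i, by omega⟩]
  · rw [coeff_const_mul_neg_D_pow, if_pos (by push_cast; omega), kappa_genQ, if_pos, mul_comm]
    · congr 2
      simp only
      omega
    · exact P.isU_uPos b a i
  · intro j _ hj
    rw [coeff_const_mul_neg_D_pow, if_neg]
    intro h
    refine hj (Fin.ext ?_)
    simp only
    have := j.2
    omega
  · simp

end Pyramid
end
end WGL

namespace WGL
noncomputable section
open scoped Differential

/-! ### Injectivity of the restriction of the `W`-algebra to the slice -/

/-! ### Weights of polynomials and of derivations. -/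

section Weight

variable {σ : Type*} (w : σ → ℕ)

/-- All monomials of `p` have weight at least `j`. -/
def WtGE (j : ℤ) (p : MvPolynomial σ ℂ) : Prop := ∀ d ∈ p.support, j ≤ (Finsupp.weight w d : ℕ)

variable {w} {j k : ℤ} {p q : MvPolynomial σ ℂ}

theorem WtGE.mono (h : WtGE w j p) (hk : k ≤ j) : WtGE w k p := fun d hd => hk.trans (h d hd)

theorem wtGE_of_nonpos (hj : j ≤ 0) (p : MvPolynomial σ ℂ) : WtGE w j p :=
  fun _ _ => hj.trans (Int.natCast_nonneg _)

theorem WtGE.add (hp : WtGE w j p) (hq : WtGE w j q) : WtGE w j (p + q) := by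
  classical
  intro d hd
  rcases Finset.mem_union.1 (MvPolynomial.support_add hd) with h | h
  exacts [hp d h, hq d h]

theorem WtGE.mul (hp : WtGE w j p) (hq : WtGE w k q) : WtGE w (j + k) (p * q) := by
  classical
  intro d hd
  obtain ⟨a, ha, b, hb, rfl⟩ := Finset.mem_add.1 (MvPolynomial.support_mul p q hd)
  have := hp a ha
  have := hq b hb
  rw [map_add]
  push_cast
  omega

theorem wtGE_zero : WtGE w j (0 : MvPolynomial σ ℂ) := fun d hd => by simp at hd

theorem WtGE.sum {ι : Type*} {s : Finset ι} {f : ι → MvPolynomial σ ℂ}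
    (h : ∀ i ∈ s, WtGE w j (f i)) : WtGE w j (∑ i ∈ s, f i) := by
  classical
  induction s using Finset.induction_on with
  | empty => exact wtGE_zero
  | insert i s hi ih =>
    rw [Finset.sum_insert hi]
    exact (h i (Finset.mem_insert_self _ _)).add
      (ih fun i' hi' => h i' (Finset.mem_insert_of_mem hi'))

theorem wtGE_monomial (d : σ →₀ ℕ) (c : ℂ) :
    WtGE w (Finsupp.weight w d : ℕ) (MvPolynomial.monomial d c) := fun d' hd' => by
  rw [Finset.mem_singleton.1 (MvPolynomial.support_monomial_subset hd')]

theorem wtGE_C (c : ℂ) : WtGE w 0 (MvPolynomial.C c : MvPolynomial σ ℂ) := wtGE_of_nonpos le_rfl _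

theorem wtGE_X (i : σ) : WtGE w (w i) (MvPolynomial.X i : MvPolynomial σ ℂ) := by
  have := wtGE_monomial (w := w) (Finsupp.single i 1) 1
  rwa [Finsupp.weight_single, one_smul] at this

/-- A derivation that changes the weights of variables by at least `s` changes all weights by at
least `s`. -/
theorem WtGE.derivation {s : ℤ} (E : Derivation ℂ (MvPolynomial σ ℂ) (MvPolynomial σ ℂ))
    (hE : ∀ i, WtGE w (w i + s) (E (MvPolynomial.X i))) (hp : WtGE w j p) :
    WtGE w (j + s) (E p) := by
  have e : E = MvPolynomial.mkDerivation ℂ fun i => E (MvPolynomial.X i) :=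
    MvPolynomial.derivation_ext fun i => by rw [MvPolynomial.mkDerivation_X]
  rw [p.as_sum, map_sum]
  refine WtGE.sum fun d hd => ?_
  rw [e, MvPolynomial.mkDerivation_monomial, MvPolynomial.smul_eq_C_mul]
  refine ((wtGE_C _).mul (WtGE.sum (j := j + s) fun i hi => ?_)).mono (by omega)
  refine WtGE.mono (p := MvPolynomial.monomial _ _ * _) ((wtGE_monomial _ _).mul (hE i)) ?_
  have h1 := hp d hd
  have h2 : d = (d - Finsupp.single i 1) + Finsupp.single i 1 := by
    rw [tsub_add_cancel_of_le]
    rw [Finsupp.single_le_iff]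
    exact Nat.one_le_iff_ne_zero.2 (Finsupp.mem_support_iff.1 hi)
  have h3 := congrArg (Finsupp.weight w) h2
  rw [map_add, Finsupp.weight_single, one_smul] at h3
  omega

end Weight

namespace Pyramid

open PsiDO

variable {r : ℕ} (P : Pyramid r)

/-- The subspace `g_{≥ 1/2}`. -/
def gGeSub : Submodule ℂ P.gl where
  carrier := P.gGe
  zero_mem' := fun x hx => absurd rfl hx
  add_mem' := fun {a b} ha hb x hx => by
    by_cases h : a x.1 x.2 = 0
    · refine hb x fun h' => hx ?_
      rw [Matrix.add_apply, h, h', add_zero]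
    · exact ha x h
  smul_mem' := fun c a ha x hx => ha x fun h => hx (by rw [Matrix.smul_apply, h, smul_zero])

/-- The pairing `a ↦ (f|[a,z])`. -/
def pairing (z : P.gl) : P.gl →ₗ[ℂ] ℂ where
  toFun a := (P.nilp * ⁅a, z⁆).trace
  map_add' a b := by simp only [Ring.lie_def, add_mul, mul_add, mul_sub, Matrix.trace_add,
    Matrix.trace_sub]; ring
  map_smul' c a := by simp only [Ring.lie_def, smul_mul_assoc, mul_smul_comm, ← smul_sub,
    Matrix.trace_smul, RingHom.id_apply]

theorem pairing_apply (z a : P.gl) : P.pairing z a = (P.nilp * ⁅a, z⁆).trace := rfl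

theorem pairing_eq (z a : P.gl) : P.pairing z a = -(a * ⁅P.nilp, z⁆).trace := by
  rw [pairing_apply, Ring.lie_def, Ring.lie_def, mul_sub, mul_sub, Matrix.trace_sub,
    Matrix.trace_sub, Matrix.trace_mul_comm P.nilp (a * z), mul_assoc,
    Matrix.trace_mul_comm P.nilp (z * a), mul_assoc, Matrix.trace_mul_comm z, mul_assoc]
  ring

theorem pairing_sum {ι : Type*} (s : Finset ι) (c : ι → ℂ) (z : ι → P.gl) (a : P.gl) :
    P.pairing (∑ i ∈ s, c i • z i) a = ∑ i ∈ s, c i * P.pairing (z i) a := by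
  simp only [pairing_apply, Ring.lie_def, Finset.mul_sum, Finset.sum_mul, mul_sub, mul_smul_comm,
    smul_mul_assoc, Matrix.trace_sub, Matrix.trace_sum, Matrix.trace_smul, smul_eq_mul,
    Finset.sum_sub_distrib]

/-- The variables that vanish on the slice. -/
abbrev NonU : Type := {y : P.Box × P.Box // P.deg y ≤ 1 / 2 ∧ ¬ P.IsU y}

/-- By invariance (f|[a,Z]) = -(a|[f,Z]), so the hypothesis says [f,Z] = 0. Then Z is in g^f and has
no U-coordinates, hence vanishes. -/
theorem eq_zero_of_pairing (c : P.NonU → ℂ)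
    (h : ∀ a ∈ P.gGe, P.pairing (∑ y : P.NonU, c y • matUnit y.1) a = 0) : c = 0 := by
  classical
  set Z : P.gl := ∑ y : P.NonU, c y • matUnit y.1 with hZ
  have hZ1 : ∀ y : P.NonU, Z y.1.1 y.1.2 = c y := fun y => by
    rw [hZ, Matrix.sum_apply, Finset.sum_eq_single y]
    · simp [matUnit]
    · intro z _ hz
      rw [Matrix.smul_apply, matUnit, Matrix.single_apply, if_neg, smul_zero]
      rintro ⟨h1, h2⟩
      exact hz (Subtype.ext (Prod.ext h1 h2))
    · simp
  have hZ2 : ∀ x y : P.Box, ¬ (P.deg (x, y) ≤ 1 / 2 ∧ ¬ P.IsU (x, y)) → Z x y = 0 := by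
    intro x y hxy
    rw [hZ, Matrix.sum_apply]
    refine Finset.sum_eq_zero fun z _ => ?_
    rw [Matrix.smul_apply, matUnit, Matrix.single_apply, if_neg, smul_zero]
    rintro ⟨h1, h2⟩
    have := z.2
    rw [show z.1 = (x, y) from Prod.ext h1 h2] at this
    exact hxy this
  have hZ3 : ∀ x y : P.Box, 1 < P.ht x - P.ht y → Z x y = 0 := fun x y hxy =>
    hZ2 x y fun h' => by
      have := (P.deg_le_iff _).1 h'.1
      simp only at this
      omega
  have hgf : Z ∈ P.gf := by
    ext x y
    by_contra hne
    -- [f,Z] lies in degrees ≤ -1/2, exactly the part that matrix units of g_{≥1/2} detect.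
    have hd : 1 ≤ P.ht y - P.ht x := by
      by_contra hd
      refine hne ?_
      rw [lie_nilp_apply]
      have e1 : (if 0 < (x.2 : ℕ) then Z (P.prev x) y else 0) = 0 := by
        split_ifs with h'
        · exact hZ3 _ _ (by rw [P.ht_prev h']; omega)
        · rfl
      have e2 : (if h : (y.2 : ℕ) + 1 < P.part y.1 then Z x (P.next y h) else 0) = 0 := by
        split_ifs with h'
        · exact hZ3 _ _ (by rw [P.ht_next]; omega)
        · rfl
      rw [e1, e2, sub_zero]
      rfl
    have := h (matUnit (y, x)) fun z hz => by
      rw [le_deg_iff]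
      have : z = (y, x) := by
        by_contra h'
        refine hz ?_
        rw [matUnit, Matrix.single_apply, if_neg]
        rintro ⟨h1, h2⟩
        exact h' (Prod.ext h1.symm h2.symm)
      rw [this]
      exact hd
    rw [pairing_eq, Matrix.trace_mul_comm, trace_mul_matUnit, neg_eq_zero] at this
    exact hne this
  have hZ0 := P.eq_zero_of_mem_gf hgf fun y hy => hZ2 _ _ fun h' => h'.2 hy
  ext y
  rw [← hZ1, hZ0]
  rfl

/-- A linear map onto a finite-dimensional space is surjective once its dual is injective, and
injectivity of the dual is `eq_zero_of_pairing`. -/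
theorem exists_dual (y : P.NonU) : ∃ a ∈ P.gGe, ∀ z : P.NonU,
    P.pairing (matUnit z.1) a = if z = y then 1 else 0 := by
  classical
  let Φ : P.gGeSub →ₗ[ℂ] (P.NonU → ℂ) :=
    LinearMap.pi fun z => (P.pairing (matUnit z.1)).comp P.gGeSub.subtype
  have hΦ : Function.Surjective Φ := by
    rw [← LinearMap.dualMap_injective_iff]
    rw [injective_iff_map_eq_zero]
    intro l hl
    have hl' : ∀ v, l v = ∑ z, l (Pi.single z 1) * v z := fun v => by
      conv_lhs => rw [← Finset.univ_sum_single v, map_sum]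
      refine Finset.sum_congr rfl fun z _ => ?_
      rw [mul_comm, ← smul_eq_mul, ← map_smul, ← Pi.single_smul, smul_eq_mul, mul_one]
    have hc := P.eq_zero_of_pairing (fun z => l (Pi.single z 1)) fun a ha => by
      have := LinearMap.congr_fun hl ⟨a, ha⟩
      rw [LinearMap.dualMap_apply, hl'] at this
      rw [pairing_sum]
      exact this
    ext z
    exact congrFun hc z
  obtain ⟨a, ha⟩ := hΦ (Pi.single y 1)
  refine ⟨a.1, a.2, fun z => ?_⟩
  have := congrFun ha z
  rw [Pi.single_apply] at this
  exact this

/-- The weight of variables: `n + 1` on the slice and `n + 2` off the slice. -/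
def wt (v : {x : P.Box × P.Box // P.deg x ≤ 1 / 2} × ℕ) : ℕ :=
  v.2 + 1 + if P.IsU v.1.1 then 0 else 1

theorem wtGE_deriv {j : ℤ} {p : P.Vle} (hp : WtGE P.wt j p) : WtGE P.wt (j + 1) p′ := by
  refine WtGE.derivation (MvPolynomial.mkDerivation ℂ fun y => MvPolynomial.X (y.1, y.2 + 1))
    (fun y => ?_) hp
  rw [MvPolynomial.mkDerivation_X]
  refine (wtGE_X _).mono ?_
  simp only [wt]
  push_cast
  omega

theorem wtGE_rho_emb (a : P.gl) :
    WtGE P.wt 1 (P.rho (emb a) - MvPolynomial.C (P.nilp * a).trace) := by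
  have hC : ∀ c, P.rho (MvPolynomial.C c) = MvPolynomial.C c := P.rho.commutes
  have e : P.rho (emb a) - MvPolynomial.C (P.nilp * a).trace =
      ∑ x : P.Box × P.Box, MvPolynomial.C (a x.1 x.2) * P.genQ x.2 x.1 := by
    have h1 : (P.nilp * a).trace = ∑ x : P.Box × P.Box, a x.1 x.2 * P.nilp x.2 x.1 := by
      conv_lhs => rw [eq_sum_matUnit a, Finset.mul_sum, Matrix.trace_sum]
      refine Finset.sum_congr rfl fun x _ => ?_
      rw [mul_smul_comm, Matrix.trace_smul, trace_mul_matUnit, smul_eq_mul]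
    rw [h1, emb, map_sum, map_sum, ← Finset.sum_sub_distrib]
    refine Finset.sum_congr rfl fun x _ => ?_
    rw [map_mul, hC, rho_X_zero, map_mul]
    ring
  rw [e]
  refine WtGE.sum fun x _ => ((wtGE_C _).mul (k := 1) ?_).mono (by omega)
  rw [genQ_apply]
  split_ifs
  · refine (wtGE_X _).mono ?_
    simp only [wt]
    push_cast
    omega
  · exact wtGE_zero

/-- Each ∂ raises the weight by one and each λ leaves it unchanged. The constant (f|[a,x]) is killed
by any ∂, so it survives only in λ^n. -/
theorem wtGE_coeff_lamD (a : P.gl) (x : P.Box × P.Box) (n k : ℕ) :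
    WtGE P.wt (n - k + 1) ((lamD^[n] (P.gaugeLin a x)).coeff k -
      if k = n then MvPolynomial.C (P.pairing (matUnit x) a) else 0) := by
  have hderiv : ∀ (j : ℤ) (p : P.Vle) (c : Prop) [Decidable c] (z : ℂ),
      WtGE P.wt j (p - if c then MvPolynomial.C z else 0) → WtGE P.wt (j + 1) p′ := by
    intro j p c _ z h
    have := P.wtGE_deriv h
    rw [map_sub] at this
    have e : (if c then MvPolynomial.C z else 0 : P.Vle)′ = 0 := by
      split_ifs
      · exact DiffPoly.deriv_C _
      · exact map_zero _
    rwa [e, sub_zero] at this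
  induction n generalizing k with
  | zero =>
    rw [Function.iterate_zero, id, gaugeLin, Polynomial.coeff_add, Polynomial.coeff_C_mul]
    rcases k with _ | k
    · rw [Polynomial.coeff_C_zero, Polynomial.coeff_X_zero, mul_zero, add_zero, if_pos rfl]
      exact P.wtGE_rho_emb _
    -- The central term tr(ax)λ falls here; the required weight is at most 0.
    · exact wtGE_of_nonpos (by push_cast; omega) _
  | succ n ih =>
    rw [Function.iterate_succ_apply']
    rcases k with _ | k
    · rw [coeff_lamD_zero, if_neg (by omega), sub_zero]
      exact (hderiv _ _ _ _ (ih 0)).mono (by push_cast; omega)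
    · rw [coeff_lamD_succ, add_sub_right_comm]
      refine WtGE.add ?_ ((hderiv _ _ _ _ (ih (k + 1))).mono (by push_cast; omega))
      have := ih k
      simp only [Nat.add_right_cancel_iff]
      exact this.mono (by push_cast; omega)

/-- The derivation `w ↦ coefficient of λᵏ in ρ{a_λ w}`. -/
def gaugeDer (a : P.gl) (k : ℕ) : Derivation ℂ P.Vle P.Vle :=
  MvPolynomial.mkDerivation ℂ fun v => (lamD^[v.2] (P.gaugeLin a v.1.1)).coeff k

theorem coeff_snd_gaugeHom (a : P.gl) (k : ℕ) (x : P.Vle) :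
    (P.gaugeHom a x).snd.coeff k = P.gaugeDer a k x := by
  induction x using MvPolynomial.induction_on with
  | C c => rw [gaugeHom_C, TrivSqZeroExt.snd_inl, Polynomial.coeff_zero, MvPolynomial.derivation_C]
  | add p q hp hq => rw [map_add, TrivSqZeroExt.snd_add, Polynomial.coeff_add, hp, hq, map_add]
  | mul_X p y hp =>
    rw [map_mul, TrivSqZeroExt.snd_mul, fst_gaugeHom, Polynomial.coeff_add, op_smul_eq_smul,
      Polynomial.coeff_smul, Polynomial.coeff_smul, hp, fst_gaugeHom, Derivation.leibniz]
    congr 2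
    rw [gaugeHom_X, gaugeDer, MvPolynomial.mkDerivation_X]
    simp

/-- An element of the `W`-algebra that vanishes on the slice is zero. -/
theorem eq_zero_of_kappa {x : P.Vle} (hx : x ∈ P.wAlgebra) (h : P.kappa x = 0) : x = 0 := by
  classical
  by_contra hne
  obtain ⟨d, hd, hmin⟩ := Finset.exists_min_image x.support (fun d => Finsupp.weight P.wt d)
    (MvPolynomial.support_nonempty.2 hne)
  have hmem := P.sub_kappa_mem x
  rw [h, sub_zero, MvPolynomial.mem_ideal_span_X_image] at hmem
  obtain ⟨⟨y, k⟩, hy, hdy⟩ := hmem d hd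
  -- A monomial of least weight contains an off-slice variable (y, k), and a is chosen so that only
  -- y among the off-slice directions pairs with it.
  obtain ⟨a, ha, hdual⟩ := P.exists_dual ⟨y.1, y.2, hy⟩
  have h0 : P.gaugeDer a k x = 0 := by
    rw [← coeff_snd_gaugeHom, P.mem_wAlgebra.1 hx a ha]
    simp
  -- ∂/∂y⁽ᵏ⁾ lowers weights by k + 2, and δ lowers them by at most k + 1. Slice variables may pair
  -- with a, but their weight is one less, so the constant they yield is harmless.
  set δ : Derivation ℂ P.Vle P.Vle := P.gaugeDer a k - MvPolynomial.pderiv (y, k) with hδ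
  have hδ' : ∀ v, WtGE P.wt (P.wt v + (-k - 1)) (δ (MvPolynomial.X v)) := by
    rintro ⟨z, n⟩
    have e1 : P.gaugeDer a k (MvPolynomial.X (z, n)) = (lamD^[n] (P.gaugeLin a z.1)).coeff k :=
      MvPolynomial.mkDerivation_X ..
    have key := P.wtGE_coeff_lamD a z.1 n k
    rw [hδ, Derivation.sub_apply, e1]
    by_cases hkn : k = n
    · subst hkn
      by_cases hz : P.IsU z.1
      · refine wtGE_of_nonpos ?_ _
        simp only [wt, if_pos hz]
        push_cast
        omega
      · have e2 : MvPolynomial.pderiv (y, k) (MvPolynomial.X (z, k) : P.Vle) =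
            MvPolynomial.C (P.pairing (matUnit z.1) a) := by
          rw [hdual ⟨z.1, z.2, hz⟩]
          by_cases hzy : z = y
          · subst hzy
            simp
          · rw [MvPolynomial.pderiv_X_of_ne (by simpa using hzy), if_neg, map_zero]
            intro h'
            exact hzy (Subtype.ext (congrArg (fun t => t.1) h'))
        rw [e2]
        rw [if_pos rfl] at key
        refine key.mono ?_
        simp only [wt, if_neg hz]
        push_cast
        omega
    · rw [MvPolynomial.pderiv_X_of_ne (by simp [Ne.symm hkn]), sub_zero]
      rw [if_neg hkn, sub_zero] at key
      refine key.mono ?_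
      simp only [wt]
      split_ifs <;> push_cast <;> omega
  have hδx := WtGE.derivation δ hδ' (j := (Finsupp.weight P.wt d : ℕ)) (p := x)
    fun d' hd' => by exact_mod_cast hmin d' hd'
  set m := d - Finsupp.single (y, k) 1 with hm
  have hdm : m + Finsupp.single (y, k) 1 = d := by
    rw [hm, tsub_add_cancel_of_le]
    rw [Finsupp.single_le_iff]
    exact Nat.one_le_iff_ne_zero.2 hdy
  have hwt := congrArg (Finsupp.weight P.wt) hdm
  rw [map_add, Finsupp.weight_single, one_smul] at hwt
  -- m has weight wt(d) - k - 2, one less than δx allows. Since the gauge derivation kills x, this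
  -- coefficient is minus that of ∂x/∂y⁽ᵏ⁾ at m, a nonzero multiple of the coefficient of x at d.
  have hc1 : (δ x).coeff m = 0 := by
    by_contra hc
    have := hδx m (MvPolynomial.mem_support_iff.2 hc)
    have hw : P.wt (y, k) = k + 1 + 1 := by simp only [wt, if_neg hy]
    omega
  rw [hδ, Derivation.sub_apply, h0, zero_sub, MvPolynomial.coeff_neg, neg_eq_zero,
    MvPolynomial.coeff_pderiv, hdm] at hc1
  have := MvPolynomial.mem_support_iff.1 hd
  rcases mul_eq_zero.1 hc1 with h' | h'
  · exact this h'
  · exact Nat.cast_add_one_ne_zero (m (y, k)) h'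

end Pyramid
end
end WGL

namespace WGL
noncomputable section
open scoped Differential

namespace Pyramid

open PsiDO

variable {r : ℕ} (P : Pyramid r)

/-! ### The generators of the `W`-algebra -/

theorem sub_mem_wAlgebra {x y : P.Vle} (hx : x ∈ P.wAlgebra) (hy : y ∈ P.wAlgebra) :
    x - y ∈ P.wAlgebra :=
  P.mem_wAlgebra.2 fun a ha => by
    rw [map_sub, map_sub, P.mem_wAlgebra.1 hx a ha, P.mem_wAlgebra.1 hy a ha]

theorem neg_one_pow_mul_mem_wAlgebra {x : P.Vle} (hx : x ∈ P.wAlgebra) (i : ℕ) :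
    (-1) ^ i * x ∈ P.wAlgebra := by
  rcases neg_one_pow_eq_or P.Vle i with h | h
  · rwa [h, one_mul]
  · rw [h, neg_one_mul, ← zero_sub]
    exact P.sub_mem_wAlgebra (sub_self x ▸ P.sub_mem_wAlgebra hx hx) hx

theorem eq_of_kappa_eq {x y : P.Vle} (hx : x ∈ P.wAlgebra) (hy : y ∈ P.wAlgebra)
    (h : P.kappa x = P.kappa y) : x = y :=
  sub_eq_zero.1 (P.eq_zero_of_kappa (P.sub_mem_wAlgebra hx hy) (by rw [map_sub, h, sub_self]))

/-- The `W`-algebra is an equalizer of differential homomorphisms, so it contains all differential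
polynomials in its elements. -/
theorem sliceHom_mem_wAlgebra {g : P.Box × P.Box → P.Vle}
    (hg : ∀ y, P.IsU y → g y ∈ P.wAlgebra) (x : P.Vle) : P.sliceHom g x ∈ P.wAlgebra := by
  refine P.mem_wAlgebra.2 fun a ha => ?_
  have h : (P.gaugeHom a).comp (P.sliceHom g).toRingHom =
      (TrivSqZeroExt.inlHom P.Vle (Polynomial P.Vle)).comp (P.sliceHom g).toRingHom := by
    refine MvPolynomial.ringHom_ext (fun c => ?_) fun y => ?_
    · change P.gaugeHom a (P.sliceHom g (MvPolynomial.C c)) =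
        TrivSqZeroExt.inlHom P.Vle (Polynomial P.Vle) (P.sliceHom g (MvPolynomial.C c))
      rw [sliceHom_C, gaugeHom_C]
      rfl
    · change P.gaugeHom a (P.sliceHom g (MvPolynomial.X y)) =
        TrivSqZeroExt.inlHom P.Vle (Polynomial P.Vle) (P.sliceHom g (MvPolynomial.X y))
      obtain ⟨y, n⟩ := y
      by_cases hy : P.IsU y.1
      · rw [P.sliceHom_X_of_isU g hy, map_der (P.gaugeHom_deriv a), map_der inlHom_deriv,
          P.mem_wAlgebra.1 (hg y.1 hy) a ha]
      · rw [P.sliceHom_X_of_not_isU g hy, map_zero, map_zero]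
  exact DFunLike.congr_fun h x

/-- It suffices to lift the coordinates: substituting the lifts for the coordinates in κ(x) lifts
κ(x). -/
theorem exists_mem_wAlgebra (h : ∀ a b i, ∃ c ∈ P.wAlgebra,
    P.kappa c = P.embLe (matUnit (P.uPos a b i))) (x : P.Vle) :
    ∃ w ∈ P.wAlgebra, P.kappa w = P.kappa x := by
  have h' : ∀ y, ∃ c, P.IsU y → c ∈ P.wAlgebra ∧ P.kappa c = P.embLe (matUnit y) := fun y => by
    by_cases hy : P.IsU y
    · obtain ⟨a, b, i, rfl⟩ := P.exists_uPos hy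
      obtain ⟨c, hc⟩ := h a b i
      exact ⟨c, fun _ => hc⟩
    · exact ⟨0, fun h => absurd h hy⟩
  choose g hg using h'
  exact ⟨P.sliceHom g x, P.sliceHom_mem_wAlgebra (fun y hy => (hg y hy).1) x,
    P.kappa_sliceHom (fun y hy => (hg y hy).2) x⟩

/-- A transform of `T(∂)` to reduced form has coefficients in the `W`-algebra, and the same
restriction to the slice as `T(∂)`. -/
theorem Resolvent.reduced_transform {P : Pyramid r} (S : P.Resolvent)
    {V E F : Matrix (Fin r) (Fin r) (PsiDO P.Vle)} (hV : Reduced P.part V)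
    (hE : Unitri (fun a => (P.part a : ℤ)) E ∧ DiffMat E)
    (hF : Unitri (fun a => -(P.part a : ℤ)) F ∧ DiffMat F) (h : V = E * S.T * F) :
    (∀ a b n, (V a b).coeff n ∈ P.wAlgebra) ∧
      ∀ a b n, P.kappa ((V a b).coeff n) = P.kappa ((S.T a b).coeff n) := by
  have hmap : ∀ {R : Type} [CommRing R] [Differential R] (φ : P.Vle →+* R)
      (hφ : ∀ x, φ x′ = (φ x)′), V.map (mapHom φ hφ) =
        E.map (mapHom φ hφ) * S.T.map (mapHom φ hφ) * F.map (mapHom φ hφ) := fun φ hφ => by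
    rw [h, Matrix.map_mul, Matrix.map_mul]
  constructor
  · intro a b n
    refine P.mem_wAlgebra.2 fun c hc => ?_
    obtain ⟨A, B, hB, hA, hAB⟩ := S.gauge hc
    have h1 := hV.map (P.gaugeHom_deriv c)
    have h2 := hV.map (inlHom_deriv (R := P.Vle))
    rw [hmap] at h1 h2
    -- The gauge image and the plain inclusion of V are reduced forms of operators related by
    -- `Resolvent.gauge`, hence equal.
    have key := Reduced.eq_of_equiv h2 h1 ⟨hE.1.map _, hE.2.map _⟩ ⟨hF.1.map _, hF.2.map _⟩
      ⟨hE.1.map _, hE.2.map _⟩ ⟨hF.1.map _, hF.2.map _⟩ hB hA hAB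
    rw [← hmap, ← hmap] at key
    have := congrArg (fun M => (M a b).coeff n) key
    simp only [Matrix.map_apply, coeff_mapHom] at this
    exact this.symm
  · intro a b n
    have h1 := hV.map P.kappa_deriv
    have h2 := S.reduced_kappa
    rw [hmap] at h1
    rw [← one_mul (S.T.map _), ← mul_one (1 * S.T.map _)] at h2
    -- The restriction of T to the slice is already reduced, so it is the reduced form and equals
    -- the restriction of V.
    have key := Reduced.eq_of_equiv h1 h2 ⟨hE.1.map _, hE.2.map _⟩ ⟨hF.1.map _, hF.2.map _⟩
      ⟨unitri_one, diffMat_one⟩ ⟨unitri_one, diffMat_one⟩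
      (B := 1) (A := 1) ⟨unitri_one, diffMat_one⟩ ⟨unitri_one, diffMat_one⟩
      (by rw [one_mul, mul_one])
    rw [← hmap, one_mul, mul_one] at key
    have := congrArg (fun M => (M a b).coeff n) key
    simp only [Matrix.map_apply, coeff_mapHom] at this
    exact this

theorem coeff_topMat_of_lt {a b : Fin r} {i : ℤ} (hi : i < min (P.part b) (P.part a)) :
    (topMat P.Vle P.part a b).coeff i = 0 := by
  rw [topMat, Matrix.diagonal_apply]
  split_ifs with hab
  · rw [coeff_neg, neg_D_pow, coeff_mono, if_neg (by omega), neg_zero]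
  · rfl

theorem isDiffOp_topMat (a b : Fin r) : (topMat P.Vle P.part a b).IsDiffOp := fun n hn =>
  P.coeff_topMat_of_lt (by omega)

/-- Expansion of an entry of a reduced matrix differential operator. -/
theorem Reduced.entry_eq {V : Matrix (Fin r) (Fin r) (PsiDO P.Vle)} (hV : Reduced P.part V)
    (hV' : DiffMat V) (a b : Fin r) :
    V a b = topMat P.Vle P.part a b + ∑ i : Fin (min (P.part b) (P.part a)),
      const ((-1) ^ (i : ℕ) * (V a b).coeff (i : ℕ)) * (-D) ^ (i : ℕ) := by
  rw [← sub_eq_iff_eq_add']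
  ext n : 1
  rw [coeff_sum]
  simp only [coeff_const_mul_neg_D_pow]
  by_cases hn : 0 ≤ n ∧ n < min (P.part b) (P.part a)
  · obtain ⟨i, rfl⟩ := Int.eq_ofNat_of_zero_le hn.1
    rw [Finset.sum_eq_single ⟨i, by omega⟩, if_pos rfl, coeff_sub, P.coeff_topMat_of_lt hn.2,
      sub_zero, mul_right_comm, ← pow_add, Even.neg_one_pow ⟨i, rfl⟩, one_mul]
    · intro j _ hj
      rw [if_neg fun h => hj (Fin.ext (by simpa using h.symm))]
    · exact fun h => absurd (Finset.mem_univ _) h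
  · rw [Finset.sum_eq_zero fun i _ => if_neg (by have := i.2; omega)]
    by_cases h0 : n < 0
    · rw [coeff_sub, hV' a b n h0, P.isDiffOp_topMat a b n h0, sub_zero]
    · exact hV a b n (by omega)

theorem wMap_eq {q x : P.Vle} (hx : P.IsLift q x) : P.wMap q = x := by
  have h : ∃ x, P.IsLift q x := ⟨x, hx⟩
  rw [wMap, dif_pos h]
  exact P.eq_of_kappa_eq h.choose_spec.1 hx.1 ((P.sub_mem_uPerpIdeal.1 h.choose_spec.2).trans
    (P.sub_mem_uPerpIdeal.1 hx.2).symm)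

end Pyramid
end
end WGL

/-! ### Assembly of the theorem. -/

open WGL WGL.Pyramid in
theorem mainTheorem3 {r : ℕ} (P : WGL.Pyramid r) :
    -- the projection modulo `⟨U^⊥⟩` is a bijection from the `W`-algebra onto `𝒱(g^f)`,
    -- so that `w` and the generators `w_{ab;i}` are well defined
    (∀ q ∈ P.vgf, ∃! x, P.IsLift q x) ∧
    (∀ x ∈ P.wAlgebra, ∃! q, q ∈ P.vgf ∧ P.IsLift q x) ∧
    -- `T(∂)` and all the steps of the recursion are well defined
    WGL.QuasidetExists P.rhoA P.firstBox P.lastBox ∧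
    (∀ k, 1 ≤ k → k ≤ P.numBlocks →
      (∀ a b, (P.recT k a b).IsDiffOp) ∧ IsUnit (P.recW k)) ∧
    -- the last term of the recursion
    P.recW 1 = (-P.negDPow + P.genMatrix).submatrix Subtype.val Subtype.val := by
  obtain ⟨S⟩ := P.nonempty_resolvent
  obtain ⟨hq, hST⟩ := S.quasidet
  have hT : P.Admissible P.opT := hST ▸ S.admissible
  -- For r = 0 there are no blocks; truncated subtraction gives j = 0, which the second alternative
  -- of `recAux_spec` admits.
  obtain ⟨hadm, hred, E, F, hE, hF, hV⟩ := recAux_spec hT (P.numBlocks - 1) (by omega)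
  have hred' : Reduced P.part (P.recT 1) := fun a b =>
    hred a b (by have := P.one_le_block a; omega) (by have := P.one_le_block b; omega)
  rw [hST] at hV
  obtain ⟨hW, hκ⟩ := S.reduced_transform (V := P.recT 1) hred' hE hF hV
  -- The sign converts the coefficient of ∂^i into that of (-∂)^i. These elements serve twice: as
  -- the lifts that prove existence of w, and as the generators w_{ba;i}.
  have hc : ∀ (a b : Fin r) (i : Fin (min (P.part b) (P.part a))),
      (-1) ^ (i : ℕ) * (P.recT 1 a b).coeff (i : ℕ) ∈ P.wAlgebra ∧
      P.kappa ((-1) ^ (i : ℕ) * (P.recT 1 a b).coeff (i : ℕ)) =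
        P.embLe (matUnit (P.uPos b a i)) := by
    refine fun a b i => ⟨P.neg_one_pow_mul_mem_wAlgebra (hW a b i) i, ?_⟩
    have := Resolvent.coeff_kappa P S a b i
    rw [PsiDO.coeff_sub, P.coeff_topMat_of_lt (by have := i.2; omega), sub_zero] at this
    rw [map_mul, hκ, this, map_pow, map_neg, map_one, ← mul_assoc, ← pow_add,
      Even.neg_one_pow ⟨_, rfl⟩, one_mul]
  have hlift : ∀ x, ∃ w ∈ P.wAlgebra, P.kappa w = P.kappa x :=
    P.exists_mem_wAlgebra fun a b i => ⟨_, hc b a i⟩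
  refine ⟨fun q _ => ?_, fun x hx => ?_, hq, fun k hk hk' => ?_, ?_⟩
  · obtain ⟨w, hw, hwq⟩ := hlift q
    exact ⟨w, ⟨hw, P.sub_mem_uPerpIdeal.2 hwq⟩, fun y hy =>
      P.eq_of_kappa_eq hy.1 hw ((P.sub_mem_uPerpIdeal.1 hy.2).trans hwq.symm)⟩
  · refine ⟨P.toGf x, ⟨P.toGf_mem x, hx, P.sub_mem_uPerpIdeal.2 (P.kappa_toGf x).symm⟩, ?_⟩
    rintro q ⟨hq, -, hxq⟩
    -- An element of 𝒱(g^f) is recovered from its restriction to the slice.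
    rw [← P.toGf_eq_self hq, ← P.toGf_kappa q, ← P.sub_mem_uPerpIdeal.1 hxq, P.toGf_kappa]
  · have h := (recAux_spec hT (P.numBlocks - k) (by omega)).1
    exact ⟨h.1, (h.corner k).1⟩
  · suffices h : P.recT 1 = -P.negDPow + P.genMatrix by rw [recW, h, corner]
    refine Matrix.ext fun a b => ?_
    rw [Reduced.entry_eq P hred' hadm.1 a b]
    have h1 : topMat P.Vle P.part a b = (-P.negDPow) a b := by
      rw [topMat, negDPow, Matrix.neg_apply, Matrix.diagonal_apply, Matrix.diagonal_apply]
      split_ifs <;> simp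
    rw [Matrix.add_apply, h1]
    congr 1
    refine Finset.sum_congr rfl fun i _ => ?_
    rw [wGen, P.wMap_eq (x := (-1) ^ (i : ℕ) * (P.recT 1 a b).coeff (i : ℕ))]
    refine ⟨(hc a b i).1, P.sub_mem_uPerpIdeal.2 ?_⟩
    rw [(hc a b i).2, fElt_eq, P.kappa_embLe_fU (P.isU_uPos b a i)]
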